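/- **Setting.** Let $N\ge 1$ clients hold nonempty finite data sets $\mathcal S_1^i,\mathcal S_2^i$ ($i=1,\dots,N$), let $M=\max_i|\mathcal S_1^i|$, and write $\mathbb E_{z\in\mathcal S}$ for the uniform average over $\mathcal S$. Let $h(\mathbf w,z)\in\mathbb R$ be the prediction of the model $\mathbf w\in\mathbb R^d$ on $z$, $\ell:\mathbb R^2\to\mathbb R$ and $f:\mathbb R\to\mathbb R$. Put $$F(\mathbf w)=\frac1N\sum_{i=1}^N\mathbb E_{z\in\mathcal S_1^i}f\big(g(\mathbf w,z)\big),\qquad g(\mathbf w,z)=\frac1N\sum_{j=1}^N\mathbb E_{z'\in\mathcal S_2^j}\,\ell\big(h(\mathbf w,z),h(\mathbf w,z')\big).$$ Assume that $|\ell|\le C_0$; that $\ell$ is differentiable, $C_\ell$-Lipschitz and $L_\ell$-smooth (its gradient is $L_\ell$-Lipschitz); that $f$ is differentiable, $C_f$-Lipschitz and $L_f$-smooth; and that $h(\cdot,z)$ is differentiable, $C_h$-Lipschitz and $L_h$-smooth for every data point $z$ of any client. **Algorithm FedX2** (with $\gamma,\beta,\eta>0$, $K$ local iterations in each of $R$ rounds).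 Start from arbitrary local models $\mathbf w_i^0$, with $\bar{\mathbf w}^0=\frac1N\sum_i\mathbf w_i^0$, $\bar G^0=0$ and $u_i(z)=0$ for all $z\in\mathcal S_1^i$. The records $(i,k)$, $0\le k<K$, of round $0$ are $h^0_{1,(i,k)}=h(\mathbf w^0_i,\hat z^0_{i,k,1})$, $h^0_{2,(i,k)}=h(\mathbf w_i^0,\hat z^0_{i,k,2})$ and $u^0_{(i,k)}=0$. In round $r=1,\dots,R$ client $i$ starts from $\mathbf w=\bar{\mathbf w}^{r-1}$, $G=\bar G^{r-1}$ and its own $u_i$ from the end of the previous round, and shuffles the $NK$ records of round $r-1$, uniformly and independently for the first-argument records $(h^{r-1}_1,u^{r-1})$ and for the second-argument records $h^{r-1}_2$. At iteration $k=0,\dots,K-1$ it takes the next record $\zeta$ of the former and $\xi$ of the latter, samples $z_1\in\mathcal S_1^i$, $z_2\in\mathcal S_2^i$, and performs $$u_i(z_1)\leftarrow(1-\gamma)u_i(z_1)+\gamma\,\ell\big(h(\mathbf w,z_1),h^{r-1}_{2,\xi}\big),$$ $$G\leftarrow(1-\beta)G+\beta\Big(f'(u_i(z_1))\,\partial_1\ell\big(h(\mathbf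 w,z_1),h^{r-1}_{2,\xi}\big)\nabla h(\mathbf w,z_1)+f'(u^{r-1}_\zeta)\,\partial_2\ell\big(h^{r-1}_{1,\zeta},h(\mathbf w,z_2)\big)\nabla h(\mathbf w,z_2)\Big),$$ $$\mathbf w\leftarrow\mathbf w-\eta G .$$ It also records, for separately sampled points $\hat z^r_{i,k,1}\in\mathcal S_1^i$, $\hat z^r_{i,k,2}\in\mathcal S_2^i$, the values $h^r_{1,(i,k)}=h(\mathbf w,\hat z^r_{i,k,1})$ and $h^r_{2,(i,k)}=h(\mathbf w,\hat z^r_{i,k,2})$ (with the model before the update) and $u^r_{(i,k)}=u_i(\hat z^r_{i,k,1})$ (after the update of $u_i$). At the end of the round $\bar{\mathbf w}^r$ and $\bar G^r$ are the averages over the clients of the final $\mathbf w$ and $G$. All samples are uniform with replacement, and all samples and shuffles are independent. **Theorem.** For all $c_\gamma,c_\beta,c_K>0$ there is $c_0>0$ such that for all $c_\eta\in(0,c_0]$ there are constants $C_1,C_2,C_3>0$ with the following property; $c_0$ depends only on $C_0,C_\ell,L_\ell,C_f,L_f,C_h,L_h,c_\gamma,c_\beta,c_K$, and $C_1,C_2,C_3$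 only on these and $c_\eta$ (not on $N$, $d$, the data, $M$, $R$ or the initial models). With $$\gamma=c_\gamma\frac{M^{1/3}}{R^{2/3}},\quad \beta=\frac{c_\beta}{M^{1/6}R^{2/3}},\quad \eta=\frac{c_\eta}{M^{2/3}R^{2/3}},\quad K=\big\lceil c_KM^{1/3}R^{1/3}\big\rceil,$$ FedX2 satisfies, for every $R\ge1$, $$\mathbb E\Big[\frac1R\sum_{r=1}^R\|\nabla F(\bar{\mathbf w}^r)\|^2\Big]\le C_1\frac{M^{1/3}}{R^{2/3}}$$ (so it is $O(1/R^{2/3})$ for fixed $M$). Moreover, for every $\varepsilon\in(0,1]$, with $R=\lceil C_2\sqrt M/\varepsilon^3\rceil$ rounds the left-hand side is at most $\varepsilon^2$, and each machine samples $2K+4RK\le C_3M/\varepsilon^4$ data points in total. -/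

import Mathlib

open scoped BigOperators NNReal

noncomputable section

namespace FedX

/-- The model space `ℝ^d` with its Euclidean norm. -/
abbrev Vec (d : ℕ) : Type := EuclideanSpace ℝ (Fin d)

/-- Data of a federated compositional pairwise risk problem with `N` clients and models in `ℝ^d`:
client `i` holds the nonempty finite data sets `S1 i` and `S2 i`; `h w z` is the (scalar) prediction
of model `w` on the data point `z`; `ℓ` is the pairwise loss, a function of two predictions; `f` is
the outer function. -/
structure Problem (N d : ℕ) (Z : Type*) where
  S1 : Fin N → Finset Z
  S2 : Fin N → Finset Z
  nonempty1 : ∀ i, (S1 i).Nonempty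
  nonempty2 : ∀ i, (S2 i).Nonempty
  h : Vec d → Z → ℝ
  ℓ : Vec 2 → ℝ
  f : ℝ → ℝ

/-- `φ` is differentiable, `C`-Lipschitz and `L`-smooth (its gradient is `L`-Lipschitz). -/
structure SmoothLipschitz {n : ℕ} (C L : ℝ≥0) (φ : Vec n → ℝ) : Prop where
  differentiable : Differentiable ℝ φ
  lipschitz : LipschitzWith C φ
  smooth : LipschitzWith L (gradient φ)

namespace Problem

/-- The regularity of the loss, of the outer function and of the predictions. -/
structure Regular {N d : ℕ} {Z : Type*} (P : Problem N d Z)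
    (C₀ Cℓ Lℓ Cf Lf Ch Lh : ℝ≥0) : Prop where
  loss_bound : ∀ x, |P.ℓ x| ≤ C₀
  loss : SmoothLipschitz Cℓ Lℓ P.ℓ
  outer_differentiable : Differentiable ℝ P.f
  outer_lipschitz : LipschitzWith Cf P.f
  outer_smooth : LipschitzWith Lf (deriv P.f)
  predict1 : ∀ i, ∀ z ∈ P.S1 i, SmoothLipschitz Ch Lh (fun w => P.h w z)
  predict2 : ∀ i, ∀ z ∈ P.S2 i, SmoothLipschitz Ch Lh (fun w => P.h w z)

/-- The inner function `g(w, z, S₂) = (1/N) ∑_j E_{z' ∈ S₂^j} ℓ(h(w,z), h(w,z'))`.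
Here `𝔼` is the uniform average over a finite set. -/
def innerRisk {N d : ℕ} {Z : Type*} (P : Problem N d Z) (w : Vec d) (z : Z) : ℝ :=
  𝔼 j : Fin N, 𝔼 z' ∈ P.S2 j, P.ℓ !₂[P.h w z, P.h w z']

/-- The objective `F(w) = (1/N) ∑_i E_{z ∈ S₁^i} f(g(w, z, S₂))`. -/
def risk {N d : ℕ} {Z : Type*} (P : Problem N d Z) (w : Vec d) : ℝ :=
  𝔼 i : Fin N, 𝔼 z ∈ P.S1 i, P.f (P.innerRisk w z)

/-- `M = max_i |S₁^i|`. -/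
def maxData {N d : ℕ} {Z : Type*} (P : Problem N d Z) : ℕ :=
  Finset.univ.sup fun i => (P.S1 i).card

/-- The partial derivative of the loss in its first argument, at the pair `(a, b)`. -/
def lossDeriv1 {N d : ℕ} {Z : Type*} (P : Problem N d Z) (a b : ℝ) : ℝ :=
  gradient P.ℓ !₂[a, b] 0

/-- The partial derivative of the loss in its second argument, at the pair `(a, b)`. -/
def lossDeriv2 {N d : ℕ} {Z : Type*} (P : Problem N d Z) (a b : ℝ) : ℝ :=
  gradient P.ℓ !₂[a, b] 1

/-- The gradient of the prediction `h(·, z)` at the model `w`. -/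
def predictGrad {N d : ℕ} {Z : Type*} (P : Problem N d Z) (w : Vec d) (z : Z) : Vec d :=
  gradient (fun v => P.h v z) w

/-- All the randomness of one round with `K` local iterations on each client:
* the training samples `(z_{i,k,1}, z_{i,k,2}) ∈ S₁^i × S₂^i`;
* the separate samples `(ẑ_{i,k,1}, ẑ_{i,k,2}) ∈ S₁^i × S₂^i`, whose predictions are communicated;
* for each client, the first `K` entries of a shuffle of the `N K` records in the buffer `B_{i,1}`
  (and, in the same order, `C_i`), and of a shuffle of the buffer `B_{i,2}`. A record is addressed by
  the client and the iteration at which it was computed, and the first `K` entries of a uniform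
  shuffle are a uniform injection. -/
abbrev RoundSample {N d : ℕ} {Z : Type*} (P : Problem N d Z) (K : ℕ) : Type _ :=
  (∀ i : Fin N, Fin K → P.S1 i × P.S2 i) × (∀ i : Fin N, Fin K → P.S1 i × P.S2 i) ×
    (Fin N → Fin K ↪ Fin N × Fin K) × (Fin N → Fin K ↪ Fin N × Fin K)

/-- The randomness of a whole run: round `0` (initial predictions) and rounds `1, …, R`. The uniform
distribution on this finite product makes all draws uniform and independent. -/
abbrev RunSample {N d : ℕ} {Z : Type*} (P : Problem N d Z) (R K : ℕ) : Type _ :=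
  Fin (R + 1) → P.RoundSample K

end Problem

/-- The training samples `(z_{i,k,1}, z_{i,k,2})` of a round. -/
def train {N d : ℕ} {Z : Type*} {P : Problem N d Z} {K : ℕ} (s : P.RoundSample K)
    (i : Fin N) (k : Fin K) : P.S1 i × P.S2 i := s.1 i k

/-- The samples `(ẑ_{i,k,1}, ẑ_{i,k,2})` of a round, whose predictions are communicated. -/
def sent {N d : ℕ} {Z : Type*} {P : Problem N d Z} {K : ℕ} (s : P.RoundSample K)
    (i : Fin N) (k : Fin K) : P.S1 i × P.S2 i := s.2.1 i k

/-- The records that client `i` takes from `B_{i,1}` and `C_i` in a round, in order. -/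
def shuffle1 {N d : ℕ} {Z : Type*} {P : Problem N d Z} {K : ℕ} (s : P.RoundSample K)
    (i : Fin N) : Fin K ↪ Fin N × Fin K := s.2.2.1 i

/-- The records that client `i` takes from `B_{i,2}` in a round, in order. -/
def shuffle2 {N d : ℕ} {Z : Type*} {P : Problem N d Z} {K : ℕ} (s : P.RoundSample K)
    (i : Fin N) : Fin K ↪ Fin N × Fin K := s.2.2.2 i

/-- The step sizes of the algorithm: `γ` for the inner estimators, `β` for the gradient estimators,
`η` for the models. -/
structure Rates where
  γ : ℝ
  β : ℝ
  η : ℝ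

/-- The local variables of a client with first data set `S`: its model `w`, its inner estimators
`u(z)`, `z ∈ S`, and its gradient estimator `G`. -/
structure Local (d : ℕ) {Z : Type*} (S : Finset Z) where
  w : Vec d
  u : S → ℝ
  G : Vec d

/-- What is kept at the end of a round: the averaged model `w̄` and gradient estimator `Ḡ`, the inner
estimators `u` of every client, and the communicated records (indexed by client and iteration): the
predictions on `ẑ_{·,1}` and `ẑ_{·,2}`, and the inner estimators at `ẑ_{·,1}`. -/
structure Global {N d : ℕ} {Z : Type*} (P : Problem N d Z) (K : ℕ) where
  w : Vec d
  G : Vec d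
  u : ∀ i, P.S1 i → ℝ
  H1 : Fin N × Fin K → ℝ
  H2 : Fin N × Fin K → ℝ
  U : Fin N × Fin K → ℝ

open Classical in
/-- One local iteration of client `i`. The pair `z` is the training sample, `h2` the lazy prediction
`h_{2,ξ}`, and `h1`, `u1` the lazy prediction `h_{1,ζ}` and inner estimator `u_ζ`. -/
def localStep {N d : ℕ} {Z : Type*} (P : Problem N d Z) (θ : Rates) {i : Fin N}
    (z : P.S1 i × P.S2 i) (h2 h1 u1 : ℝ) (x : Local d (P.S1 i)) : Local d (P.S1 i) :=
  let a := P.h x.w z.1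
  let b := P.h x.w z.2
  let u := Function.update x.u z.1 ((1 - θ.γ) * x.u z.1 + θ.γ * P.ℓ !₂[a, h2])
  let G1 := (deriv P.f (u z.1) * P.lossDeriv1 a h2) • P.predictGrad x.w z.1
  let G2 := (deriv P.f u1 * P.lossDeriv2 h1 b) • P.predictGrad x.w z.2
  let G := (1 - θ.β) • x.G + θ.β • (G1 + G2)
  { w := x.w - θ.η • G, u := u, G := G }

/-- The local variables of client `i` after `k` iterations (`k ≤ K`) of a round that starts from the
communicated state `g`; the lazy quantities come from the records in `g`. -/
def localRun {N d : ℕ} {Z : Type*} (P : Problem N d Z) (θ : Rates) {K : ℕ} (s : P.RoundSample K)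
    (g : Global P K) (i : Fin N) : ℕ → Local d (P.S1 i)
  | 0 => { w := g.w, u := g.u i, G := g.G }
  | k + 1 =>
    if hk : k < K then
      let ξ := shuffle2 s i ⟨k, hk⟩
      let ζ := shuffle1 s i ⟨k, hk⟩
      localStep P θ (train s i ⟨k, hk⟩) (g.H2 ξ) (g.H1 ζ) (g.U ζ) (localRun P θ s g i k)
    else localRun P θ s g i k

/-- One round. The record of client `j` at iteration `t` holds the predictions of the model before
the update at iteration `t`, and the inner estimator after it. -/
def nextRound {N d : ℕ} {Z : Type*} (P : Problem N d Z) (θ : Rates) {K : ℕ} (s : P.RoundSample K)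
    (g : Global P K) : Global P K where
  w := 𝔼 i : Fin N, (localRun P θ s g i K).w
  G := 𝔼 i : Fin N, (localRun P θ s g i K).G
  u := fun i => (localRun P θ s g i K).u
  H1 := fun p => P.h (localRun P θ s g p.1 p.2).w (sent s p.1 p.2).1
  H2 := fun p => P.h (localRun P θ s g p.1 p.2).w (sent s p.1 p.2).2
  U := fun p => (localRun P θ s g p.1 (p.2 + 1)).u (sent s p.1 p.2).1

/-- Initialization (round `0`) from the local models `w₀ i`: inner and gradient estimators are `0`,
and each client computes predictions of its initial model on `K` random points of each data set. -/
def init {N d : ℕ} {Z : Type*} (P : Problem N d Z) {K : ℕ} (w₀ : Fin N → Vec d)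
    (s : P.RoundSample K) : Global P K where
  w := 𝔼 i : Fin N, w₀ i
  G := 0
  u := 0
  H1 := fun p => P.h (w₀ p.1) (sent s p.1 p.2).1
  H2 := fun p => P.h (w₀ p.1) (sent s p.1 p.2).2
  U := 0

/-- The state at the end of round `r`, along the sequence `s` of the random draws of the rounds. -/
def run {N d : ℕ} {Z : Type*} (P : Problem N d Z) (θ : Rates) {K : ℕ} (w₀ : Fin N → Vec d)
    (s : ℕ → P.RoundSample K) : ℕ → Global P K
  | 0 => init P w₀ (s 0)
  | r + 1 => nextRound P θ (s (r + 1)) (run P θ w₀ s r)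

/-- `E[(1/R) ∑_{r=1}^R ‖∇F(w̄^r)‖²]` for `R` rounds of `K` local iterations, where `w̄^r` is the
averaged model at the end of round `r`. The index `Fin.ofNat (R + 1) r` is `r` for `r ≤ R`. -/
def expectedSqGrad {N d : ℕ} {Z : Type*} (P : Problem N d Z) (θ : Rates) (R K : ℕ)
    (w₀ : Fin N → Vec d) : ℝ :=
  𝔼 ω : P.RunSample R K, (1 / (R : ℝ)) * ∑ r ∈ Finset.Icc 1 R,
    ‖gradient P.risk (run P θ w₀ (fun r => ω (Fin.ofNat (R + 1) r)) r).w‖ ^ 2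

/-- The number of data points that each client samples: `2 K` at initialization, and then four
(`z_1, z_2, ẑ_1, ẑ_2`) at each of the `R K` local iterations. -/
def samplesPerClient (R K : ℕ) : ℕ := 2 * K + 4 * (R * K)

/-- The step sizes `γ = c_γ M^{1/3} / R^{2/3}`, `β = c_β / (M^{1/6} R^{2/3})`,
`η = c_η / (M^{2/3} R^{2/3})`. -/
def rates (cγ cβ cη : ℝ) (M R : ℕ) : Rates where
  γ := cγ * (M : ℝ) ^ (1 / 3 : ℝ) / (R : ℝ) ^ (2 / 3 : ℝ)
  β := cβ / ((M : ℝ) ^ (1 / 6 : ℝ) * (R : ℝ) ^ (2 / 3 : ℝ))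
  η := cη / ((M : ℝ) ^ (2 / 3 : ℝ) * (R : ℝ) ^ (2 / 3 : ℝ))

/-- The number of local iterations `K = ⌈c_K M^{1/3} R^{1/3}⌉`. -/
def iterations (cK : ℝ) (M R : ℕ) : ℕ :=
  ⌈cK * (M : ℝ) ^ (1 / 3 : ℝ) * (R : ℝ) ^ (1 / 3 : ℝ)⌉₊

end FedX

end

/-! The proof is a Lyapunov argument run round by round. A round uses stale records drawn without
replacement, so its estimates are not independent of the past in an obvious way. The remedy is to
cut time at the right place: a `PreState` is the state at the end of a round before its communicated
points are drawn. The transition to the next such state uses only randomness independent of it,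
namely those points together with the training samples and shuffles of the following round
(`freshSample`, `expect_preRun_succ`). After the first round, every model that enters a transition
lies within `4 * c * η * K` of the averaged model `w` (`Bounded.fresh_next`).

With all models frozen at `w`, and exact inner risks, the gradient estimates of a client have fixed
means, which average over the clients to the gradient of the risk (`grad_eq_mean`). Their deviations
at distinct iterations are nonpositively correlated (`expect_shuffled_inner_nonpos`, resting on
`expect_embedding_inner_nonpos`), so variances add and the noise of a round has second moment of
order `K * β ^ 2`. What remains is `gradErr`, governed by the displacement of the models and by the
errors of the inner estimators.

Three recursions are then combined. The squared inner error contracts by the factor `1 - γ / m` per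
iteration for a client with `m` points, up to `trackingError` (`expect_sq_innerErr_succ_le`), hence
the weighted potential of `roundSq_le`. The squared gap between the gradient estimator and the
gradient contracts by `1 - β * K / 2` per round (`expect_sq_gap_next_le`). The risk decreases by
multiples of the squared norms of the gradient and of the mean direction of the round
(`expect_risk_next_le`). The first two recursions are charged for the displacement of the model; the
last negative term pays for it when `η / β` and `M * η / γ` are small, which is the smallness of
`cη`. The sum is `expect_potential_next_le`, and telescoping gives `expectedSqGrad_le`.

With `s = M ^ (1/6)` and `T = R ^ (1/3)`, all contributions are `O(s ^ 2 / T ^ 2)`. If `T` is below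
a fixed multiple of `s`, the step sizes may be inadmissible, but then the rate is no stronger than
boundedness of the gradient. -/

noncomputable section
namespace FedX

/-! ### Uniform averages, resampling, and draws without replacement. -/

section Expectation

variable {H : Type*} [NormedAddCommGroup H] [InnerProductSpace ℝ H] [Module ℚ≥0 H]
variable {ι : Type*}

theorem expect_eq_smul_sum (s : Finset ι) (f : ι → H) :
    𝔼 i ∈ s, f i = ((s.card : ℝ)⁻¹) • ∑ i ∈ s, f i := by
  rcases s.eq_empty_or_nonempty with rfl | hs
  · simp
  · have h0 : (s.card : ℝ) ≠ 0 := by exact_mod_cast hs.card_pos.ne'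
    rw [← Finset.card_smul_expect s f, ← Nat.cast_smul_eq_nsmul ℝ, smul_smul, inv_mul_cancel₀ h0,
      one_smul]

theorem map_expect_real {H' : Type*} [NormedAddCommGroup H'] [InnerProductSpace ℝ H']
    [Module ℚ≥0 H'] (L : H →ₗ[ℝ] H') (s : Finset ι) (f : ι → H) :
    L (𝔼 i ∈ s, f i) = 𝔼 i ∈ s, L (f i) := by
  rw [expect_eq_smul_sum, expect_eq_smul_sum, map_smul, map_sum]

theorem inner_expect (s : Finset ι) (f : ι → H) (v : H) :
    inner ℝ v (𝔼 i ∈ s, f i) = 𝔼 i ∈ s, inner ℝ v (f i) :=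
  map_expect_real (innerₗ H v) s f

theorem expect_inner (s : Finset ι) (f : ι → H) (v : H) :
    inner ℝ (𝔼 i ∈ s, f i) v = 𝔼 i ∈ s, inner ℝ (f i) v := by
  simp only [real_inner_comm v, inner_expect]

theorem smul_expect_real (s : Finset ι) (f : ι → H) (c : ℝ) :
    c • 𝔼 i ∈ s, f i = 𝔼 i ∈ s, c • f i :=
  map_expect_real (LinearMap.lsmul ℝ H c) s f

theorem norm_expect_le_expect (s : Finset ι) (f : ι → H) :
    ‖𝔼 i ∈ s, f i‖ ≤ 𝔼 i ∈ s, ‖f i‖ := by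
  rw [expect_eq_smul_sum, expect_eq_smul_sum, norm_smul, smul_eq_mul, norm_inv, RCLike.norm_natCast]
  gcongr
  exact norm_sum_le _ _

theorem sq_expect_le (s : Finset ι) (f : ι → ℝ) : (𝔼 i ∈ s, f i) ^ 2 ≤ 𝔼 i ∈ s, f i ^ 2 := by
  rcases s.eq_empty_or_nonempty with rfl | hs
  · simp
  · have h := Finset.expect_mul_sq_le_sq_mul_sq s f (fun _ => 1)
    simpa [Finset.expect_const hs] using h

theorem norm_sq_expect_le (s : Finset ι) (f : ι → H) :
    ‖𝔼 i ∈ s, f i‖ ^ 2 ≤ 𝔼 i ∈ s, ‖f i‖ ^ 2 :=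
  (pow_le_pow_left₀ (norm_nonneg _) (norm_expect_le_expect s f) 2).trans (sq_expect_le s _)

theorem norm_expect_le_of_le [Fintype ι] [Nonempty ι] {f : ι → H} {C : ℝ} (h : ∀ i, ‖f i‖ ≤ C) :
    ‖𝔼 i, f i‖ ≤ C :=
  (norm_expect_le_expect _ _).trans (Finset.expect_le Finset.univ_nonempty fun i _ => h i)

theorem norm_expect_finset_le {s : Finset ι} (hs : s.Nonempty) {f : ι → H} {C : ℝ}
    (h : ∀ i ∈ s, ‖f i‖ ≤ C) : ‖𝔼 i ∈ s, f i‖ ≤ C :=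
  (norm_expect_le_expect _ _).trans (Finset.expect_le hs h)

theorem abs_expect_finset_le {s : Finset ι} (hs : s.Nonempty) {f : ι → ℝ} {C : ℝ}
    (h : ∀ i ∈ s, |f i| ≤ C) : |𝔼 i ∈ s, f i| ≤ C :=
  (Finset.abs_expect_le _ _).trans (Finset.expect_le hs h)

theorem expect_subtype {M : Type*} [AddCommMonoid M] [Module ℚ≥0 M] (s : Finset ι) (f : ι → M) :
    𝔼 i : s, f i = 𝔼 i ∈ s, f i := by
  rw [Finset.expect, Finset.expect, Finset.sum_coe_sort s f]
  simp

theorem expect_mono [Fintype ι] {f g : ι → ℝ} (h : ∀ i, f i ≤ g i) : 𝔼 i, f i ≤ 𝔼 i, g i :=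
  Finset.expect_le_expect fun i _ => h i

variable {M : Type*} [AddCommMonoid M] [Module ℚ≥0 M]

theorem expect_prod {A B : Type*} [Fintype A] [Fintype B] (f : A × B → M) :
    𝔼 x, f x = 𝔼 a, 𝔼 b, f (a, b) := by
  rw [← Finset.univ_product_univ, Finset.expect_product]

/-- Redrawing a uniform component of a uniform random variable does not change expectations. -/
theorem expect_resample {Y S : Type*} [Fintype Y] [Fintype S] [Nonempty S] (get : Y → S)
    (set : Y → S → Y) (get_set : ∀ y s, get (set y s) = s)
    (set_set : ∀ y s, set (set y s) (get y) = y) (f : Y → M) :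
    𝔼 y, f y = 𝔼 y, 𝔼 s, f (set y s) := by
  let e : Y × S → Y × S := fun x => (set x.1 x.2, get x.1)
  have he : Function.Involutive e := fun x => by simp [e, get_set, set_set]
  calc 𝔼 y, f y = 𝔼 x : Y × S, f x.1 := by
        rw [expect_prod]
        exact Finset.expect_congr rfl fun y _ => (Fintype.expect_const (f y)).symm
    _ = 𝔼 x : Y × S, f (set x.1 x.2) :=
        Fintype.expect_bijective e he.bijective _ _ fun x => by simp [e, set_set]
    _ = _ := expect_prod _

theorem expect_eval {Y S : Type*} [Fintype Y] [Nonempty Y] [Fintype S] [Nonempty S] (get : Y → S)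
    (set : Y → S → Y) (get_set : ∀ y s, get (set y s) = s)
    (set_set : ∀ y s, set (set y s) (get y) = y) (f : S → M) :
    𝔼 y, f (get y) = 𝔼 s, f s := by
  rw [expect_resample get set get_set set_set]
  simp only [get_set, Fintype.expect_const]

theorem expect_pi_apply {I : Type*} [Fintype I] [DecidableEq I] {X : I → Type*}
    [∀ i, Fintype (X i)] [∀ i, Nonempty (X i)] (i : I) (f : X i → M) :
    𝔼 y : ∀ i, X i, f (y i) = 𝔼 s, f s :=
  expect_eval (fun y => y i) (fun y s => Function.update y i s) (by simp) (by simp) f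

/-- Setting one entry of a dependent matrix. -/
def updateEntry {I J : Type*} [DecidableEq I] [DecidableEq J] {X : I → Type*} (p : I × J)
    (y : ∀ i, J → X i) (s : X p.1) : ∀ i, J → X i :=
  Function.update y p.1 (Function.update (y p.1) p.2 s)

theorem updateEntry_self {I J : Type*} [DecidableEq I] [DecidableEq J] {X : I → Type*} (p : I × J)
    (y : ∀ i, J → X i) (s : X p.1) : updateEntry p y s p.1 p.2 = s := by
  simp [updateEntry]

theorem updateEntry_of_ne {I J : Type*} [DecidableEq I] [DecidableEq J] {X : I → Type*}
    {p q : I × J} (h : q ≠ p) (y : ∀ i, J → X i) (s : X p.1) :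
    updateEntry p y s q.1 q.2 = y q.1 q.2 := by
  obtain ⟨i, j⟩ := p
  obtain ⟨i', j'⟩ := q
  by_cases hi : i' = i
  · subst hi
    have hj : j' ≠ j := fun hj => h (by rw [hj])
    simp [updateEntry, hj]
  · simp [updateEntry, hi]

theorem updateEntry_updateEntry {I J : Type*} [DecidableEq I] [DecidableEq J] {X : I → Type*}
    (p : I × J) (y : ∀ i, J → X i) (s : X p.1) :
    updateEntry p (updateEntry p y s) (y p.1 p.2) = y := by
  simp [updateEntry]

section Matrix

variable {I J : Type*} [Fintype I] [Fintype J] [DecidableEq I] [DecidableEq J] {X : I → Type*}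
  [∀ i, Fintype (X i)] [∀ i, Nonempty (X i)]

theorem expect_entry_resample (p : I × J) (f : (∀ i, J → X i) → M) :
    𝔼 y, f y = 𝔼 y, 𝔼 s, f (updateEntry p y s) :=
  expect_resample (fun y => y p.1 p.2) (updateEntry p) (updateEntry_self p)
    (updateEntry_updateEntry p) f

theorem expect_entry (p : I × J) (f : X p.1 → M) :
    𝔼 y : ∀ i, J → X i, f (y p.1 p.2) = 𝔼 s, f s :=
  expect_eval (fun y => y p.1 p.2) (updateEntry p) (updateEntry_self p)
    (updateEntry_updateEntry p) f

theorem expect_inner_entries {p q : I × J} (h : p ≠ q) (f : X p.1 → H) (f' : X q.1 → H) :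
    𝔼 y : ∀ i, J → X i, inner ℝ (f (y p.1 p.2)) (f' (y q.1 q.2)) =
      inner ℝ (𝔼 s, f s) (𝔼 s, f' s) := by
  rw [expect_entry_resample p]
  simp only [updateEntry_self, updateEntry_of_ne h.symm, ← expect_inner]
  rw [expect_entry q (fun s => inner ℝ (𝔼 s, f s) (f' s)), inner_expect]

end Matrix

section Embedding

variable {J Q : Type*} [Fintype J] [DecidableEq J] [Fintype Q] [DecidableEq Q]

-- Relabelling the values by a transposition moves `p` to position `k` and keeps the map injective.
-- The pair of the old injection and `p` is recovered by swapping back, so `expect_resample`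
-- applies.
omit [DecidableEq J] in
theorem expect_embedding_resample [Nonempty Q] (k : J) (f : (J ↪ Q) → M) :
    𝔼 ξ, f ξ = 𝔼 ξ : J ↪ Q, 𝔼 p, f (ξ.trans (Equiv.swap (ξ k) p).toEmbedding) :=
  expect_resample (fun ξ => ξ k) (fun ξ p => ξ.trans (Equiv.swap (ξ k) p).toEmbedding)
    (by simp) (fun ξ p => by ext j; simp [Equiv.swap_comm p]) f

omit [DecidableEq J] in
theorem expect_embedding_apply [Nonempty (J ↪ Q)] [Nonempty Q] (k : J) (f : Q → M) :
    𝔼 ξ : J ↪ Q, f (ξ k) = 𝔼 p, f p := by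
  rw [expect_embedding_resample k]
  simp

omit [DecidableEq J] in
/-- Draws without replacement from a centred family are nonpositively correlated. -/
theorem expect_embedding_inner_nonpos [Nonempty (J ↪ Q)] [Nonempty Q] {k l : J} (hkl : k ≠ l)
    (a : Q → H) (ha : 𝔼 p, a p = 0) :
    𝔼 ξ : J ↪ Q, inner ℝ (a (ξ k)) (a (ξ l)) ≤ 0 := by
  have hsum : ∑ p, a p = 0 := by
    rw [← Finset.card_smul_expect, ha, smul_zero]
  have hc : 0 < (Fintype.card Q : ℝ) := by exact_mod_cast Fintype.card_pos
  -- Redraw position `l` as a uniform `p`. Position `k` keeps its value unless `p = ξ k`, when it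
  -- receives `ξ l`; without this collision the average over `p` would vanish by centring. The
  -- collision term is at most half a difference of squared norms, and this has mean zero because
  -- both positions have the same law.
  have key : ∀ ξ : J ↪ Q,
      𝔼 p, inner ℝ (a (Equiv.swap (ξ l) p (ξ k))) (a p) ≤
        (Fintype.card Q : ℝ)⁻¹ * (2⁻¹ * (‖a (ξ l)‖ ^ 2 - ‖a (ξ k)‖ ^ 2)) := by
    intro ξ
    have hne : ξ k ≠ ξ l := fun h => hkl (ξ.injective h)
    rw [expect_eq_smul_sum, smul_eq_mul, Finset.card_univ]
    gcongr
    have h1 : ∀ p, inner ℝ (a (Equiv.swap (ξ l) p (ξ k))) (a p) =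
        inner ℝ (a (ξ k)) (a p) +
          if p = ξ k then inner ℝ (a (ξ l)) (a (ξ k)) - ‖a (ξ k)‖ ^ 2 else 0 := by
      intro p
      by_cases hp : p = ξ k
      · subst hp
        simp [Equiv.swap_apply_right]
      · rw [Equiv.swap_apply_of_ne_of_ne hne (Ne.symm hp)]
        simp [hp]
    simp only [h1, Finset.sum_add_distrib, ← inner_sum, hsum, inner_zero_right]
    simp only [Finset.sum_ite_eq', Finset.mem_univ, if_true]
    have := norm_sub_sq_real (a (ξ l)) (a (ξ k))
    nlinarith [sq_nonneg ‖a (ξ l) - a (ξ k)‖]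
  rw [expect_embedding_resample l]
  simp only [Function.Embedding.trans_apply, Equiv.coe_toEmbedding, Equiv.swap_apply_left]
  refine (expect_mono key).trans ?_
  rw [← Finset.mul_expect, ← Finset.mul_expect, Finset.expect_sub_distrib,
    expect_embedding_apply l (fun p => ‖a p‖ ^ 2), expect_embedding_apply k (fun p => ‖a p‖ ^ 2)]
  simp

variable {I : Type*} [Fintype I] [DecidableEq I] {X : I → Type*}
  [∀ i, Fintype (X i)] [∀ i, Nonempty (X i)]

omit [DecidableEq J] [DecidableEq I] in
theorem expect_prod_fst [Nonempty I] [Nonempty J] (f : I → M) : 𝔼 p : I × J, f p.1 = 𝔼 i, f i := by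
  rw [expect_prod]
  simp

theorem expect_lazy_entry [Nonempty I] [Nonempty J] [Nonempty (J ↪ I × J)] (k : J)
    (F : ∀ i, X i → M) :
    𝔼 y : ∀ i, J → X i, 𝔼 ξ : J ↪ I × J, F (ξ k).1 (y (ξ k).1 (ξ k).2) = 𝔼 i, 𝔼 s, F i s := by
  rw [Finset.expect_comm]
  simp only [expect_entry (X := X) _ (F _)]
  rw [expect_embedding_apply k (fun p : I × J => 𝔼 s, F p.1 s),
    expect_prod_fst (fun i => 𝔼 s, F i s)]

/-- Records drawn without replacement, each of which carries an independent uniform sample, are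
nonpositively correlated. -/
theorem expect_lazy_inner_nonpos [Nonempty I] [Nonempty J] [Nonempty (J ↪ I × J)] {k l : J}
    (hkl : k ≠ l) (F : ∀ i, X i → H) :
    𝔼 y : ∀ i, J → X i, 𝔼 ξ : J ↪ I × J,
      inner ℝ (F (ξ k).1 (y (ξ k).1 (ξ k).2) - 𝔼 i, 𝔼 s, F i s)
        (F (ξ l).1 (y (ξ l).1 (ξ l).2) - 𝔼 i, 𝔼 s, F i s) ≤ 0 := by
  rw [Finset.expect_comm]
  -- For a fixed shuffle the two records are distinct entries, so their samples are independent and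
  -- can be averaged out. Only the dependence on the client of the record is left, which is a
  -- centred family drawn without replacement.
  have h : ∀ ξ : J ↪ I × J, 𝔼 y : ∀ i, J → X i,
      inner ℝ (F (ξ k).1 (y (ξ k).1 (ξ k).2) - 𝔼 i, 𝔼 s, F i s)
        (F (ξ l).1 (y (ξ l).1 (ξ l).2) - 𝔼 i, 𝔼 s, F i s) =
      inner ℝ ((fun p : I × J => 𝔼 s, F p.1 s - 𝔼 i, 𝔼 s, F i s) (ξ k))
        ((fun p : I × J => 𝔼 s, F p.1 s - 𝔼 i, 𝔼 s, F i s) (ξ l)) := fun ξ => by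
    rw [expect_inner_entries (X := X) (fun h => hkl (ξ.injective h))
      (fun s => F (ξ k).1 s - 𝔼 i, 𝔼 s, F i s) (fun s => F (ξ l).1 s - 𝔼 i, 𝔼 s, F i s)]
    simp [Finset.expect_sub_distrib]
  simp only [h]
  refine expect_embedding_inner_nonpos hkl (fun p : I × J => 𝔼 s, F p.1 s - 𝔼 i, 𝔼 s, F i s) ?_
  rw [Finset.expect_sub_distrib, expect_prod_fst (fun i => 𝔼 s, F i s)]
  simp

end Embedding

end Expectation


/-! ### Gradients and the quadratic upper model. -/

section Calculus

variable {d : ℕ}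

theorem abs_coord_le_norm {n : ℕ} (v : Vec n) (i : Fin n) : |v i| ≤ ‖v‖ := by
  simpa using PiLp.norm_apply_le v i

theorem norm_pair_sub_le (a b a' b' : ℝ) :
    ‖(!₂[a, b] : Vec 2) - !₂[a', b']‖ ≤ |a - a'| + |b - b'| := by
  rw [EuclideanSpace.norm_eq]
  apply Real.sqrt_le_iff.2
  refine ⟨by positivity, ?_⟩
  simp [Fin.sum_univ_two]
  nlinarith [abs_nonneg (a - a'), abs_nonneg (b - b'), sq_abs (a - a'), sq_abs (b - b')]

theorem norm_gradient_le {n : ℕ} {C L : ℝ≥0} {φ : Vec n → ℝ} (h : SmoothLipschitz C L φ)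
    (x : Vec n) :
    ‖gradient φ x‖ ≤ C := by
  rw [gradient, LinearIsometryEquiv.norm_map]
  exact norm_fderiv_le_of_lipschitz ℝ h.lipschitz

theorem inner_gradient_eq {φ : Vec d → ℝ} (x y : Vec d) :
    inner ℝ (gradient φ x) y = fderiv ℝ φ x y := inner_gradient_left

/-- A function with `L`-Lipschitz gradient lies below its quadratic upper model. -/
theorem le_add_inner_gradient {φ : Vec d → ℝ} {L : ℝ} (hd : Differentiable ℝ φ)
    (hL : ∀ x y, ‖gradient φ x - gradient φ y‖ ≤ L * ‖x - y‖) (hL0 : 0 ≤ L) (x y : Vec d) :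
    φ y ≤ φ x + inner ℝ (gradient φ x) (y - x) + L * ‖y - x‖ ^ 2 := by
  have hb : ∀ z ∈ segment ℝ x y, ‖fderiv ℝ φ z - fderiv ℝ φ x‖ ≤ L * ‖y - x‖ := by
    intro z hz
    have h1 : fderiv ℝ φ z - fderiv ℝ φ x =
        InnerProductSpace.toDual ℝ (Vec d) (gradient φ z - gradient φ x) := by
      rw [map_sub, toDual_gradient, toDual_gradient]
    rw [h1, LinearIsometryEquiv.norm_map]
    refine (hL z x).trans (mul_le_mul_of_nonneg_left ?_ hL0)
    obtain ⟨t, ht, rfl⟩ := (segment_eq_image' ℝ x y) ▸ hz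
    simp only [add_sub_cancel_left, norm_smul, Real.norm_eq_abs, abs_of_nonneg ht.1]
    exact mul_le_of_le_one_left (norm_nonneg _) ht.2
  -- The mean value inequality yields the constant `L` instead of the sharp `L / 2`; this costs only
  -- a constant in the step size condition.
  have := (convex_segment (𝕜 := ℝ) x y).norm_image_sub_le_of_norm_fderiv_le'
    (fun z _ => hd z) hb (left_mem_segment ℝ x y) (right_mem_segment ℝ x y)
  rw [inner_gradient_eq]
  have h2 := (abs_le.1 (Real.norm_eq_abs _ ▸ this)).2
  nlinarith

theorem gradient_eq_of_hasFDerivAt {φ : Vec d → ℝ} {x v : Vec d}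
    (h : HasFDerivAt φ (innerSL ℝ v) x) : gradient φ x = v := by
  apply HasGradientAt.gradient
  rw [hasGradientAt_iff_hasFDerivAt]
  exact h

end Calculus

/-! ### Regularity of the risk and the constants of the analysis. -/

namespace Problem

variable {N d : ℕ} {Z : Type*} {P : Problem N d Z} {C₀ Cℓ Lℓ Cf Lf Ch Lh : ℝ≥0}

/-- The prediction on the data point `z` is regular. -/
abbrev Smooth (P : Problem N d Z) (Ch Lh : ℝ≥0) (z : Z) : Prop :=
  SmoothLipschitz Ch Lh fun w => P.h w z

theorem Smooth.abs_sub_le {z : Z} (hz : P.Smooth Ch Lh z) (w w' : Vec d) :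
    |P.h w z - P.h w' z| ≤ Ch * ‖w - w'‖ := hz.lipschitz.norm_sub_le w w'

theorem Smooth.norm_predictGrad_le {z : Z} (hz : P.Smooth Ch Lh z) (w : Vec d) :
    ‖P.predictGrad w z‖ ≤ Ch := norm_gradient_le hz w

theorem Smooth.norm_predictGrad_sub_le {z : Z} (hz : P.Smooth Ch Lh z) (w w' : Vec d) :
    ‖P.predictGrad w z - P.predictGrad w' z‖ ≤ Lh * ‖w - w'‖ := hz.smooth.norm_sub_le w w'

theorem Smooth.hasFDerivAt {z : Z} (hz : P.Smooth Ch Lh z) (w : Vec d) :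
    HasFDerivAt (fun v => P.h v z) (innerSL ℝ (P.predictGrad w z)) w :=
  (hasGradientAt_iff_hasFDerivAt.1 (hz.differentiable w).hasGradientAt)

/-- The two summands of the gradient of the risk at a pair of data points. -/
def pairGrad1 (P : Problem N d Z) (w : Vec d) (z z' : Z) : Vec d :=
  (deriv P.f (P.innerRisk w z) * P.lossDeriv1 (P.h w z) (P.h w z')) • P.predictGrad w z

/-- The second summand. -/
def pairGrad2 (P : Problem N d Z) (w : Vec d) (z z' : Z) : Vec d :=
  (deriv P.f (P.innerRisk w z) * P.lossDeriv2 (P.h w z) (P.h w z')) • P.predictGrad w z'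

namespace Regular

variable (hP : P.Regular C₀ Cℓ Lℓ Cf Lf Ch Lh)
include hP

theorem loss_sub_le (a b a' b' : ℝ) :
    |P.ℓ !₂[a, b] - P.ℓ !₂[a', b']| ≤ Cℓ * (|a - a'| + |b - b'|) :=
  (hP.loss.lipschitz.norm_sub_le _ _).trans
    (mul_le_mul_of_nonneg_left (norm_pair_sub_le a b a' b') Cℓ.coe_nonneg)

theorem abs_lossDeriv1_le (a b : ℝ) : |P.lossDeriv1 a b| ≤ Cℓ :=
  (abs_coord_le_norm _ _).trans (norm_gradient_le hP.loss _)

theorem abs_lossDeriv2_le (a b : ℝ) : |P.lossDeriv2 a b| ≤ Cℓ :=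
  (abs_coord_le_norm _ _).trans (norm_gradient_le hP.loss _)

theorem lossDeriv1_sub_le (a b a' b' : ℝ) :
    |P.lossDeriv1 a b - P.lossDeriv1 a' b'| ≤ Lℓ * (|a - a'| + |b - b'|) :=
  (abs_coord_le_norm (gradient P.ℓ !₂[a, b] - gradient P.ℓ !₂[a', b']) 0).trans
    ((hP.loss.smooth.norm_sub_le _ _).trans
      (mul_le_mul_of_nonneg_left (norm_pair_sub_le a b a' b') Lℓ.coe_nonneg))

theorem lossDeriv2_sub_le (a b a' b' : ℝ) :
    |P.lossDeriv2 a b - P.lossDeriv2 a' b'| ≤ Lℓ * (|a - a'| + |b - b'|) :=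
  (abs_coord_le_norm (gradient P.ℓ !₂[a, b] - gradient P.ℓ !₂[a', b']) 1).trans
    ((hP.loss.smooth.norm_sub_le _ _).trans
      (mul_le_mul_of_nonneg_left (norm_pair_sub_le a b a' b') Lℓ.coe_nonneg))

theorem abs_deriv_le (a : ℝ) : |deriv P.f a| ≤ Cf :=
  norm_deriv_le_of_lipschitz hP.outer_lipschitz

theorem deriv_sub_le (a b : ℝ) : |deriv P.f a - deriv P.f b| ≤ Lf * |a - b| :=
  hP.outer_smooth.norm_sub_le a b

theorem hasFDerivAt_loss {z z' : Z} (hz : P.Smooth Ch Lh z) (hz' : P.Smooth Ch Lh z') (w : Vec d) :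
    HasFDerivAt (fun v => P.ℓ !₂[P.h v z, P.h v z'])
      (innerSL ℝ (P.lossDeriv1 (P.h w z) (P.h w z') • P.predictGrad w z +
        P.lossDeriv2 (P.h w z) (P.h w z') • P.predictGrad w z')) w := by
  have h1 : HasFDerivAt (fun v => (!₂[P.h v z, P.h v z'] : Vec 2))
      ((innerSL ℝ (P.predictGrad w z)).smulRight (!₂[(1 : ℝ), 0] : Vec 2) +
        (innerSL ℝ (P.predictGrad w z')).smulRight (!₂[(0 : ℝ), 1] : Vec 2)) w := by
    have h2 := ((hz.hasFDerivAt w).smul_const (!₂[(1 : ℝ), 0] : Vec 2)).add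
      ((hz'.hasFDerivAt w).smul_const (!₂[(0 : ℝ), 1] : Vec 2))
    refine h2.congr_of_eventuallyEq (Filter.Eventually.of_forall fun v => ?_)
    ext i
    fin_cases i <;> simp
  have h3 := (hasGradientAt_iff_hasFDerivAt.1
    (hP.loss.differentiable !₂[P.h w z, P.h w z']).hasGradientAt).comp w h1
  refine h3.congr_fderiv ?_
  ext v
  simp only [lossDeriv1, lossDeriv2]
  generalize gradient P.ℓ !₂[P.h w z, P.h w z'] = g
  generalize P.predictGrad w z = a
  generalize P.predictGrad w z' = b
  have h0 : inner ℝ g (!₂[(1 : ℝ), 0] : Vec 2) = g 0 := by simp [PiLp.inner_apply]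
  have h1 : inner ℝ g (!₂[(0 : ℝ), 1] : Vec 2) = g 1 := by simp [PiLp.inner_apply]
  simp only [ContinuousLinearMap.comp_apply, add_apply,
    ContinuousLinearMap.smulRight_apply, innerSL_apply_apply, InnerProductSpace.toDual_apply_apply,
    inner_add_right, inner_smul_right, inner_add_left, real_inner_smul_left, h0, h1]
  ring

theorem abs_innerRisk_le (hN : 0 < N) (w : Vec d) (z : Z) : |P.innerRisk w z| ≤ C₀ := by
  have : Nonempty (Fin N) := ⟨⟨0, hN⟩⟩
  exact abs_expect_finset_le Finset.univ_nonempty fun j _ =>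
    abs_expect_finset_le (P.nonempty2 j) fun z' _ => hP.loss_bound _

theorem loss_predict_sub_le {z z' : Z} (hz : P.Smooth Ch Lh z) (hz' : P.Smooth Ch Lh z')
    {w w₁ w₂ : Vec d} {D : ℝ} (h₁ : ‖w₁ - w‖ ≤ D) (h₂ : ‖w₂ - w‖ ≤ D) :
    |P.ℓ !₂[P.h w₁ z, P.h w₂ z'] - P.ℓ !₂[P.h w z, P.h w z']| ≤ 2 * Cℓ * Ch * D := by
  refine (hP.loss_sub_le _ _ _ _).trans ?_
  have h3 := (hz.abs_sub_le w₁ w).trans (mul_le_mul_of_nonneg_left h₁ Ch.coe_nonneg)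
  have h4 := (hz'.abs_sub_le w₂ w).trans (mul_le_mul_of_nonneg_left h₂ Ch.coe_nonneg)
  calc (Cℓ : ℝ) * (|P.h w₁ z - P.h w z| + |P.h w₂ z' - P.h w z'|) ≤ Cℓ * (Ch * D + Ch * D) := by
        gcongr
    _ = _ := by ring

theorem innerRisk_sub_le (hN : 0 < N) {z : Z} (hz : P.Smooth Ch Lh z) (w₁ w : Vec d) :
    |P.innerRisk w₁ z - P.innerRisk w z| ≤ 2 * Cℓ * Ch * ‖w₁ - w‖ := by
  have : Nonempty (Fin N) := ⟨⟨0, hN⟩⟩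
  simp only [innerRisk, ← Finset.expect_sub_distrib]
  exact abs_expect_finset_le Finset.univ_nonempty fun j _ =>
    abs_expect_finset_le (P.nonempty2 j) fun z' hz' =>
      hP.loss_predict_sub_le hz (hP.predict2 j z' hz') le_rfl le_rfl

omit hP in
theorem hasFDerivAt_expect {ι : Type*} (s : Finset ι) {φ : ι → Vec d → ℝ}
    {v : ι → Vec d} {w : Vec d}
    (h : ∀ i ∈ s, HasFDerivAt (φ i) (innerSL ℝ (v i)) w) :
    HasFDerivAt (fun x => 𝔼 i ∈ s, φ i x) (innerSL ℝ (𝔼 i ∈ s, v i)) w := by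
  have h1 := (HasFDerivAt.fun_sum h).const_smul ((s.card : ℝ)⁻¹)
  simp only [expect_eq_smul_sum]
  refine h1.congr_fderiv ?_
  rw [map_smul, map_sum]


theorem hasFDerivAt_innerRisk {z : Z} (hz : P.Smooth Ch Lh z) (w : Vec d) :
    HasFDerivAt (fun v => P.innerRisk v z)
      (innerSL ℝ (𝔼 j : Fin N, 𝔼 z' ∈ P.S2 j,
        (P.lossDeriv1 (P.h w z) (P.h w z') • P.predictGrad w z +
          P.lossDeriv2 (P.h w z) (P.h w z') • P.predictGrad w z'))) w :=
  hasFDerivAt_expect _ fun j _ => hasFDerivAt_expect _ fun z' hz' =>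
    hP.hasFDerivAt_loss hz (hP.predict2 j z' hz') w

theorem hasFDerivAt_risk (w : Vec d) :
    HasFDerivAt P.risk (innerSL ℝ (𝔼 i : Fin N, 𝔼 z ∈ P.S1 i, 𝔼 j : Fin N, 𝔼 z' ∈ P.S2 j,
      (P.pairGrad1 w z z' + P.pairGrad2 w z z'))) w := by
  refine hasFDerivAt_expect _ fun i _ => hasFDerivAt_expect _ fun z hz => ?_
  have h := (hP.outer_differentiable (P.innerRisk w z)).hasDerivAt.comp_hasFDerivAt w
    (hP.hasFDerivAt_innerRisk (hP.predict1 i z hz) w)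
  refine h.congr_fderiv ?_
  rw [← map_smul, smul_expect_real]
  simp only [smul_expect_real, smul_add, smul_smul]
  rfl

theorem differentiable_risk : Differentiable ℝ P.risk :=
  fun w => (hP.hasFDerivAt_risk w).differentiableAt

theorem gradient_risk (w : Vec d) :
    gradient P.risk w = 𝔼 i : Fin N, 𝔼 z ∈ P.S1 i, 𝔼 j : Fin N, 𝔼 z' ∈ P.S2 j,
      (P.pairGrad1 w z z' + P.pairGrad2 w z z') :=
  gradient_eq_of_hasFDerivAt (hP.hasFDerivAt_risk w)

theorem abs_risk_sub_le (hN : 0 < N) (w : Vec d) : |P.risk w - P.f 0| ≤ Cf * C₀ := by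
  have : Nonempty (Fin N) := ⟨⟨0, hN⟩⟩
  have h : P.risk w - P.f 0 = 𝔼 i : Fin N, 𝔼 z ∈ P.S1 i, (P.f (P.innerRisk w z) - P.f 0) := by
    simp only [risk, Finset.expect_sub_distrib, Finset.expect_const (P.nonempty1 _),
      Fintype.expect_const]
  rw [h]
  refine abs_expect_finset_le Finset.univ_nonempty fun i _ =>
    abs_expect_finset_le (P.nonempty1 i) fun z _ => ?_
  refine (hP.outer_lipschitz.norm_sub_le _ _).trans ?_
  rw [sub_zero]
  exact mul_le_mul_of_nonneg_left (hP.abs_innerRisk_le hN w z) Cf.coe_nonneg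

theorem norm_term_le {a b : ℝ} {v : Vec d} (hb : |b| ≤ Cℓ) (hv : ‖v‖ ≤ Ch) :
    ‖(deriv P.f a * b) • v‖ ≤ Cf * Cℓ * Ch := by
  rw [norm_smul, Real.norm_eq_abs, abs_mul]
  gcongr
  exact hP.abs_deriv_le a

/-- The factors are exchanged one at a time. The change of `a` is kept visible because inner
estimators are controlled only in mean square, whereas `e` and `e'` will be deterministic multiples
of a displacement. -/
theorem norm_term_sub_le {a a' b b' e e' : ℝ} {v v' : Vec d} (hb : |b| ≤ Cℓ) (hv : ‖v‖ ≤ Ch)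
    (hb' : |b'| ≤ Cℓ) (he : |b - b'| ≤ e) (he' : ‖v - v'‖ ≤ e') :
    ‖(deriv P.f a * b) • v - (deriv P.f a' * b') • v'‖ ≤
      Lf * Cℓ * Ch * |a - a'| + (Cf * Ch * e + Cf * Cℓ * e') := by
  have h1 : (deriv P.f a * b) • v - (deriv P.f a' * b') • v' =
      ((deriv P.f a - deriv P.f a') * b) • v + ((deriv P.f a' * (b - b')) • v +
        (deriv P.f a' * b') • (v - v')) := by
    module
  rw [h1]
  refine (norm_add_le _ _).trans (add_le_add ?_ ((norm_add_le _ _).trans (add_le_add ?_ ?_)))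
  · rw [norm_smul, Real.norm_eq_abs, abs_mul]
    calc _ ≤ (Lf * |a - a'| * Cℓ) * Ch := by
          gcongr
          exact hP.deriv_sub_le a a'
      _ = _ := by ring
  · rw [norm_smul, Real.norm_eq_abs, abs_mul]
    have := (abs_nonneg _).trans he
    calc _ ≤ (Cf * e) * Ch := by
          gcongr
          exact hP.abs_deriv_le a'
      _ = _ := by ring
  · rw [norm_smul, Real.norm_eq_abs, abs_mul]
    gcongr
    exact hP.abs_deriv_le a'

end Regular

/-- The estimates on a regular problem that the convergence analysis uses: `B` bounds the loss,
`c` the summands of the gradient estimators, `q` the oscillation of the risk; `l` is a Lipschitz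
constant of the inner risk, `L` of the gradient of the risk, and `a`, `b` are Lipschitz constants of
the summands in the inner estimator and in the models. -/
structure Bounds (P : Problem N d Z) (B c q l L a b : ℝ) : Prop where
  pos : 0 < N
  nonneg : 0 ≤ B ∧ 0 ≤ c ∧ 0 ≤ q ∧ 0 ≤ l ∧ 0 ≤ L ∧ 0 ≤ a ∧ 0 ≤ b
  loss : ∀ x, |P.ℓ x| ≤ B
  inner_le : ∀ w z, |P.innerRisk w z| ≤ B
  loss_sub : ∀ {i j z z'}, z ∈ P.S1 i → z' ∈ P.S2 j → ∀ {w w₁ w₂ : Vec d} {D : ℝ}, ‖w₁ - w‖ ≤ D →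
    ‖w₂ - w‖ ≤ D → |P.ℓ !₂[P.h w₁ z, P.h w₂ z'] - P.ℓ !₂[P.h w z, P.h w z']| ≤ l * D
  inner_sub : ∀ {i z}, z ∈ P.S1 i → ∀ w w₁,
    |P.innerRisk w₁ z - P.innerRisk w z| ≤ l * ‖w₁ - w‖
  term1 : ∀ {i z}, z ∈ P.S1 i → ∀ u x y w,
    ‖(deriv P.f u * P.lossDeriv1 x y) • P.predictGrad w z‖ ≤ c
  term2 : ∀ {j z}, z ∈ P.S2 j → ∀ u x y w,
    ‖(deriv P.f u * P.lossDeriv2 x y) • P.predictGrad w z‖ ≤ c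
  term1_sub : ∀ {i j z z'}, z ∈ P.S1 i → z' ∈ P.S2 j → ∀ {w w₁ w₂ : Vec d} {D : ℝ}, ‖w₁ - w‖ ≤ D →
    ‖w₂ - w‖ ≤ D → ∀ u,
    ‖(deriv P.f u * P.lossDeriv1 (P.h w₁ z) (P.h w₂ z')) • P.predictGrad w₁ z - P.pairGrad1 w z z'‖
      ≤ a * |u - P.innerRisk w z| + b * D
  term2_sub : ∀ {i j z z'}, z ∈ P.S1 i → z' ∈ P.S2 j → ∀ {w w₁ w₂ : Vec d} {D : ℝ}, ‖w₁ - w‖ ≤ D →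
    ‖w₂ - w‖ ≤ D → ∀ u,
    ‖(deriv P.f u * P.lossDeriv2 (P.h w₁ z) (P.h w₂ z')) • P.predictGrad w₂ z' -
      P.pairGrad2 w z z'‖ ≤ a * |u - P.innerRisk w z| + b * D
  risk_le : ∀ w, |P.risk w - P.f 0| ≤ q
  grad_eq : ∀ w, gradient P.risk w = 𝔼 i : Fin N, 𝔼 z ∈ P.S1 i, 𝔼 j : Fin N, 𝔼 z' ∈ P.S2 j,
      (P.pairGrad1 w z z' + P.pairGrad2 w z z')
  grad_le : ∀ w, ‖gradient P.risk w‖ ≤ 2 * c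
  grad_sub : ∀ w w₁, ‖gradient P.risk w₁ - gradient P.risk w‖ ≤ L * ‖w₁ - w‖
  differentiable : Differentiable ℝ P.risk

/-- The constants are fixed before `N`, `d` and the problem, which is the source of the uniformity
in the theorem. Everything later uses only `Bounds`. -/
theorem Regular.exists_bounds (C₀ Cℓ Lℓ Cf Lf Ch Lh : ℝ≥0) :
    ∃ B c q l L a b : ℝ, (0 ≤ B ∧ 0 ≤ c ∧ 0 ≤ q ∧ 0 ≤ l ∧ 0 ≤ L ∧ 0 ≤ a ∧ 0 ≤ b) ∧
      ∀ (N d : ℕ) (Z : Type*) (P : Problem N d Z), 0 < N →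
      P.Regular C₀ Cℓ Lℓ Cf Lf Ch Lh → P.Bounds B c q l L a b := by
  -- Here `L = 2 * (a * l + b)`: each of the two summands of the gradient varies through the inner
  -- risk, at rate `a * l`, and through the model directly, at rate `b`.
  refine ⟨C₀, Cf * Cℓ * Ch, Cf * C₀, 2 * Cℓ * Ch,
    2 * (Lf * Cℓ * Ch * (2 * Cℓ * Ch) + (2 * Cf * Ch * Lℓ * Ch + Cf * Cℓ * Lh)), Lf * Cℓ * Ch,
    2 * Cf * Ch * Lℓ * Ch + Cf * Cℓ * Lh,
    by refine ⟨?_, ?_, ?_, ?_, ?_, ?_, ?_⟩ <;> positivity, fun N d Z P hN hP => ?_⟩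
  have : Nonempty (Fin N) := ⟨⟨0, hN⟩⟩
  have t1 : ∀ {i z}, z ∈ P.S1 i → ∀ u x y w,
      ‖(deriv P.f u * P.lossDeriv1 x y) • P.predictGrad w z‖ ≤ Cf * Cℓ * Ch :=
    fun {i z} hz u x y w => hP.norm_term_le (hP.abs_lossDeriv1_le _ _)
      (Smooth.norm_predictGrad_le (hP.predict1 i z hz) w)
  have t2 : ∀ {i z}, z ∈ P.S2 i → ∀ u x y w,
      ‖(deriv P.f u * P.lossDeriv2 x y) • P.predictGrad w z‖ ≤ Cf * Cℓ * Ch :=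
    fun {i z} hz u x y w => hP.norm_term_le (hP.abs_lossDeriv2_le _ _)
      (Smooth.norm_predictGrad_le (hP.predict2 i z hz) w)
  have ts : ∀ {i j z z'}, z ∈ P.S1 i → z' ∈ P.S2 j → ∀ {w w₁ w₂ : Vec d} {D : ℝ}, ‖w₁ - w‖ ≤ D →
      ‖w₂ - w‖ ≤ D → Lℓ * (|P.h w₁ z - P.h w z| + |P.h w₂ z' - P.h w z'|) ≤ 2 * Lℓ * Ch * D := by
    intro i j z z' hz hz' w w₁ w₂ D h₁ h₂
    have h3 := (Smooth.abs_sub_le (hP.predict1 i z hz) w₁ w).trans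
      (mul_le_mul_of_nonneg_left h₁ Ch.coe_nonneg)
    have h4 := (Smooth.abs_sub_le (hP.predict2 j z' hz') w₂ w).trans
      (mul_le_mul_of_nonneg_left h₂ Ch.coe_nonneg)
    calc (Lℓ : ℝ) * (|P.h w₁ z - P.h w z| + |P.h w₂ z' - P.h w z'|) ≤ Lℓ * (Ch * D + Ch * D) := by
          gcongr
      _ = _ := by ring
  have t1s : ∀ {i j z z'}, z ∈ P.S1 i → z' ∈ P.S2 j → ∀ {w w₁ w₂ : Vec d} {D : ℝ}, ‖w₁ - w‖ ≤ D →
      ‖w₂ - w‖ ≤ D → ∀ u,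
      ‖(deriv P.f u * P.lossDeriv1 (P.h w₁ z) (P.h w₂ z')) • P.predictGrad w₁ z -
        P.pairGrad1 w z z'‖ ≤ Lf * Cℓ * Ch * |u - P.innerRisk w z| +
          (2 * Cf * Ch * Lℓ * Ch + Cf * Cℓ * Lh) * D := by
    intro i j z z' hz hz' w w₁ w₂ D h₁ h₂ u
    have h := hP.norm_term_sub_le (a := u) (a' := P.innerRisk w z) (hP.abs_lossDeriv1_le _ _)
      (Smooth.norm_predictGrad_le (hP.predict1 i z hz) w₁) (hP.abs_lossDeriv1_le _ _)
      ((hP.lossDeriv1_sub_le _ _ _ _).trans (ts hz hz' h₁ h₂))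
      ((Smooth.norm_predictGrad_sub_le (hP.predict1 i z hz) w₁ w).trans
        (mul_le_mul_of_nonneg_left h₁ Lh.coe_nonneg))
    refine h.trans (le_of_eq ?_)
    ring
  have t2s : ∀ {i j z z'}, z ∈ P.S1 i → z' ∈ P.S2 j → ∀ {w w₁ w₂ : Vec d} {D : ℝ}, ‖w₁ - w‖ ≤ D →
      ‖w₂ - w‖ ≤ D → ∀ u,
      ‖(deriv P.f u * P.lossDeriv2 (P.h w₁ z) (P.h w₂ z')) • P.predictGrad w₂ z' -
        P.pairGrad2 w z z'‖ ≤ Lf * Cℓ * Ch * |u - P.innerRisk w z| +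
          (2 * Cf * Ch * Lℓ * Ch + Cf * Cℓ * Lh) * D := by
    intro i j z z' hz hz' w w₁ w₂ D h₁ h₂ u
    have h := hP.norm_term_sub_le (a := u) (a' := P.innerRisk w z) (hP.abs_lossDeriv2_le _ _)
      (Smooth.norm_predictGrad_le (hP.predict2 j z' hz') w₂) (hP.abs_lossDeriv2_le _ _)
      ((hP.lossDeriv2_sub_le _ _ _ _).trans (ts hz hz' h₁ h₂))
      ((Smooth.norm_predictGrad_sub_le (hP.predict2 j z' hz') w₂ w).trans
        (mul_le_mul_of_nonneg_left h₂ Lh.coe_nonneg))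
    refine h.trans (le_of_eq ?_)
    ring
  have avg : ∀ (φ : Fin N → Z → Fin N → Z → Vec d) (C : ℝ),
      (∀ i, ∀ z ∈ P.S1 i, ∀ j, ∀ z' ∈ P.S2 j, ‖φ i z j z'‖ ≤ C) →
      ‖𝔼 i : Fin N, 𝔼 z ∈ P.S1 i, 𝔼 j : Fin N, 𝔼 z' ∈ P.S2 j, φ i z j z'‖ ≤ C := fun φ C h =>
    norm_expect_finset_le Finset.univ_nonempty fun i _ =>
      norm_expect_finset_le (P.nonempty1 i) fun z hz =>
        norm_expect_finset_le Finset.univ_nonempty fun j _ =>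
          norm_expect_finset_le (P.nonempty2 j) fun z' hz' => h i z hz j z' hz'
  exact
    { pos := hN
      nonneg := by refine ⟨?_, ?_, ?_, ?_, ?_, ?_, ?_⟩ <;> positivity
      loss := hP.loss_bound
      inner_le := hP.abs_innerRisk_le hN
      loss_sub := fun {i j z z'} hz hz' {w w₁ w₂ D} h₁ h₂ =>
        hP.loss_predict_sub_le (hP.predict1 i z hz) (hP.predict2 j z' hz') h₁ h₂
      inner_sub := fun {i z} hz w w₁ => hP.innerRisk_sub_le hN (hP.predict1 i z hz) w₁ w
      term1 := t1
      term2 := t2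
      term1_sub := t1s
      term2_sub := t2s
      risk_le := hP.abs_risk_sub_le hN
      grad_eq := hP.gradient_risk
      grad_le := fun w => by
        rw [hP.gradient_risk]
        refine avg _ _ fun i z hz j z' hz' => (norm_add_le _ _).trans ?_
        rw [two_mul]
        exact add_le_add (t1 hz _ _ _ _) (t2 hz' _ _ _ _)
      grad_sub := fun w w₁ => by
        simp only [hP.gradient_risk, ← Finset.expect_sub_distrib]
        refine avg (fun i z j z' => P.pairGrad1 w₁ z z' + P.pairGrad2 w₁ z z' -
          (P.pairGrad1 w z z' + P.pairGrad2 w z z')) _ fun i z hz j z' hz' => ?_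
        have h1 := t1s hz hz' (le_refl ‖w₁ - w‖) le_rfl (P.innerRisk w₁ z)
        have h2 := t2s hz hz' (le_refl ‖w₁ - w‖) le_rfl (P.innerRisk w₁ z)
        have h3 := mul_le_mul_of_nonneg_left (hP.innerRisk_sub_le hN (hP.predict1 i z hz) w₁ w)
          (show (0 : ℝ) ≤ Lf * Cℓ * Ch by positivity)
        rw [add_sub_add_comm]
        refine (norm_add_le _ _).trans ((add_le_add h1 h2).trans ?_)
        linarith
      differentiable := hP.differentiable_risk }

end Problem

/-! ### States between rounds, and deterministic bounds along a round. -/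

/-- The state at the end of a round before the communicated samples are drawn: the averaged model
and gradient estimator, the inner estimators, and for every record the model at which the
predictions are evaluated and the inner estimators after the update. -/
structure PreState {N d : ℕ} {Z : Type*} (P : Problem N d Z) (K : ℕ) where
  w : Vec d
  G : Vec d
  u : ∀ i, P.S1 i → ℝ
  wl : Fin N × Fin K → Vec d
  ul : ∀ p : Fin N × Fin K, P.S1 p.1 → ℝ

namespace PreState

variable {N d : ℕ} {Z : Type*} {P : Problem N d Z} {K : ℕ}

/-- The communicated state, once the samples `y` have been drawn. -/
def global (x : PreState P K) (y : ∀ i : Fin N, Fin K → P.S1 i × P.S2 i) : Global P K where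
  w := x.w
  G := x.G
  u := x.u
  H1 := fun p => P.h (x.wl p) (y p.1 p.2).1
  H2 := fun p => P.h (x.wl p) (y p.1 p.2).2
  U := fun p => x.ul p (y p.1 p.2).1

/-- The local variables in the round that follows `x`. Here `ν` consists of the training samples
and shuffles of that round and of the communicated samples of the preceding one. -/
def loc (x : PreState P K) (θ : Rates) (ν : P.RoundSample K) (i : Fin N) (k : ℕ) :
    Local d (P.S1 i) :=
  localRun P θ ν (x.global (sent ν)) i k

/-- The state at the end of the next round. -/
def next (x : PreState P K) (θ : Rates) (ν : P.RoundSample K) : PreState P K where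
  w := 𝔼 i : Fin N, (x.loc θ ν i K).w
  G := 𝔼 i : Fin N, (x.loc θ ν i K).G
  u := fun i => (x.loc θ ν i K).u
  wl := fun p => (x.loc θ ν p.1 p.2).w
  ul := fun p => (x.loc θ ν p.1 (p.2 + 1)).u

variable (x : PreState P K) (θ : Rates) (ν : P.RoundSample K) (i : Fin N)

/-- The first summand of the gradient estimate at iteration `k` of client `i`. -/
def est1 (k : Fin K) : Vec d :=
  let ξ := shuffle2 ν i k
  let z := (train ν i k).1
  (deriv P.f ((x.loc θ ν i (k + 1)).u z) * P.lossDeriv1 (P.h (x.loc θ ν i k).w z)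
    (P.h (x.wl ξ) (sent ν ξ.1 ξ.2).2)) • P.predictGrad (x.loc θ ν i k).w z

/-- The second summand of the gradient estimate at iteration `k` of client `i`. -/
def est2 (k : Fin K) : Vec d :=
  let ζ := shuffle1 ν i k
  let z := (train ν i k).2
  (deriv P.f (x.ul ζ (sent ν ζ.1 ζ.2).1) * P.lossDeriv2 (P.h (x.wl ζ) (sent ν ζ.1 ζ.2).1)
    (P.h (x.loc θ ν i k).w z)) • P.predictGrad (x.loc θ ν i k).w z

theorem loc_zero : x.loc θ ν i 0 = { w := x.w, u := x.u i, G := x.G } := rfl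

theorem loc_succ (k : Fin K) : x.loc θ ν i (k + 1) =
    localStep P θ (train ν i k)
      (P.h (x.wl (shuffle2 ν i k)) (sent ν (shuffle2 ν i k).1 (shuffle2 ν i k).2).2)
      (P.h (x.wl (shuffle1 ν i k)) (sent ν (shuffle1 ν i k).1 (shuffle1 ν i k).2).1)
      (x.ul (shuffle1 ν i k) (sent ν (shuffle1 ν i k).1 (shuffle1 ν i k).2).1) (x.loc θ ν i k) := by
  rw [loc, localRun, dif_pos k.2]
  rfl

theorem loc_succ_u_self (k : Fin K) : (x.loc θ ν i (k + 1)).u (train ν i k).1 =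
    (1 - θ.γ) * (x.loc θ ν i k).u (train ν i k).1 +
      θ.γ * P.ℓ !₂[P.h (x.loc θ ν i k).w (train ν i k).1,
        P.h (x.wl (shuffle2 ν i k)) (sent ν (shuffle2 ν i k).1 (shuffle2 ν i k).2).2] := by
  rw [loc_succ]
  simp [localStep]

theorem loc_succ_u_of_ne (k : Fin K) {z : P.S1 i} (hz : z ≠ (train ν i k).1) :
    (x.loc θ ν i (k + 1)).u z = (x.loc θ ν i k).u z := by
  rw [loc_succ]
  simp [localStep, hz]

theorem loc_succ_G (k : Fin K) : (x.loc θ ν i (k + 1)).G =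
    (1 - θ.β) • (x.loc θ ν i k).G + θ.β • (x.est1 θ ν i k + x.est2 θ ν i k) := by
  rw [est1, loc_succ]
  rfl

theorem loc_succ_w (k : Fin K) : (x.loc θ ν i (k + 1)).w =
    (x.loc θ ν i k).w - θ.η • (x.loc θ ν i (k + 1)).G := by
  rw [loc_succ]
  rfl

/-- The local variables before iteration `k` do not depend on later training samples. -/
theorem loc_congr {ν' : P.RoundSample K} (hs : sent ν = sent ν')
    (h1 : shuffle1 ν i = shuffle1 ν' i) (h2 : shuffle2 ν i = shuffle2 ν' i) :
    ∀ k : ℕ, (∀ j : Fin K, (j : ℕ) < k → train ν i j = train ν' i j) →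
      x.loc θ ν i k = x.loc θ ν' i k := by
  intro k
  induction k with
  | zero => intro _; rfl
  | succ k ih =>
    intro h
    by_cases hk : k < K
    · have := x.loc_succ θ ν i ⟨k, hk⟩
      have h' := x.loc_succ θ ν' i ⟨k, hk⟩
      simp only at this h'
      rw [this, h', ih fun j hj => h j (by omega), hs, h1, h2, h ⟨k, hk⟩ (by simp)]
    · have e : ∀ ν : P.RoundSample K, x.loc θ ν i (k + 1) = x.loc θ ν i k := fun ν => by
        rw [loc, localRun, dif_neg hk, loc]
      rw [e, e, ih fun j hj => h j (by omega)]

/-- The bounds on the estimators that every round preserves. -/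
def Bounded (x : PreState P K) (B c : ℝ) : Prop := ‖x.G‖ ≤ 2 * c ∧ ∀ i z, |x.u i z| ≤ B

/-- The records of the state are bounded, and were computed within distance `D` of the model. -/
def Fresh (x : PreState P K) (B D : ℝ) : Prop := (∀ p, ‖x.wl p - x.w‖ ≤ D) ∧ ∀ p z, |x.ul p z| ≤ B

variable {x θ}
variable {B c q l L a b : ℝ} (hP : P.Bounds B c q l L a b)
include hP

theorem norm_est1_le (k : Fin K) : ‖x.est1 θ ν i k‖ ≤ c := hP.term1 (train ν i k).1.2 _ _ _ _

theorem norm_est2_le (k : Fin K) : ‖x.est2 θ ν i k‖ ≤ c := hP.term2 (train ν i k).2.2 _ _ _ _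

theorem norm_loc_G_le (hx : x.Bounded B c) (hβ : 0 ≤ θ.β) (hβ1 : θ.β ≤ 1) :
    ∀ k ≤ K, ‖(x.loc θ ν i k).G‖ ≤ 2 * c := by
  intro k
  induction k with
  | zero => intro _; exact hx.1
  | succ k ih =>
    intro hk
    have := x.loc_succ_G θ ν i ⟨k, hk⟩
    simp only at this
    rw [this]
    have h1 := norm_est1_le (x := x) (θ := θ) ν i hP ⟨k, hk⟩
    have h2 := norm_est2_le (x := x) (θ := θ) ν i hP ⟨k, hk⟩
    refine (norm_add_le _ _).trans ?_
    rw [norm_smul, norm_smul, Real.norm_eq_abs, Real.norm_eq_abs, abs_of_nonneg hβ,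
      abs_of_nonneg (sub_nonneg.2 hβ1)]
    calc (1 - θ.β) * ‖(x.loc θ ν i k).G‖ + θ.β * ‖x.est1 θ ν i ⟨k, hk⟩ + x.est2 θ ν i ⟨k, hk⟩‖
        ≤ (1 - θ.β) * (2 * c) + θ.β * (c + c) := by
          have h3 := ih (by omega)
          have h4 := (norm_add_le _ _).trans (add_le_add h1 h2)
          have h5 := sub_nonneg.2 hβ1
          gcongr
      _ = 2 * c := by ring

theorem abs_loc_u_le (hx : x.Bounded B c) (hγ : 0 ≤ θ.γ) (hγ1 : θ.γ ≤ 1) :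
    ∀ k ≤ K, ∀ z, |(x.loc θ ν i k).u z| ≤ B := by
  intro k
  induction k with
  | zero => intro _; exact hx.2 i
  | succ k ih =>
    intro hk z
    by_cases hz : z = (train ν i ⟨k, hk⟩).1
    · have := x.loc_succ_u_self θ ν i ⟨k, hk⟩
      simp only at this
      rw [hz, this]
      have h1 := abs_le.1 (ih (by omega) (train ν i ⟨k, hk⟩).1)
      have h2 := abs_le.1 (hP.loss !₂[P.h (x.loc θ ν i k).w (train ν i ⟨k, hk⟩).1,
        P.h (x.wl (shuffle2 ν i ⟨k, hk⟩))
          (sent ν (shuffle2 ν i ⟨k, hk⟩).1 (shuffle2 ν i ⟨k, hk⟩).2).2])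
      rw [abs_le]
      constructor <;> nlinarith
    · have := x.loc_succ_u_of_ne θ ν i ⟨k, hk⟩ hz
      simp only at this
      rw [this]
      exact ih (by omega) z

theorem norm_loc_w_sub_le (hx : x.Bounded B c) (hβ : 0 ≤ θ.β) (hβ1 : θ.β ≤ 1) (hη : 0 ≤ θ.η) :
    ∀ k ≤ K, ‖(x.loc θ ν i k).w - x.w‖ ≤ 2 * c * θ.η * k := by
  intro k
  induction k with
  | zero => intro _; simp [loc_zero]
  | succ k ih =>
    intro hk
    have := x.loc_succ_w θ ν i ⟨k, hk⟩
    simp only at this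
    rw [this, sub_right_comm]
    refine (norm_sub_le _ _).trans ?_
    rw [norm_smul, Real.norm_eq_abs, abs_of_nonneg hη]
    have h1 := ih (by omega)
    have h2 := mul_le_mul_of_nonneg_left (norm_loc_G_le ν i hP hx hβ hβ1 (k + 1) hk) hη
    push_cast
    linarith

theorem norm_loc_w_sub_le' (hx : x.Bounded B c) (hβ : 0 ≤ θ.β) (hβ1 : θ.β ≤ 1)
    (hη : 0 ≤ θ.η) {k : ℕ}
    (hk : k ≤ K) : ‖(x.loc θ ν i k).w - x.w‖ ≤ 2 * c * θ.η * K := by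
  refine (norm_loc_w_sub_le ν i hP hx hβ hβ1 hη k hk).trans ?_
  have : (k : ℝ) ≤ K := by exact_mod_cast hk
  have := hP.nonneg.2.1
  gcongr

theorem norm_next_w_sub_le (hx : x.Bounded B c) (hβ : 0 ≤ θ.β) (hβ1 : θ.β ≤ 1) (hη : 0 ≤ θ.η) :
    ‖(x.next θ ν).w - x.w‖ ≤ 2 * c * θ.η * K := by
  have : Nonempty (Fin N) := ⟨⟨0, hP.pos⟩⟩
  have h : (x.next θ ν).w - x.w = 𝔼 i : Fin N, ((x.loc θ ν i K).w - x.w) := by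
    rw [Finset.expect_sub_distrib, Fintype.expect_const]
    rfl
  rw [h]
  exact norm_expect_le_of_le fun i => norm_loc_w_sub_le' ν i hP hx hβ hβ1 hη le_rfl

theorem Bounded.next (hx : x.Bounded B c) (hβ : 0 ≤ θ.β) (hβ1 : θ.β ≤ 1)
    (hγ : 0 ≤ θ.γ) (hγ1 : θ.γ ≤ 1) : (x.next θ ν).Bounded B c := by
  have : Nonempty (Fin N) := ⟨⟨0, hP.pos⟩⟩
  exact ⟨norm_expect_le_of_le fun i => norm_loc_G_le ν i hP hx hβ hβ1 K le_rfl,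
    fun i z => abs_loc_u_le ν i hP hx hγ hγ1 K le_rfl z⟩

/-- Local models and their final average both stay within `2 * c * η * K` of the model at the start
of the round, hence the factor `4`. Freshness of `x` is not needed, so even arbitrary initial models
yield a fresh state after one round. -/
theorem Bounded.fresh_next (hx : x.Bounded B c) (hβ : 0 ≤ θ.β) (hβ1 : θ.β ≤ 1)
    (hγ : 0 ≤ θ.γ) (hγ1 : θ.γ ≤ 1) (hη : 0 ≤ θ.η) :
    (x.next θ ν).Fresh B (4 * c * θ.η * K) := by
  refine ⟨fun p => ?_, fun p z => abs_loc_u_le ν p.1 hP hx hγ hγ1 _ p.2.2 z⟩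
  have h1 := norm_loc_w_sub_le' ν p.1 hP hx hβ hβ1 hη p.2.2.le
  have h2 := norm_next_w_sub_le ν hP hx hβ hβ1 hη
  calc ‖(x.next θ ν).wl p - (x.next θ ν).w‖
      = ‖((x.loc θ ν p.1 p.2).w - x.w) - ((x.next θ ν).w - x.w)‖ := by
        rw [sub_sub_sub_cancel_right]
        rfl
    _ ≤ 2 * c * θ.η * K + 2 * c * θ.η * K := (norm_sub_le _ _).trans (add_le_add h1 h2)
    _ = _ := by ring

end PreState

/-! ### Exponential moving averages. -/

section MovingAverage

variable {H : Type*} [NormedAddCommGroup H] [InnerProductSpace ℝ H] [Module ℚ≥0 H]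

/-- The exponential moving average of `v 0, …, v (k - 1)` with weight `β`, started from `0`. -/
def movingAverage (β : ℝ) (v : ℕ → H) : ℕ → H
  | 0 => 0
  | k + 1 => (1 - β) • movingAverage β v k + β • v k

/-- The extension of a finite sequence by `0`. -/
def extendZero {K : ℕ} (v : Fin K → H) (k : ℕ) : H := if hk : k < K then v ⟨k, hk⟩ else 0

omit [InnerProductSpace ℝ H] [Module ℚ≥0 H] in
theorem extendZero_val {K : ℕ} (v : Fin K → H) (k : Fin K) : extendZero v k = v k := by
  simp [extendZero]

omit [Module ℚ≥0 H] in
theorem movingAverage_add (β : ℝ) (v v' : ℕ → H) (k : ℕ) :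
    movingAverage β (fun j => v j + v' j) k = movingAverage β v k + movingAverage β v' k := by
  induction k with
  | zero => simp [movingAverage]
  | succ k ih =>
    simp only [movingAverage, ih]
    module

omit [Module ℚ≥0 H] in
theorem movingAverage_const (β : ℝ) (v : H) (k : ℕ) :
    movingAverage β (fun _ => v) k = (1 - (1 - β) ^ k) • v := by
  induction k with
  | zero => simp [movingAverage]
  | succ k ih =>
    simp only [movingAverage, ih, pow_succ]
    module

omit [Module ℚ≥0 H] in
theorem norm_movingAverage_le {β : ℝ} (hβ : 0 ≤ β) (hβ1 : β ≤ 1) (v : ℕ → H) (k : ℕ) :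
    ‖movingAverage β v k‖ ≤ β * ∑ j ∈ Finset.range k, ‖v j‖ := by
  induction k with
  | zero => simp [movingAverage]
  | succ k ih =>
    rw [movingAverage, Finset.sum_range_succ, mul_add]
    refine (norm_add_le _ _).trans ?_
    rw [norm_smul, norm_smul, Real.norm_eq_abs, Real.norm_eq_abs, abs_of_nonneg hβ,
      abs_of_nonneg (sub_nonneg.2 hβ1)]
    refine add_le_add ?_ le_rfl
    exact (mul_le_of_le_one_left (norm_nonneg _) (show 1 - β ≤ 1 by linarith)).trans ih

-- This is the estimate for inputs without any cancellation: Jensen's inequality over the round, at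
-- the price of the full factor `(β * K) ^ 2`.
omit [Module ℚ≥0 H] in
theorem sq_norm_movingAverage_le {β : ℝ} (hβ : 0 ≤ β) (hβ1 : β ≤ 1) {K : ℕ} (v : Fin K → H) {k : ℕ}
    (hk : k ≤ K) :
    ‖movingAverage β (extendZero v) k‖ ^ 2 ≤ (β * K) ^ 2 * 𝔼 j, ‖v j‖ ^ 2 := by
  rcases Nat.eq_zero_or_pos K with hK | hK
  · subst hK
    obtain rfl : k = 0 := by omega
    simp [movingAverage]
  have : Nonempty (Fin K) := ⟨⟨0, hK⟩⟩
  have hK' : (K : ℝ) ≠ 0 := by positivity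
  have h1 : ‖movingAverage β (extendZero v) k‖ ≤ (β * K) * 𝔼 j, ‖v j‖ := by
    refine (norm_movingAverage_le hβ hβ1 _ k).trans ?_
    rw [Fintype.expect_eq_sum_div_card, Fintype.card_fin, mul_assoc, mul_div_cancel₀ _ hK']
    gcongr
    calc ∑ j ∈ Finset.range k, ‖extendZero v j‖ ≤ ∑ j ∈ Finset.range K, ‖extendZero v j‖ :=
          Finset.sum_le_sum_of_subset_of_nonneg (Finset.range_mono hk) fun _ _ _ => norm_nonneg _
      _ = ∑ j : Fin K, ‖v j‖ := by
          rw [Finset.sum_range]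
          exact Finset.sum_congr rfl fun j _ => by rw [extendZero_val]
  calc _ ≤ ((β * K) * 𝔼 j, ‖v j‖) ^ 2 := pow_le_pow_left₀ (norm_nonneg _) h1 2
    _ = (β * K) ^ 2 * (𝔼 j, ‖v j‖) ^ 2 := by ring
    _ ≤ _ := by
      gcongr
      exact sq_expect_le _ _

-- Unrolled, `p k` is a nonnegative combination of `p 0` and of the earlier `v i`, each
-- nonpositively correlated with `v j`. This replaces the martingale property, which draws without
-- replacement lack. The weights must not depend on `ω`.
omit [Module ℚ≥0 H] in
theorem expect_inner_recursion_nonpos {Ω : Type*} [Fintype Ω] {β : ℕ → ℝ}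
    (hβ : ∀ k, 0 ≤ β k) (hβ1 : ∀ k, β k ≤ 1) {p v : ℕ → Ω → H}
    (hp : ∀ k ω, p (k + 1) ω = (1 - β k) • p k ω + β k • v k ω)
    (h0 : ∀ j, 𝔼 ω, inner ℝ (p 0 ω) (v j ω) ≤ 0)
    (hv : ∀ i j, i ≠ j → 𝔼 ω, inner ℝ (v i ω) (v j ω) ≤ 0) :
    ∀ k j, k ≤ j → 𝔼 ω, inner ℝ (p k ω) (v j ω) ≤ 0 := by
  intro k
  induction k with
  | zero => exact fun j _ => h0 j
  | succ k ih =>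
    intro j hj
    simp only [hp, inner_add_left, real_inner_smul_left, Finset.expect_add_distrib,
      ← Finset.mul_expect]
    have h1 := mul_nonneg_of_nonpos_of_nonpos (neg_nonpos.2 (sub_nonneg.2 (hβ1 k)))
      (ih j (by omega))
    have h2 := mul_nonneg_of_nonpos_of_nonpos (neg_nonpos.2 (hβ k)) (hv k j (by omega))
    linarith

-- Since the cross term in each step has nonpositive mean, second moments add: the bound grows like
-- `k * β ^ 2` and not like `(k * β) ^ 2`.
omit [Module ℚ≥0 H] in
theorem expect_sq_movingAverage_le {Ω : Type*} [Fintype Ω] [Nonempty Ω] {β : ℝ}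
    (hβ : 0 ≤ β) (hβ1 : β ≤ 1) {v : Ω → ℕ → H} {C : ℝ}
    (hv : ∀ i j, i ≠ j → 𝔼 ω, inner ℝ (v ω i) (v ω j) ≤ 0)
    (hC : ∀ ω k, ‖v ω k‖ ≤ C) (k : ℕ) :
    𝔼 ω, ‖movingAverage β (v ω) k‖ ^ 2 ≤ k * (β * C) ^ 2 := by
  induction k with
  | zero => simp [movingAverage]
  | succ k ih =>
    have hneg := expect_inner_recursion_nonpos (β := fun _ => β) (fun _ => hβ) (fun _ => hβ1)
      (p := fun k ω => movingAverage β (v ω) k) (v := fun k ω => v ω k) (fun _ _ => rfl)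
      (fun j => by simp [movingAverage]) hv k k le_rfl
    have h1 : ∀ ω, ‖movingAverage β (v ω) (k + 1)‖ ^ 2 ≤ ‖movingAverage β (v ω) k‖ ^ 2 +
        (β * C) ^ 2 + 2 * ((1 - β) * β) * inner ℝ (movingAverage β (v ω) k) (v ω k) := by
      intro ω
      rw [movingAverage, norm_add_sq_real, norm_smul, norm_smul, mul_pow, mul_pow,
        real_inner_smul_left, real_inner_smul_right, Real.norm_eq_abs, Real.norm_eq_abs, sq_abs,
        sq_abs, mul_pow β C]
      have h2 : (1 - β) ^ 2 * ‖movingAverage β (v ω) k‖ ^ 2 ≤ ‖movingAverage β (v ω) k‖ ^ 2 :=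
        mul_le_of_le_one_left (sq_nonneg _) (by nlinarith)
      have h3 : β ^ 2 * ‖v ω k‖ ^ 2 ≤ β ^ 2 * C ^ 2 := by
        gcongr
        exact hC ω k
      linarith
    refine (expect_mono h1).trans ?_
    rw [Finset.expect_add_distrib, Finset.expect_add_distrib, ← Finset.mul_expect,
      Fintype.expect_const]
    have h4 : 2 * ((1 - β) * β) * 𝔼 ω, inner ℝ (movingAverage β (v ω) k) (v ω k) ≤ 0 :=
      mul_nonpos_of_nonneg_of_nonpos
        (mul_nonneg zero_le_two (mul_nonneg (sub_nonneg.2 hβ1) hβ)) hneg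
    push_cast
    linarith

theorem expect_movingAverage {Ω : Type*} [Fintype Ω] (β : ℝ) {v : Ω → ℕ → H}
    (hv : ∀ k, 𝔼 ω, v ω k = 0) (k : ℕ) : 𝔼 ω, movingAverage β (v ω) k = 0 := by
  induction k with
  | zero => simp [movingAverage]
  | succ k ih =>
    simp only [movingAverage, Finset.expect_add_distrib, ← smul_expect_real, ih, hv, smul_zero,
      add_zero]

end MovingAverage


/-! ### Independent samples paired with shuffled records. -/

section Shuffled

variable {H : Type*} [NormedAddCommGroup H] [InnerProductSpace ℝ H] [Module ℚ≥0 H]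
variable {M : Type*} [AddCommMonoid M] [Module ℚ≥0 M]
variable {J : Type*} [Fintype J] [DecidableEq J]
variable {I : Type*} [Fintype I] [DecidableEq I] {X : I → Type*}
  [∀ i, Fintype (X i)] [∀ i, Nonempty (X i)]

omit [DecidableEq J] [Fintype J] [Fintype I] [DecidableEq I] in
theorem nonempty_records [Nonempty I] : Nonempty (J ↪ I × J) :=
  ⟨⟨fun k => (Classical.arbitrary I, k), fun _ _ h => (Prod.mk.inj h).2⟩⟩

theorem expect_record [Nonempty I] [Nonempty J] (k : J) (F : ∀ p : I × J, X p.1 → M) :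
    𝔼 y : ∀ i, J → X i, 𝔼 ξ : J ↪ I × J, F (ξ k) (y (ξ k).1 (ξ k).2) = 𝔼 p, 𝔼 s, F p s := by
  have : Nonempty (J ↪ I × J) := nonempty_records
  rw [Finset.expect_comm]
  simp only [expect_entry (X := X) _ (F _)]
  rw [expect_embedding_apply k (fun p : I × J => 𝔼 s, F p s)]

theorem expect_shuffled [Nonempty I] [Nonempty J] (i : I) (k : J) (F : X i → ∀ j, X j → M) :
    𝔼 τ : ∀ i, J → X i, 𝔼 y : ∀ i, J → X i, 𝔼 ξ : J ↪ I × J,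
      F (τ i k) (ξ k).1 (y (ξ k).1 (ξ k).2) = 𝔼 t, 𝔼 j, 𝔼 s, F t j s := by
  have : Nonempty (J ↪ I × J) := nonempty_records
  simp only [expect_lazy_entry k (F _)]
  rw [expect_entry (X := X) (i, k) (fun t => 𝔼 j, 𝔼 s, F t j s)]

/-- Independent samples combined with records that are drawn without replacement give nonpositively
correlated variables. -/
theorem expect_shuffled_inner_nonpos [Nonempty I] (i : I) {k l : J} (hkl : k ≠ l)
    (F : X i → ∀ j, X j → H) :
    𝔼 τ : ∀ i, J → X i, 𝔼 y : ∀ i, J → X i, 𝔼 ξ : J ↪ I × J,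
      inner ℝ (F (τ i k) (ξ k).1 (y (ξ k).1 (ξ k).2) - 𝔼 t, 𝔼 j, 𝔼 s, F t j s)
        (F (τ i l) (ξ l).1 (y (ξ l).1 (ξ l).2) - 𝔼 t, 𝔼 j, 𝔼 s, F t j s) ≤ 0 := by
  have : Nonempty (J ↪ I × J) := nonempty_records
  have : Nonempty J := ⟨k⟩
  rw [Finset.expect_comm]
  -- With records and shuffle fixed, the training samples at `k` and `l` are independent, so each
  -- factor is replaced by its average over `t`. This leaves the case of records alone.
  have h1 : ∀ y : ∀ i, J → X i, 𝔼 τ : ∀ i, J → X i, 𝔼 ξ : J ↪ I × J,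
      inner ℝ (F (τ i k) (ξ k).1 (y (ξ k).1 (ξ k).2) - 𝔼 t, 𝔼 j, 𝔼 s, F t j s)
        (F (τ i l) (ξ l).1 (y (ξ l).1 (ξ l).2) - 𝔼 t, 𝔼 j, 𝔼 s, F t j s) = 𝔼 ξ : J ↪ I × J,
      inner ℝ ((fun j s => 𝔼 t, F t j s) (ξ k).1 (y (ξ k).1 (ξ k).2) -
        𝔼 j, 𝔼 s, (fun j s => 𝔼 t, F t j s) j s)
        ((fun j s => 𝔼 t, F t j s) (ξ l).1 (y (ξ l).1 (ξ l).2) -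
        𝔼 j, 𝔼 s, (fun j s => 𝔼 t, F t j s) j s) := fun y => by
    rw [Finset.expect_comm]
    refine Finset.expect_congr rfl fun ξ _ => ?_
    have hne : (i, k) ≠ (i, l) := fun h => hkl (Prod.mk.inj h).2
    rw [expect_inner_entries (X := X) hne
      (fun t => F t (ξ k).1 (y (ξ k).1 (ξ k).2) - 𝔼 t, 𝔼 j, 𝔼 s, F t j s)
      (fun t => F t (ξ l).1 (y (ξ l).1 (ξ l).2) - 𝔼 t, 𝔼 j, 𝔼 s, F t j s)]
    have h2 : 𝔼 t, 𝔼 j, 𝔼 s, F t j s = 𝔼 j, 𝔼 s, 𝔼 t, F t j s := by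
      rw [Finset.expect_comm]
      exact Finset.expect_congr rfl fun j _ => Finset.expect_comm _ _ _
    simp only [Finset.expect_sub_distrib, Fintype.expect_const, h2]
  simp only [h1]
  exact expect_lazy_inner_nonpos (X := X) hkl (fun j s => 𝔼 t, F t j s)

end Shuffled

/-! ### Sampling noise of the gradient estimates. -/

namespace Problem

variable {N d : ℕ} {Z : Type*} (P : Problem N d Z)

instance nonempty_data1 (i : Fin N) : Nonempty (P.S1 i) := (P.nonempty1 i).to_subtype

instance nonempty_data2 (i : Fin N) : Nonempty (P.S2 i) := (P.nonempty2 i).to_subtype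

theorem nonempty_roundSample {K : ℕ} (hN : 0 < N) : Nonempty (P.RoundSample K) := by
  have : Nonempty (Fin N) := ⟨⟨0, hN⟩⟩
  have : Nonempty (Fin K ↪ Fin N × Fin K) := nonempty_records
  infer_instance

variable {M : Type*} [AddCommMonoid M] [Module ℚ≥0 M] {K : ℕ}

theorem expect_round1 (hN : 0 < N) (i : Fin N) (f : (∀ i : Fin N, Fin K → P.S1 i × P.S2 i) →
    (∀ i : Fin N, Fin K → P.S1 i × P.S2 i) → (Fin K ↪ Fin N × Fin K) → M) :
    𝔼 ν : P.RoundSample K, f (train ν) (sent ν) (shuffle1 ν i) = 𝔼 τ, 𝔼 y, 𝔼 ξ, f τ y ξ := by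
  have : Nonempty (Fin N) := ⟨⟨0, hN⟩⟩
  have : Nonempty (Fin K ↪ Fin N × Fin K) := nonempty_records
  rw [expect_prod]
  refine Finset.expect_congr rfl fun τ _ => ?_
  rw [expect_prod]
  refine Finset.expect_congr rfl fun y _ => ?_
  rw [expect_prod]
  change 𝔼 a : Fin N → Fin K ↪ Fin N × Fin K, 𝔼 b : Fin N → Fin K ↪ Fin N × Fin K,
    f τ y (a i) = _
  simp only [Fintype.expect_const]
  exact expect_pi_apply (X := fun _ : Fin N => Fin K ↪ Fin N × Fin K) i (fun ξ => f τ y ξ)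

theorem expect_round2 (hN : 0 < N) (i : Fin N) (f : (∀ i : Fin N, Fin K → P.S1 i × P.S2 i) →
    (∀ i : Fin N, Fin K → P.S1 i × P.S2 i) → (Fin K ↪ Fin N × Fin K) → M) :
    𝔼 ν : P.RoundSample K, f (train ν) (sent ν) (shuffle2 ν i) = 𝔼 τ, 𝔼 y, 𝔼 ξ, f τ y ξ := by
  have : Nonempty (Fin N) := ⟨⟨0, hN⟩⟩
  have : Nonempty (Fin K ↪ Fin N × Fin K) := nonempty_records
  rw [expect_prod]
  refine Finset.expect_congr rfl fun τ _ => ?_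
  rw [expect_prod]
  refine Finset.expect_congr rfl fun y _ => ?_
  rw [expect_prod]
  change 𝔼 a : Fin N → Fin K ↪ Fin N × Fin K, 𝔼 b : Fin N → Fin K ↪ Fin N × Fin K,
    f τ y (b i) = _
  simp only [Fintype.expect_const]
  exact expect_pi_apply (X := fun _ : Fin N => Fin K ↪ Fin N × Fin K) i (fun ξ => f τ y ξ)

variable (w : Vec d) (ν : P.RoundSample K) (i : Fin N)

/-- The first summand of the gradient estimate, evaluated at the model `w`. -/
def frozen1 (k : Fin K) : Vec d :=
  P.pairGrad1 w (train ν i k).1 (sent ν (shuffle2 ν i k).1 (shuffle2 ν i k).2).2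

/-- The second summand of the gradient estimate, evaluated at the model `w`. -/
def frozen2 (k : Fin K) : Vec d :=
  P.pairGrad2 w (sent ν (shuffle1 ν i k).1 (shuffle1 ν i k).2).1 (train ν i k).2

/-- The expectation of `frozen1`. -/
def mean1 : Vec d :=
  𝔼 t : P.S1 i × P.S2 i, 𝔼 j : Fin N, 𝔼 s : P.S1 j × P.S2 j, P.pairGrad1 w t.1 s.2

/-- The expectation of `frozen2`. -/
def mean2 : Vec d :=
  𝔼 t : P.S1 i × P.S2 i, 𝔼 j : Fin N, 𝔼 s : P.S1 j × P.S2 j, P.pairGrad2 w s.1 t.2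

/-- The noise of the first summand of the gradient estimate. -/
def noise1 (k : ℕ) : Vec d := extendZero (fun k : Fin K => P.frozen1 w ν i k - P.mean1 w i) k

/-- The noise of the second summand of the gradient estimate. -/
def noise2 (k : ℕ) : Vec d := extendZero (fun k : Fin K => P.frozen2 w ν i k - P.mean2 w i) k

variable {P} {B c q l L a b : ℝ} (hP : P.Bounds B c q l L a b)
include hP

/-- The means of one client need not give the gradient: `mean1` takes its first point from client
`i` and its second from all clients, and `mean2` the reverse. Averaging over `i` and exchanging the
two client averages in the second summand restores the gradient. -/
theorem Bounds.grad_eq_mean : gradient P.risk w = 𝔼 i, (P.mean1 w i + P.mean2 w i) := by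
  have e1 : ∀ i, P.mean1 w i = 𝔼 z ∈ P.S1 i, 𝔼 j, 𝔼 z' ∈ P.S2 j, P.pairGrad1 w z z' := fun i => by
    rw [mean1, expect_prod]
    simp only [Fintype.expect_const]
    rw [expect_subtype (P.S1 i)
      (fun z => 𝔼 j, 𝔼 s : P.S1 j × P.S2 j, P.pairGrad1 w z s.2)]
    refine Finset.expect_congr rfl fun z _ => Finset.expect_congr rfl fun j _ => ?_
    rw [expect_prod]
    simp only [Fintype.expect_const]
    exact expect_subtype (P.S2 j) (fun z' => P.pairGrad1 w z z')
  have e2 : ∀ i, P.mean2 w i = 𝔼 j, 𝔼 z ∈ P.S1 j, 𝔼 z' ∈ P.S2 i, P.pairGrad2 w z z' := fun i => by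
    rw [mean2, expect_prod]
    simp only [Fintype.expect_const]
    rw [expect_subtype (P.S2 i)
      (fun z' => 𝔼 j, 𝔼 s : P.S1 j × P.S2 j, P.pairGrad2 w s.1 z'), Finset.expect_comm]
    refine Finset.expect_congr rfl fun j _ => Eq.trans ?_ (Finset.expect_comm _ _ _)
    refine Finset.expect_congr rfl fun z' _ => ?_
    rw [expect_prod]
    simp only [Fintype.expect_const]
    exact expect_subtype (P.S1 j) (fun z => P.pairGrad2 w z z')
  rw [hP.grad_eq, Finset.expect_add_distrib]
  simp only [Finset.expect_add_distrib, e1, e2]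
  congr 1
  rw [Finset.expect_comm]
  refine Finset.expect_congr rfl fun j _ => ?_
  rw [Finset.expect_comm]

theorem Bounds.norm_frozen1_le (k : Fin K) : ‖P.frozen1 w ν i k‖ ≤ c :=
  hP.term1 (train ν i k).1.2 _ _ _ _

theorem Bounds.norm_frozen2_le (k : Fin K) : ‖P.frozen2 w ν i k‖ ≤ c :=
  hP.term2 (train ν i k).2.2 _ _ _ _

theorem Bounds.norm_mean1_le : ‖P.mean1 w i‖ ≤ c := by
  have : Nonempty (Fin N) := ⟨⟨0, hP.pos⟩⟩
  rw [mean1]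
  refine norm_expect_le_of_le fun t => ?_
  refine norm_expect_le_of_le fun j => ?_
  refine norm_expect_le_of_le fun s => ?_
  exact hP.term1 t.1.2 _ _ _ _

theorem Bounds.norm_mean2_le : ‖P.mean2 w i‖ ≤ c := by
  have : Nonempty (Fin N) := ⟨⟨0, hP.pos⟩⟩
  rw [mean2]
  refine norm_expect_le_of_le fun t => ?_
  refine norm_expect_le_of_le fun j => ?_
  refine norm_expect_le_of_le fun s => ?_
  exact hP.term2 t.2.2 _ _ _ _

theorem Bounds.norm_noise1_le (k : ℕ) : ‖P.noise1 w ν i k‖ ≤ 2 * c := by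
  have := hP.nonneg.2.1
  rw [noise1, extendZero]
  split_ifs with hk
  · rw [two_mul]
    exact (norm_sub_le _ _).trans (add_le_add (hP.norm_frozen1_le w ν i _) (hP.norm_mean1_le w i))
  · rw [norm_zero]
    positivity

theorem Bounds.norm_noise2_le (k : ℕ) : ‖P.noise2 w ν i k‖ ≤ 2 * c := by
  have := hP.nonneg.2.1
  rw [noise2, extendZero]
  split_ifs with hk
  · rw [two_mul]
    exact (norm_sub_le _ _).trans (add_le_add (hP.norm_frozen2_le w ν i _) (hP.norm_mean2_le w i))
  · rw [norm_zero]
    positivity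

theorem Bounds.expect_noise1 (k : ℕ) : 𝔼 ν : P.RoundSample K, P.noise1 w ν i k = 0 := by
  have : Nonempty (Fin N) := ⟨⟨0, hP.pos⟩⟩
  have := P.nonempty_roundSample (K := K) hP.pos
  simp only [noise1, extendZero]
  split_ifs with hk
  · have : Nonempty (Fin K) := ⟨⟨k, hk⟩⟩
    rw [Finset.expect_sub_distrib, Fintype.expect_const, sub_eq_zero]
    rw [mean1, ← expect_shuffled (X := fun i => P.S1 i × P.S2 i) i (⟨k, hk⟩ : Fin K)
        (fun t j s => P.pairGrad1 w t.1 s.2),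
      ← P.expect_round2 (K := K) hP.pos i (fun τ y ξ => P.pairGrad1 w (τ i ⟨k, hk⟩).1
        (y (ξ ⟨k, hk⟩).1 (ξ ⟨k, hk⟩).2).2)]
    rfl
  · simp

theorem Bounds.expect_noise2 (k : ℕ) : 𝔼 ν : P.RoundSample K, P.noise2 w ν i k = 0 := by
  have : Nonempty (Fin N) := ⟨⟨0, hP.pos⟩⟩
  have := P.nonempty_roundSample (K := K) hP.pos
  simp only [noise2, extendZero]
  split_ifs with hk
  · have : Nonempty (Fin K) := ⟨⟨k, hk⟩⟩
    rw [Finset.expect_sub_distrib, Fintype.expect_const, sub_eq_zero]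
    rw [mean2, ← expect_shuffled (X := fun i => P.S1 i × P.S2 i) i (⟨k, hk⟩ : Fin K)
        (fun t j s => P.pairGrad2 w s.1 t.2),
      ← P.expect_round1 (K := K) hP.pos i (fun τ y ξ => P.pairGrad2 w
        (y (ξ ⟨k, hk⟩).1 (ξ ⟨k, hk⟩).2).1 (τ i ⟨k, hk⟩).2)]
    rfl
  · simp

theorem Bounds.expect_inner_noise1_nonpos {k l : ℕ} (hkl : k ≠ l) :
    𝔼 ν : P.RoundSample K, inner ℝ (P.noise1 w ν i k) (P.noise1 w ν i l) ≤ 0 := by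
  have : Nonempty (Fin N) := ⟨⟨0, hP.pos⟩⟩
  by_cases hk : k < K
  · by_cases hl : l < K
    · have hne : (⟨k, hk⟩ : Fin K) ≠ ⟨l, hl⟩ := fun h => hkl (Fin.mk.inj h)
      simp only [noise1, extendZero, hk, hl, dif_pos]
      exact (P.expect_round2 hP.pos i (fun τ y ξ => inner ℝ
        (P.pairGrad1 w (τ i ⟨k, hk⟩).1 (y (ξ ⟨k, hk⟩).1 (ξ ⟨k, hk⟩).2).2 - P.mean1 w i)
        (P.pairGrad1 w (τ i ⟨l, hl⟩).1 (y (ξ ⟨l, hl⟩).1 (ξ ⟨l, hl⟩).2).2 - P.mean1 w i))).trans_le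
        (expect_shuffled_inner_nonpos (X := fun i => P.S1 i × P.S2 i) i hne
          (fun t j s => P.pairGrad1 w t.1 s.2))
    · simp [noise1, extendZero, hl]
  · simp [noise1, extendZero, hk]

theorem Bounds.expect_inner_noise2_nonpos {k l : ℕ} (hkl : k ≠ l) :
    𝔼 ν : P.RoundSample K, inner ℝ (P.noise2 w ν i k) (P.noise2 w ν i l) ≤ 0 := by
  have : Nonempty (Fin N) := ⟨⟨0, hP.pos⟩⟩
  by_cases hk : k < K
  · by_cases hl : l < K
    · have hne : (⟨k, hk⟩ : Fin K) ≠ ⟨l, hl⟩ := fun h => hkl (Fin.mk.inj h)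
      simp only [noise2, extendZero, hk, hl, dif_pos]
      exact (P.expect_round1 hP.pos i (fun τ y ξ => inner ℝ
        (P.pairGrad2 w (y (ξ ⟨k, hk⟩).1 (ξ ⟨k, hk⟩).2).1 (τ i ⟨k, hk⟩).2 - P.mean2 w i)
        (P.pairGrad2 w (y (ξ ⟨l, hl⟩).1 (ξ ⟨l, hl⟩).2).1 (τ i ⟨l, hl⟩).2 - P.mean2 w i))).trans_le
        (expect_shuffled_inner_nonpos (X := fun i => P.S1 i × P.S2 i) i hne
          (fun t j s => P.pairGrad2 w s.1 t.2))
    · simp [noise2, extendZero, hl]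
  · simp [noise2, extendZero, hk]

/-- The part of the averaged gradient estimator that comes from the sampling noise of the round. -/
theorem Bounds.expect_sq_noise_le {β : ℝ} (hβ : 0 ≤ β) (hβ1 : β ≤ 1) (k : ℕ) :
    𝔼 ν : P.RoundSample K, ‖𝔼 i, (movingAverage β (P.noise1 w ν i) k +
      movingAverage β (P.noise2 w ν i) k)‖ ^ 2 ≤ 16 * k * (β * c) ^ 2 := by
  have : Nonempty (Fin N) := ⟨⟨0, hP.pos⟩⟩
  have := P.nonempty_roundSample (K := K) hP.pos
  -- Jensen over the clients: cancellation is used only along the iterations of one client, neither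
  -- between clients nor between the two summands.
  have h : ∀ ν : P.RoundSample K, ‖𝔼 i, (movingAverage β (P.noise1 w ν i) k +
      movingAverage β (P.noise2 w ν i) k)‖ ^ 2 ≤
      𝔼 i, (2 * ‖movingAverage β (P.noise1 w ν i) k‖ ^ 2 +
        2 * ‖movingAverage β (P.noise2 w ν i) k‖ ^ 2) := fun ν =>
    (norm_sq_expect_le _ _).trans (expect_mono fun i => by
      have h1 := norm_add_le (movingAverage β (P.noise1 w ν i) k)
        (movingAverage β (P.noise2 w ν i) k)
      have h2 := pow_le_pow_left₀ (norm_nonneg _) h1 2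
      nlinarith [sq_nonneg (‖movingAverage β (P.noise1 w ν i) k‖ -
        ‖movingAverage β (P.noise2 w ν i) k‖)])
  refine (expect_mono h).trans ?_
  rw [Finset.expect_comm]
  refine Finset.expect_le Finset.univ_nonempty fun i _ => ?_
  rw [Finset.expect_add_distrib, ← Finset.mul_expect, ← Finset.mul_expect]
  have h1 := expect_sq_movingAverage_le hβ hβ1 (v := fun ν : P.RoundSample K => P.noise1 w ν i)
    (fun k l hkl => hP.expect_inner_noise1_nonpos w i hkl)
    (fun ν k => hP.norm_noise1_le w ν i k) k
  have h2 := expect_sq_movingAverage_le hβ hβ1 (v := fun ν : P.RoundSample K => P.noise2 w ν i)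
    (fun k l hkl => hP.expect_inner_noise2_nonpos w i hkl)
    (fun ν k => hP.norm_noise2_le w ν i k) k
  calc _ ≤ 2 * (k * (β * (2 * c)) ^ 2) + 2 * (k * (β * (2 * c)) ^ 2) := by gcongr
    _ = _ := by ring

theorem Bounds.expect_noise (β : ℝ) (k : ℕ) :
    𝔼 ν : P.RoundSample K, 𝔼 i, (movingAverage β (P.noise1 w ν i) k +
      movingAverage β (P.noise2 w ν i) k) = 0 := by
  rw [Finset.expect_comm]
  refine Finset.expect_eq_zero fun i _ => ?_
  rw [Finset.expect_add_distrib,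
    expect_movingAverage β (v := fun ν : P.RoundSample K => P.noise1 w ν i)
      (fun k => hP.expect_noise1 w i k),
    expect_movingAverage β (v := fun ν : P.RoundSample K => P.noise2 w ν i)
      (fun k => hP.expect_noise2 w i k), add_zero]

end Problem

/-! ### Tracking of the inner risk by the inner estimators. -/

section InnerEstimator

/-- An exponential moving average with weight `γ`, updated at the steps where `b` is `1`. -/
def lazyAverage (γ e : ℝ) (b v : ℕ → ℝ) : ℕ → ℝ
  | 0 => e
  | k + 1 => (1 - γ * b k) * lazyAverage γ e b v k + γ * b k * v k

/-- In the cross term `e * t`, the drift part `e * r` is absorbed by Young's inequality at the cost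
of half the contraction. In the noise part, `e` is replaced by a nearby proxy `p` whose product with
`n` will have nonpositive mean. -/
theorem sq_convex_step_le {γ e t n r p s δ B : ℝ} (hγ : 0 ≤ γ) (hγ1 : γ ≤ 1) (ht : |t| ≤ 2 * B)
    (htn : t = n + r) (hr : |r| ≤ δ) (hs : |e - p| ≤ s) (hn : |n| ≤ 2 * B) :
    ((1 - γ) * e + γ * t) ^ 2 ≤
      e ^ 2 + γ * (δ ^ 2 + 4 * γ * B ^ 2 + 4 * s * B - e ^ 2) + 2 * γ * (1 - γ) * (p * n) := by
  have hs0 := (abs_nonneg _).trans hs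
  have h1 : t ^ 2 ≤ 4 * B ^ 2 := by
    have := sq_le_sq' (abs_le.1 ht).1 (abs_le.1 ht).2
    linarith
  have h2 : r ^ 2 ≤ δ ^ 2 := sq_le_sq' (abs_le.1 hr).1 (abs_le.1 hr).2
  have h3 : (e - p) * n ≤ s * (2 * B) :=
    (le_abs_self _).trans (by rw [abs_mul]; gcongr)
  have h4 : 2 * (e * r) ≤ e ^ 2 + δ ^ 2 := by nlinarith [sq_nonneg (e - r)]
  have h5 : γ * (1 - γ) * (2 * (e * r)) ≤ γ * (1 - γ) * (e ^ 2 + δ ^ 2) :=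
    mul_le_mul_of_nonneg_left h4 (mul_nonneg hγ (by linarith))
  have h6 : 2 * γ * (1 - γ) * ((e - p) * n) ≤ 2 * γ * (1 - γ) * (s * (2 * B)) :=
    mul_le_mul_of_nonneg_left h3 (mul_nonneg (by linarith) (by linarith))
  have h7 : γ ^ 2 * t ^ 2 ≤ γ ^ 2 * (4 * B ^ 2) := mul_le_mul_of_nonneg_left h1 (sq_nonneg γ)
  have h8 : 0 ≤ γ ^ 2 * δ ^ 2 := by positivity
  have hB : 0 ≤ B := by linarith [(abs_nonneg _).trans hn]
  have h9 : 0 ≤ γ ^ 2 * (s * B) := by positivity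
  subst htn
  nlinarith

end InnerEstimator

/-- The step sizes are small enough for the one-round estimates. -/
structure Rates.Admissible (θ : Rates) (K M : ℕ) (L : ℝ) : Prop where
  K_pos : 0 < K
  γ_pos : 0 < θ.γ
  γ_le : θ.γ ≤ 1
  β_pos : 0 < θ.β
  βK_le : θ.β * K ≤ 1
  η_pos : 0 < θ.η
  γK_le : θ.γ * K ≤ M
  ηK_le : θ.η * K * L ≤ 1 / 4

theorem Rates.Admissible.β_le {θ : Rates} {K M : ℕ} {L : ℝ} (h : θ.Admissible K M L) : θ.β ≤ 1 := by
  have h1 : (1 : ℝ) ≤ K := by exact_mod_cast h.K_pos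
  nlinarith [h.βK_le, h.β_pos]

namespace PreState

variable {N d : ℕ} {Z : Type*} {P : Problem N d Z} {K : ℕ}

open Classical in
/-- Whether the inner estimator of `z` is updated at iteration `k`. -/
def hit (τ : ∀ i : Fin N, Fin K → P.S1 i × P.S2 i) {i : Fin N} (z : P.S1 i) (k : ℕ) : ℝ :=
  extendZero (fun k : Fin K => if (τ i k).1 = z then 1 else 0) k

/-- The error of the loss on a record as an estimate of the inner risk, at the model `w`. -/
def lossNoise (P : Problem N d Z) (w : Vec d) (z : Z) (y : ∀ i : Fin N, Fin K → P.S1 i × P.S2 i)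
    (ξ : Fin K ↪ Fin N × Fin K) (k : ℕ) : ℝ :=
  extendZero (fun k : Fin K => P.ℓ !₂[P.h w z, P.h w (y (ξ k).1 (ξ k).2).2] - P.innerRisk w z) k

/-- The error of the inner estimator at `z`, relative to the model at the start of the round. -/
def innerErr (x : PreState P K) (θ : Rates) (ν : P.RoundSample K) (i : Fin N) (k : ℕ) (z : P.S1 i) :
    ℝ := (x.loc θ ν i k).u z - P.innerRisk x.w z

theorem hit_nonneg (τ : ∀ i : Fin N, Fin K → P.S1 i × P.S2 i) {i : Fin N} (z : P.S1 i) (k : ℕ) :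
    0 ≤ hit τ z k := by
  rw [hit, extendZero]
  split_ifs <;> norm_num

theorem hit_le_one (τ : ∀ i : Fin N, Fin K → P.S1 i × P.S2 i) {i : Fin N} (z : P.S1 i) (k : ℕ) :
    hit τ z k ≤ 1 := by
  rw [hit, extendZero]
  split_ifs <;> norm_num

/-- The sample of iteration `k` is independent of anything unaffected by redrawing it, in particular
of the inner errors before that iteration (`innerErr_updateEntry`). -/
theorem expect_train (i : Fin N) (k : Fin K) (ψ : P.RoundSample K → P.S1 i → ℝ)
    (hψ : ∀ (ν : P.RoundSample K) s z,
      ψ (updateEntry (X := fun i => P.S1 i × P.S2 i) (i, k) ν.1 s, ν.2) z = ψ ν z) :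
    𝔼 ν : P.RoundSample K, ψ ν (train ν i k).1 = 𝔼 ν : P.RoundSample K, 𝔼 z, ψ ν z := by
  rw [expect_resample (S := P.S1 i × P.S2 i) (fun ν : P.RoundSample K => ν.1 i k)
    (fun ν s => (updateEntry (X := fun i => P.S1 i × P.S2 i) (i, k) ν.1 s, ν.2))
    (fun ν s => updateEntry_self (X := fun i => P.S1 i × P.S2 i) (i, k) ν.1 s)
    (fun ν s => Prod.ext
      (updateEntry_updateEntry (X := fun i => P.S1 i × P.S2 i) (i, k) ν.1 s) rfl)]
  refine Finset.expect_congr rfl fun ν _ => ?_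
  have h : ∀ s : P.S1 i × P.S2 i, ψ (updateEntry (X := fun i => P.S1 i × P.S2 i) (i, k) ν.1 s, ν.2)
      (train (updateEntry (X := fun i => P.S1 i × P.S2 i) (i, k) ν.1 s, ν.2) i k).1 = ψ ν s.1 :=
    fun s => by
      rw [hψ]
      exact congrArg (fun t => ψ ν t.1)
        (updateEntry_self (X := fun i => P.S1 i × P.S2 i) (i, k) ν.1 s)
  simp only [h]
  rw [expect_prod]
  simp only [Fintype.expect_const]

variable {x : PreState P K} {θ : Rates} {B c q l L a b : ℝ}

theorem innerErr_updateEntry (i : Fin N) (k : Fin K) (ν : P.RoundSample K) (s) (z : P.S1 i) :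
    x.innerErr θ (updateEntry (X := fun i => P.S1 i × P.S2 i) (i, k) ν.1 s, ν.2) i k z =
      x.innerErr θ ν i k z := by
  have h : x.loc θ (updateEntry (X := fun i => P.S1 i × P.S2 i) (i, k) ν.1 s, ν.2) i k =
      x.loc θ ν i k := x.loc_congr θ
        (updateEntry (X := fun i => P.S1 i × P.S2 i) (i, k) ν.1 s, ν.2) i (ν' := ν)
        rfl rfl rfl k fun j hj => by
    have hne : (i, j) ≠ (i, k) := fun h => hj.ne (congrArg Fin.val (Prod.mk.inj h).2)
    exact updateEntry_of_ne (X := fun i => P.S1 i × P.S2 i) hne ν.1 s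
  rw [innerErr, h, innerErr]

theorem expect_hit_mul (i : Fin N) (k : Fin K) (z : P.S1 i)
    (φ : P.RoundSample K → ℝ) (hφ : ∀ (ν : P.RoundSample K) s,
      φ (updateEntry (X := fun i => P.S1 i × P.S2 i) (i, k) ν.1 s, ν.2) = φ ν) :
    𝔼 ν : P.RoundSample K, hit (train ν) z k * φ ν =
      ((P.S1 i).card : ℝ)⁻¹ * 𝔼 ν : P.RoundSample K, φ ν := by
  classical
  have h := expect_train i k (fun ν z' => (if z' = z then 1 else 0) * φ ν)
    (fun ν s z' => by rw [hφ])
  have h1 : ∀ ν : P.RoundSample K, hit (train ν) z k * φ ν =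
      (if (train ν i k).1 = z then 1 else 0) * φ ν := fun ν => by
    rw [hit, extendZero_val]
  simp only [h1, h, Finset.mul_expect]
  refine Finset.expect_congr rfl fun ν _ => ?_
  rw [Fintype.expect_eq_sum_div_card]
  simp [div_eq_inv_mul]

section

variable (hP : P.Bounds B c q l L a b)
include hP

omit hP in
theorem innerRisk_eq (w : Vec d) (z : Z) :
    P.innerRisk w z = 𝔼 j, 𝔼 s : P.S1 j × P.S2 j, P.ℓ !₂[P.h w z, P.h w s.2] := by
  refine Finset.expect_congr rfl fun j _ => ?_
  rw [expect_prod]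
  simp only [Fintype.expect_const]
  exact (expect_subtype (P.S2 j) (fun z' => P.ℓ !₂[P.h w z, P.h w z'])).symm

theorem abs_loss_sub_innerRisk_le (w : Vec d) (z : Z) (v : Vec 2) :
    |P.ℓ v - P.innerRisk w z| ≤ 2 * B := by
  rw [two_mul]
  exact (abs_sub _ _).trans (add_le_add (hP.loss _) (hP.inner_le _ _))

/-- Once the training samples are fixed, the update times `b'` are deterministic weights and
`expect_inner_recursion_nonpos` applies. The starting value `e` is constant, so centring of the
noise disposes of it. -/
theorem expect_lazyAverage_mul_nonpos {γ : ℝ} (hγ : 0 ≤ γ) (hγ1 : γ ≤ 1) (w : Vec d) (z : Z)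
    (e : ℝ) {b' : ℕ → ℝ} (hb : ∀ k, 0 ≤ b' k) (hb1 : ∀ k, b' k ≤ 1) (k : ℕ) :
    𝔼 y : ∀ i : Fin N, Fin K → P.S1 i × P.S2 i, 𝔼 ξ : Fin K ↪ Fin N × Fin K,
      lazyAverage γ e b' (lossNoise P w z y ξ) k * lossNoise P w z y ξ k ≤ 0 := by
  have : Nonempty (Fin N) := ⟨⟨0, hP.pos⟩⟩
  have : Nonempty (Fin K ↪ Fin N × Fin K) := nonempty_records
  have h := expect_inner_recursion_nonpos (H := ℝ)
    (Ω := (∀ i : Fin N, Fin K → P.S1 i × P.S2 i) × (Fin K ↪ Fin N × Fin K))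
    (β := fun k => γ * b' k) (fun k => mul_nonneg hγ (hb k))
    (fun k => mul_le_one₀ hγ1 (hb k) (hb1 k))
    (p := fun k ω => lazyAverage γ e b' (lossNoise P w z ω.1 ω.2) k)
    (v := fun k ω => lossNoise P w z ω.1 ω.2 k) (fun k ω => rfl) ?_ ?_ k k le_rfl
  · rw [expect_prod] at h
    simpa only [RCLike.inner_apply, conj_trivial, mul_comm] using h
  · intro j
    refine le_of_eq ?_
    simp only [lazyAverage, RCLike.inner_apply, conj_trivial, ← Finset.expect_mul]
    refine mul_eq_zero_of_left ?_ _
    rw [expect_prod]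
    simp only [lossNoise, extendZero]
    split_ifs with hj
    · have : Nonempty (Fin K) := ⟨⟨j, hj⟩⟩
      simp only [Finset.expect_sub_distrib, Fintype.expect_const]
      rw [sub_eq_zero, innerRisk_eq]
      exact expect_lazy_entry (X := fun i => P.S1 i × P.S2 i) (⟨j, hj⟩ : Fin K)
        (fun j s => P.ℓ !₂[P.h w z, P.h w s.2])
    · simp
  · intro j j' hjj
    rw [expect_prod]
    by_cases hj : j < K
    · by_cases hj' : j' < K
      · have hne : (⟨j, hj⟩ : Fin K) ≠ ⟨j', hj'⟩ := fun h => hjj (Fin.mk.inj h)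
        have : Nonempty (Fin K) := ⟨⟨j, hj⟩⟩
        simp only [lossNoise, extendZero, hj, hj', dif_pos, innerRisk_eq]
        exact expect_lazy_inner_nonpos (X := fun i => P.S1 i × P.S2 i) hne
          (fun j s => P.ℓ !₂[P.h w z, P.h w s.2])
      · simp [lossNoise, extendZero, hj']
    · simp [lossNoise, extendZero, hj]

variable {M : ℕ} (hθ : θ.Admissible K M L) (hx : x.Bounded B c) (hf : x.Fresh B (4 * c * θ.η * K))
include hθ hx hf

/-- One step of the inner estimator, split into the noise at the frozen model and a drift. -/
theorem innerErr_succ (ν : P.RoundSample K) {i : Fin N} (z : P.S1 i) (k : Fin K) :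
    ∃ r, |r| ≤ l * (4 * c * θ.η * K) ∧
      |lossNoise P x.w z (sent ν) (shuffle2 ν i) k + r| ≤ 2 * B ∧
      x.innerErr θ ν i (k + 1) z = (1 - θ.γ * hit (train ν) z k) * x.innerErr θ ν i k z +
        θ.γ * hit (train ν) z k * (lossNoise P x.w z (sent ν) (shuffle2 ν i) k + r) := by
  have hc := hP.nonneg.2.1
  refine ⟨P.ℓ !₂[P.h (x.loc θ ν i k).w z, P.h (x.wl (shuffle2 ν i k))
      (sent ν (shuffle2 ν i k).1 (shuffle2 ν i k).2).2] - P.ℓ !₂[P.h x.w z, P.h x.w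
      (sent ν (shuffle2 ν i k).1 (shuffle2 ν i k).2).2], ?_, ?_, ?_⟩
  · refine hP.loss_sub z.2 (sent ν _ _).2.2 ?_ (hf.1 _)
    refine (norm_loc_w_sub_le' ν i hP hx hθ.β_pos.le hθ.β_le hθ.η_pos.le k.2.le).trans ?_
    have := hθ.η_pos
    gcongr
    norm_num
  · rw [lossNoise, extendZero_val]
    have := abs_loss_sub_innerRisk_le hP x.w z !₂[P.h (x.loc θ ν i k).w z,
      P.h (x.wl (shuffle2 ν i k)) (sent ν (shuffle2 ν i k).1 (shuffle2 ν i k).2).2]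
    convert this using 2
    ring
  · rw [lossNoise, hit, extendZero_val, extendZero_val]
    by_cases hz : (train ν i k).1 = z
    · rw [if_pos hz]
      subst hz
      rw [innerErr, loc_succ_u_self, innerErr]
      ring
    · rw [if_neg hz, innerErr, loc_succ_u_of_ne _ _ _ _ _ (Ne.symm hz), innerErr]
      ring

/-- The true error and the frozen average obey the same recursion up to the drift, so each iteration
adds at most `γ` times the drift. The frozen average is needed because local models depend on
earlier records, so the true error is not a combination of noises with fixed weights. -/
theorem abs_innerErr_sub_le (ν : P.RoundSample K) {i : Fin N} (z : P.S1 i) :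
    ∀ k ≤ K, |x.innerErr θ ν i k z - lazyAverage θ.γ (x.u i z - P.innerRisk x.w z)
      (hit (train ν) z) (lossNoise P x.w z (sent ν) (shuffle2 ν i)) k| ≤
        θ.γ * k * (l * (4 * c * θ.η * K)) := by
  intro k
  induction k with
  | zero => intro _; simp [innerErr, loc_zero, lazyAverage]
  | succ k ih =>
    intro hk
    obtain ⟨r, hr, -, he⟩ := innerErr_succ hP hθ hx hf ν z ⟨k, hk⟩
    simp only at he
    rw [he, lazyAverage]
    have h0 := hit_nonneg (train ν) z k
    have h1 := hit_le_one (train ν) z k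
    have hg := hθ.γ_pos
    have hg1 := hθ.γ_le
    have hb0 : 0 ≤ θ.γ * hit (train ν) z k := by positivity
    have hb1 : θ.γ * hit (train ν) z k ≤ θ.γ := mul_le_of_le_one_right hg.le h1
    rw [show ∀ e p n g : ℝ, (1 - g) * e + g * (n + r) - ((1 - g) * p + g * n) =
      (1 - g) * (e - p) + g * r from fun e p n g => by ring]
    refine (abs_add_le _ _).trans ?_
    rw [abs_mul, abs_mul, abs_of_nonneg hb0, abs_of_nonneg (by linarith :
      0 ≤ 1 - θ.γ * hit (train ν) z k)]
    have h2 := ih (by omega)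
    push_cast
    calc _ ≤ 1 * (θ.γ * k * (l * (4 * c * θ.η * K))) + θ.γ * (l * (4 * c * θ.η * K)) := by
          gcongr
          linarith
      _ = _ := by ring

/-- The limiting accuracy of the inner estimators. -/
def trackingError (θ : Rates) (K : ℕ) (B c l : ℝ) : ℝ :=
  (l * (4 * c * θ.η * K)) ^ 2 + 4 * θ.γ * B ^ 2 +
    4 * (θ.γ * K * (l * (4 * c * θ.η * K))) * B

/-- The point `z` is drawn with probability `1 / m`, independently of its current error, so one step
of weight `γ` contracts the mean square at rate `γ / m`. The product of the proxy with the noise is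
averaged over records and shuffle for fixed training samples, where it is nonpositive. -/
theorem expect_sq_innerErr_succ_le {i : Fin N} (z : P.S1 i) (k : Fin K) :
    𝔼 ν : P.RoundSample K, x.innerErr θ ν i (k + 1) z ^ 2 ≤
      𝔼 ν : P.RoundSample K, x.innerErr θ ν i k z ^ 2 + θ.γ / (P.S1 i).card *
        (trackingError θ K B c l - 𝔼 ν : P.RoundSample K, x.innerErr θ ν i k z ^ 2) := by
  have := P.nonempty_roundSample (K := K) hP.pos
  obtain ⟨hB, hc, -, hl, -⟩ := hP.nonneg
  have hg := hθ.γ_pos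
  have hg1 := hθ.γ_le
  have hη := hθ.η_pos
  set p : P.RoundSample K → ℝ := fun ν => lazyAverage θ.γ (x.u i z - P.innerRisk x.w z)
      (hit (train ν) z) (lossNoise P x.w z (sent ν) (shuffle2 ν i)) k with hp
  set n : P.RoundSample K → ℝ := fun ν => lossNoise P x.w z (sent ν) (shuffle2 ν i) k with hn
  have step : ∀ ν : P.RoundSample K, x.innerErr θ ν i (k + 1) z ^ 2 ≤
      x.innerErr θ ν i k z ^ 2 + θ.γ * (hit (train ν) z k *
        (trackingError θ K B c l - x.innerErr θ ν i k z ^ 2)) +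
        2 * θ.γ * (1 - θ.γ) * (hit (train ν) z k * (p ν * n ν)) := by
    intro ν
    obtain ⟨r, hr, ht, he⟩ := innerErr_succ hP hθ hx hf ν z k
    rw [he]
    have h01 : hit (train ν) z k = 1 ∨ hit (train ν) z k = 0 := by
      rw [hit, extendZero_val]
      split_ifs <;> simp
    rcases h01 with h1 | h0
    · have hs : |x.innerErr θ ν i k z - p ν| ≤ θ.γ * K * (l * (4 * c * θ.η * K)) := by
        refine (abs_innerErr_sub_le hP hθ hx hf ν z k k.2.le).trans ?_
        have : ((k : ℕ) : ℝ) ≤ K := by exact_mod_cast k.2.le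
        gcongr
      have hn' : |n ν| ≤ 2 * B := by
        rw [hn]
        simp only [lossNoise, extendZero_val]
        exact abs_loss_sub_innerRisk_le hP _ _ _
      have := sq_convex_step_le hg.le hg1 ht rfl hr hs hn'
      rw [h1, mul_one, one_mul, one_mul]
      rw [trackingError]
      exact this
    · rw [h0]
      simp
  refine (expect_mono step).trans ?_
  have hE : 𝔼 ν : P.RoundSample K, hit (train ν) z k *
      (trackingError θ K B c l - x.innerErr θ ν i k z ^ 2) = ((P.S1 i).card : ℝ)⁻¹ *
      (trackingError θ K B c l - 𝔼 ν : P.RoundSample K, x.innerErr θ ν i k z ^ 2) := by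
    rw [expect_hit_mul i k z _ fun ν s => by rw [innerErr_updateEntry],
      Finset.expect_sub_distrib, Fintype.expect_const]
  have hN : 𝔼 ν : P.RoundSample K, hit (train ν) z k * (p ν * n ν) ≤ 0 := by
    rw [hp, hn]
    refine (P.expect_round2 (K := K) hP.pos i (fun τ y ξ => hit τ z k *
      (lazyAverage θ.γ (x.u i z - P.innerRisk x.w z) (hit τ z) (lossNoise P x.w z y ξ) k *
        lossNoise P x.w z y ξ k))).trans_le ?_
    simp only [← Finset.mul_expect]
    have : Nonempty (∀ i : Fin N, Fin K → P.S1 i × P.S2 i) := ⟨this.some.1⟩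
    refine Finset.expect_le Finset.univ_nonempty fun τ _ => ?_
    exact mul_nonpos_of_nonneg_of_nonpos (hit_nonneg τ z k)
      (expect_lazyAverage_mul_nonpos hP hg.le hg1 x.w z _ (hit_nonneg τ z) (hit_le_one τ z) k)
  rw [Finset.expect_add_distrib, Finset.expect_add_distrib, ← Finset.mul_expect,
    ← Finset.mul_expect, hE]
  have h2 : 2 * θ.γ * (1 - θ.γ) * 𝔼 ν : P.RoundSample K, hit (train ν) z k * (p ν * n ν) ≤ 0 :=
    mul_nonpos_of_nonneg_of_nonpos (mul_nonneg (by positivity) (by linarith)) hN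
  rw [div_eq_mul_inv, mul_assoc]
  linarith

end

end PreState

/-! ### Scalar contractions and Young inequalities. -/

section RealSequences

theorem expect_fin_eq {K : ℕ} (V : ℕ → ℝ) :
    𝔼 k : Fin K, V k = (∑ k ∈ Finset.range K, V k) / K := by
  rw [Fintype.expect_eq_sum_div_card, Fintype.card_fin, Finset.sum_range]

variable {K : ℕ} {V : ℕ → ℝ} {ρ T : ℝ} (hK : 0 < K) (hρ : 0 < ρ)
  (hV : ∀ k < K, V (k + 1) ≤ V k + ρ * (T - V k))
include hK hρ hV

theorem expect_le_of_contraction : 𝔼 k : Fin K, V k ≤ (V 0 - V K) / (ρ * K) + T := by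
  have h : ∀ n ≤ K, ρ * ∑ k ∈ Finset.range n, V k ≤ V 0 - V n + ρ * n * T := by
    intro n
    induction n with
    | zero => simp
    | succ n ih =>
      intro hn
      have h1 := ih (by omega)
      have h2 := hV n (by omega)
      rw [Finset.sum_range_succ]
      push_cast
      linarith
  have hK' : (0 : ℝ) < K := by exact_mod_cast hK
  have h1 := h K le_rfl
  rw [expect_fin_eq, div_add' _ _ _ (by positivity), div_le_div_iff₀ hK' (by positivity)]
  nlinarith

/-- A bound `V k + T` propagates forward, since each step is a convex combination with `T`. The last
value is thus below every earlier one plus `T`, hence below their mean plus `T`. -/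
theorem last_le_of_contraction (hρ1 : ρ ≤ 1) (hV0 : ∀ k, 0 ≤ V k) (hT : 0 ≤ T) :
    V K ≤ 𝔼 k : Fin K, V k + T := by
  have h : ∀ k n, k + n ≤ K → V (k + n) ≤ V k + T := by
    intro k n
    induction n with
    | zero => intro _; simpa using hT
    | succ n ih =>
      intro hn
      have h1 := ih (by omega)
      have h2 := hV (k + n) (by omega)
      rw [← add_assoc]
      nlinarith [hV0 k]
  have : Nonempty (Fin K) := ⟨⟨0, hK⟩⟩
  rw [← Fintype.expect_const (ι := Fin K) T, ← Finset.expect_add_distrib,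
    ← Fintype.expect_const (ι := Fin K) (V K)]
  refine expect_mono fun k => ?_
  have := h k (K - k) (by omega)
  rwa [Nat.add_sub_cancel' k.2.le] at this

theorem expect_succ_le_of_contraction (hρ1 : ρ ≤ 1) (hV0 : ∀ k, 0 ≤ V k) (hT : 0 ≤ T) :
    𝔼 k : Fin K, V (k + 1) ≤ 𝔼 k : Fin K, V k + T := by
  have : Nonempty (Fin K) := ⟨⟨0, hK⟩⟩
  rw [← Fintype.expect_const (ι := Fin K) T, ← Finset.expect_add_distrib]
  refine expect_mono fun k => ?_
  have := hV k k.2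
  nlinarith [hV0 k]

end RealSequences

theorem sq_add_le_young {x y α : ℝ} (hα : 0 < α) :
    (x + y) ^ 2 ≤ (1 + α) * x ^ 2 + (1 + 1 / α) * y ^ 2 := by
  have h : 0 ≤ (α * x - y) ^ 2 / α := by positivity
  have e : (α * x - y) ^ 2 / α = α * x ^ 2 - 2 * x * y + 1 / α * y ^ 2 := by
    field_simp
    ring
  nlinarith

theorem sq_norm_add_le_young {E : Type*} [NormedAddCommGroup E] (x y : E) {α : ℝ} (hα : 0 < α) :
    ‖x + y‖ ^ 2 ≤ (1 + α) * ‖x‖ ^ 2 + (1 + 1 / α) * ‖y‖ ^ 2 :=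
  (pow_le_pow_left₀ (norm_nonneg _) (norm_add_le x y) 2).trans (sq_add_le_young hα)

theorem sq_norm_add_three_le {E : Type*} [NormedAddCommGroup E] (x y z : E) :
    ‖x + y + z‖ ^ 2 ≤ 3 * ‖x‖ ^ 2 + 3 * ‖y‖ ^ 2 + 3 * ‖z‖ ^ 2 := by
  have h := pow_le_pow_left₀ (norm_nonneg _) (norm_add₃_le (a := x) (b := y) (c := z)) 2
  nlinarith [sq_nonneg (‖x‖ - ‖y‖), sq_nonneg (‖x‖ - ‖z‖), sq_nonneg (‖y‖ - ‖z‖)]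

/-! ### Mean square errors over one round. -/

namespace PreState

variable {N d : ℕ} {Z : Type*} {P : Problem N d Z} {K : ℕ}

/-- The mean square error of the inner estimators of client `i` before iteration `k`. -/
def meanSq (x : PreState P K) (θ : Rates) (i : Fin N) (k : ℕ) : ℝ :=
  𝔼 ν : P.RoundSample K, 𝔼 z, x.innerErr θ ν i k z ^ 2

/-- The mean square error of the inner estimators over the clients and the iterations. -/
def roundSq (x : PreState P K) (θ : Rates) : ℝ := 𝔼 i, 𝔼 k : Fin K, x.meanSq θ i k

/-- The mean square error of the recorded inner estimators. -/
def lag (x : PreState P K) : ℝ := 𝔼 p, 𝔼 z, (x.ul p z - P.innerRisk x.w z) ^ 2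

/-- The mean square error of the inner estimators, weighted by the time scale on which the
estimators of each client are refreshed. -/
def innerPotential (x : PreState P K) (θ : Rates) : ℝ :=
  𝔼 i, ((P.S1 i).card / (θ.γ * K)) * 𝔼 z, (x.u i z - P.innerRisk x.w z) ^ 2

/-- The expected square of the displacement of the model. -/
def moveSq (x : PreState P K) (θ : Rates) : ℝ :=
  𝔼 ν : P.RoundSample K, ‖(x.next θ ν).w - x.w‖ ^ 2

theorem meanSq_nonneg (x : PreState P K) (θ : Rates) (i : Fin N) (k : ℕ) : 0 ≤ x.meanSq θ i k :=
  Finset.expect_nonneg fun _ _ => Finset.expect_nonneg fun _ _ => sq_nonneg _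

variable {x : PreState P K} {θ : Rates} {B c q l L a b : ℝ} (hP : P.Bounds B c q l L a b) {M : ℕ}
  (hθ : θ.Admissible K M L) (hx : x.Bounded B c) (hf : x.Fresh B (4 * c * θ.η * K))
include hP hθ

omit hP hθ in
theorem card_pos (i : Fin N) : (0 : ℝ) < (P.S1 i).card := by
  exact_mod_cast (P.nonempty1 i).card_pos

theorem trackingError_nonneg : 0 ≤ trackingError θ K B c l := by
  obtain ⟨hB, hc, -, hl, -⟩ := hP.nonneg
  have := hθ.γ_pos
  have := hθ.η_pos
  rw [trackingError]
  positivity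

omit hP in
theorem ratio_le_one (i : Fin N) : θ.γ / (P.S1 i).card ≤ 1 := by
  rw [div_le_one (card_pos i)]
  refine hθ.γ_le.trans ?_
  exact_mod_cast (P.nonempty1 i).card_pos

include hx hf

theorem meanSq_succ_le (i : Fin N) : ∀ k < K, x.meanSq θ i (k + 1) ≤ x.meanSq θ i k +
    θ.γ / (P.S1 i).card * (trackingError θ K B c l - x.meanSq θ i k) := by
  intro k hk
  have e : ∀ k, x.meanSq θ i k = 𝔼 z, 𝔼 ν : P.RoundSample K, x.innerErr θ ν i k z ^ 2 :=
    fun k => Finset.expect_comm _ _ _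
  have h := expect_mono fun z : P.S1 i => expect_sq_innerErr_succ_le hP hθ hx hf z ⟨k, hk⟩
  rw [Finset.expect_add_distrib, ← Finset.mul_expect, Finset.expect_sub_distrib,
    Fintype.expect_const] at h
  rw [e, e]
  exact h

/-- Summing the contraction over a round bounds the mean error by `m / (γ * K)` times the drop of
the squared error, which dictates the weights in `innerPotential`. Re-centring at the new model
costs the displacement term and half of the mean error. -/
theorem roundSq_le (hM : ∀ i, (P.S1 i).card ≤ M) : x.roundSq θ / 2 ≤
    x.innerPotential θ - 𝔼 ν : P.RoundSample K, (x.next θ ν).innerPotential θ +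
      3 / 2 * trackingError θ K B c l + 3 * (M / (θ.γ * K)) ^ 2 * l ^ 2 * x.moveSq θ := by
  have : Nonempty (Fin N) := ⟨⟨0, hP.pos⟩⟩
  have := P.nonempty_roundSample (K := K) hP.pos
  have hg := hθ.γ_pos
  have hK : (0 : ℝ) < K := by exact_mod_cast hθ.K_pos
  have hT := trackingError_nonneg hP hθ
  have hMpos : (0 : ℝ) < M := lt_of_lt_of_le (by positivity) hθ.γK_le
  set T := trackingError θ K B c l
  set S := x.moveSq θ
  have hS : 0 ≤ S := Finset.expect_nonneg fun _ _ => sq_nonneg _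
  have key : ∀ i, 𝔼 k : Fin K, x.meanSq θ i k / 2 ≤
      ((P.S1 i).card / (θ.γ * K)) * 𝔼 z, (x.u i z - P.innerRisk x.w z) ^ 2 -
      ((P.S1 i).card / (θ.γ * K)) * 𝔼 ν : P.RoundSample K, 𝔼 z,
        ((x.next θ ν).u i z - P.innerRisk (x.next θ ν).w z) ^ 2 +
      3 / 2 * T + 3 * (M / (θ.γ * K)) ^ 2 * l ^ 2 * S := by
    intro i
    have hm := card_pos (P := P) i
    have hmM : ((P.S1 i).card : ℝ) ≤ M := by exact_mod_cast hM i
    set m : ℝ := ((P.S1 i).card : ℝ) with hmdef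
    have hV := meanSq_succ_le hP hθ hx hf i
    have h1 := expect_le_of_contraction hθ.K_pos (div_pos hg hm) hV
    have h2 := last_le_of_contraction hθ.K_pos (div_pos hg hm) hV (ratio_le_one hθ i)
      (x.meanSq_nonneg θ i) hT
    have h0 : x.meanSq θ i 0 = 𝔼 z, (x.u i z - P.innerRisk x.w z) ^ 2 := by
      simp only [meanSq, innerErr, loc_zero, Fintype.expect_const]
    -- The Young parameter is chosen so that the weight `m / (γ * K)` times `α` is at most `1 / 2`;
    -- the extra final error is then absorbed through `last_le_of_contraction`.
    set α : ℝ := θ.γ * K / (2 * M) with hα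
    have hα0 : 0 < α := by positivity
    have h3 : 𝔼 ν : P.RoundSample K, 𝔼 z,
        ((x.next θ ν).u i z - P.innerRisk (x.next θ ν).w z) ^ 2 ≤
        (1 + α) * x.meanSq θ i K + (1 + 1 / α) * (l ^ 2 * S) := by
      have : ∀ (ν : P.RoundSample K) (z : P.S1 i),
          ((x.next θ ν).u i z - P.innerRisk (x.next θ ν).w z) ^ 2 ≤
          (1 + α) * x.innerErr θ ν i K z ^ 2 +
            (1 + 1 / α) * (l ^ 2 * ‖(x.next θ ν).w - x.w‖ ^ 2) := by
        intro ν z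
        have e : (x.next θ ν).u i z - P.innerRisk (x.next θ ν).w z = x.innerErr θ ν i K z +
            (P.innerRisk x.w z - P.innerRisk (x.next θ ν).w z) := by
          rw [innerErr]
          change (x.loc θ ν i K).u z - _ = _
          ring
        rw [e]
        refine (sq_add_le_young hα0).trans ?_
        have hd := hP.inner_sub z.2 x.w (x.next θ ν).w
        rw [abs_sub_comm] at hd
        have hd2 := sq_le_sq' (abs_le.1 hd).1 (abs_le.1 hd).2
        rw [mul_pow] at hd2
        gcongr
      refine (expect_mono fun ν => expect_mono (this ν)).trans (le_of_eq ?_)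
      simp only [Finset.expect_add_distrib, ← Finset.mul_expect, Fintype.expect_const]
      rfl
    rw [← h0]
    have h4 := mul_le_mul_of_nonneg_left h3 (show 0 ≤ m / (θ.γ * K) by positivity)
    have h5 : (x.meanSq θ i 0 - x.meanSq θ i K) / (θ.γ / m * K) =
        m / (θ.γ * K) * x.meanSq θ i 0 - m / (θ.γ * K) * x.meanSq θ i K := by
      field_simp
    have h6 : m / (θ.γ * K) * α ≤ 1 / 2 := by
      rw [hα, div_mul_div_comm, div_le_iff₀ (by positivity)]
      nlinarith [mul_pos hg hK]
    have h7 : m / (θ.γ * K) * (1 + 1 / α) ≤ 3 * (M / (θ.γ * K)) ^ 2 := by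
      have hr : 1 ≤ M / (θ.γ * K) := (one_le_div (by positivity)).2 hθ.γK_le
      have e1 : 1 / α = 2 * (M / (θ.γ * K)) := by
        rw [hα]
        field_simp
      have e2 : m / (θ.γ * K) ≤ M / (θ.γ * K) := by gcongr
      rw [e1]
      calc m / (θ.γ * K) * (1 + 2 * (M / (θ.γ * K)))
          ≤ M / (θ.γ * K) * (M / (θ.γ * K) + 2 * (M / (θ.γ * K))) := by gcongr
        _ = _ := by ring
    have h8 := mul_le_mul_of_nonneg_right h6 (x.meanSq_nonneg θ i K)
    have h9 := mul_le_mul_of_nonneg_right h7 (show 0 ≤ l ^ 2 * S by positivity)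
    have h10 : 𝔼 k : Fin K, x.meanSq θ i k / 2 = (𝔼 k : Fin K, x.meanSq θ i k) / 2 :=
      (Finset.expect_div _ _ _).symm
    rw [h10]
    rw [h5] at h1
    nlinarith
  have h := expect_mono key
  simp only [Finset.expect_add_distrib, Finset.expect_sub_distrib, Fintype.expect_const,
    ← Finset.expect_div] at h
  have e : 𝔼 ν : P.RoundSample K, (x.next θ ν).innerPotential θ =
      𝔼 i, ((P.S1 i).card / (θ.γ * K)) * 𝔼 ν : P.RoundSample K, 𝔼 z,
        ((x.next θ ν).u i z - P.innerRisk (x.next θ ν).w z) ^ 2 := by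
    simp only [innerPotential]
    rw [Finset.expect_comm]
    simp only [Finset.mul_expect]
  rw [e]
  exact h

/-- Recorded inner estimators enter gradient estimates one round late, so their error is carried as
a separate quantity. They are read after the update, whence the shift to `k + 1`. -/
theorem expect_lag_next_le : 𝔼 ν : P.RoundSample K, (x.next θ ν).lag ≤
    2 * x.roundSq θ + 2 * trackingError θ K B c l + 2 * l ^ 2 * (4 * c * θ.η * K) ^ 2 := by
  have : Nonempty (Fin N) := ⟨⟨0, hP.pos⟩⟩
  have : Nonempty (Fin K) := ⟨⟨0, hθ.K_pos⟩⟩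
  have := P.nonempty_roundSample (K := K) hP.pos
  have hT := trackingError_nonneg hP hθ
  obtain ⟨hB, hc, -, hl, -⟩ := hP.nonneg
  have hη := hθ.η_pos
  have h : ∀ (ν : P.RoundSample K) (p : Fin N × Fin K) (z : P.S1 p.1),
      ((x.next θ ν).ul p z - P.innerRisk (x.next θ ν).w z) ^ 2 ≤
        2 * x.innerErr θ ν p.1 (p.2 + 1) z ^ 2 + 2 * l ^ 2 * (4 * c * θ.η * K) ^ 2 := by
    intro ν p z
    have hd := hP.inner_sub z.2 x.w (x.next θ ν).w
    rw [abs_sub_comm] at hd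
    have hw := norm_next_w_sub_le ν hP hx hθ.β_pos.le hθ.β_le hθ.η_pos.le
    have hd' : |P.innerRisk x.w z - P.innerRisk (x.next θ ν).w z| ≤ l * (4 * c * θ.η * K) := by
      refine hd.trans (mul_le_mul_of_nonneg_left (hw.trans ?_) hl)
      gcongr
      norm_num
    have hd2 := sq_le_sq' (abs_le.1 hd').1 (abs_le.1 hd').2
    have e : (x.next θ ν).ul p z - P.innerRisk (x.next θ ν).w z = x.innerErr θ ν p.1 (p.2 + 1) z +
        (P.innerRisk x.w z - P.innerRisk (x.next θ ν).w z) := by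
      rw [innerErr]
      change (x.loc θ ν p.1 (p.2 + 1)).u z - _ = _
      ring
    rw [e]
    nlinarith [sq_nonneg (x.innerErr θ ν p.1 (p.2 + 1) z -
      (P.innerRisk x.w z - P.innerRisk (x.next θ ν).w z))]
  have h1 : 𝔼 ν : P.RoundSample K, (x.next θ ν).lag ≤ 2 * (𝔼 i, 𝔼 k : Fin K, x.meanSq θ i (k + 1)) +
      2 * l ^ 2 * (4 * c * θ.η * K) ^ 2 := by
    refine (expect_mono fun ν => expect_mono fun p => expect_mono (h ν p)).trans (le_of_eq ?_)
    simp only [Finset.expect_add_distrib, ← Finset.mul_expect, Fintype.expect_const]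
    rw [Finset.expect_comm, expect_prod]
    rfl
  have h2 : 𝔼 i, 𝔼 k : Fin K, x.meanSq θ i (k + 1) ≤ x.roundSq θ + trackingError θ K B c l := by
    rw [roundSq, ← Fintype.expect_const (ι := Fin N) (trackingError θ K B c l),
      ← Finset.expect_add_distrib]
    exact expect_mono fun i => expect_succ_le_of_contraction hθ.K_pos
      (div_pos hθ.γ_pos (card_pos i)) (meanSq_succ_le hP hθ hx hf i) (ratio_le_one hθ i)
      (x.meanSq_nonneg θ i) hT
  linarith

omit hx hf hP hθ in
/-- The error of the gradient estimate at iteration `k` of client `i` that does not come from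
sampling. -/
def gradErr (x : PreState P K) (θ : Rates) (ν : P.RoundSample K) (i : Fin N) (k : Fin K) : Vec d :=
  x.est1 θ ν i k - P.frozen1 x.w ν i k + (x.est2 θ ν i k - P.frozen2 x.w ν i k)

omit hx hf hP hθ in
/-- The mean square of `gradErr`. -/
def gradSq (x : PreState P K) (θ : Rates) : ℝ :=
  𝔼 i, 𝔼 k : Fin K, 𝔼 ν : P.RoundSample K, ‖x.gradErr θ ν i k‖ ^ 2

theorem sq_norm_gradErr_le (ν : P.RoundSample K) (i : Fin N) (k : Fin K) :
    ‖x.gradErr θ ν i k‖ ^ 2 ≤ 3 * a ^ 2 * (x.innerErr θ ν i k (train ν i k).1 ^ 2 +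
      4 * θ.γ * B ^ 2 + (x.ul (shuffle1 ν i k) (sent ν (shuffle1 ν i k).1 (shuffle1 ν i k).2).1 -
        P.innerRisk x.w (sent ν (shuffle1 ν i k).1 (shuffle1 ν i k).2).1) ^ 2) +
      12 * b ^ 2 * (4 * c * θ.η * K) ^ 2 := by
  obtain ⟨hB, hc, -, hl, -, ha, hb⟩ := hP.nonneg
  have hη := hθ.η_pos
  have hg := hθ.γ_pos
  have hw : ‖(x.loc θ ν i k).w - x.w‖ ≤ 4 * c * θ.η * K := by
    refine (norm_loc_w_sub_le' ν i hP hx hθ.β_pos.le hθ.β_le hθ.η_pos.le k.2.le).trans ?_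
    gcongr
    norm_num
  have h1 : ‖x.est1 θ ν i k - P.frozen1 x.w ν i k‖ ≤
      a * |x.innerErr θ ν i (k + 1) (train ν i k).1| + b * (4 * c * θ.η * K) :=
    hP.term1_sub (train ν i k).1.2 (sent ν _ _).2.2 hw (hf.1 _) _
  have h2 : ‖x.est2 θ ν i k - P.frozen2 x.w ν i k‖ ≤
      a * |x.ul (shuffle1 ν i k) (sent ν (shuffle1 ν i k).1 (shuffle1 ν i k).2).1 -
        P.innerRisk x.w (sent ν (shuffle1 ν i k).1 (shuffle1 ν i k).2).1| +
        b * (4 * c * θ.η * K) :=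
    hP.term2_sub (sent ν _ _).1.2 (train ν i k).2.2 (hf.1 _) hw _
  -- The estimator is used after its update, when it depends on the sample. Convexity of the square
  -- goes back to the error before the update, which is independent of the sample and averages to
  -- `meanSq`.
  have h3 : x.innerErr θ ν i (k + 1) (train ν i k).1 ^ 2 ≤
      x.innerErr θ ν i k (train ν i k).1 ^ 2 + 4 * θ.γ * B ^ 2 := by
    obtain ⟨r, -, ht, he⟩ := innerErr_succ hP hθ hx hf ν (train ν i k).1 k
    have hh : hit (train ν) (train ν i k).1 k = 1 := by
      rw [hit, extendZero_val, if_pos rfl]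
    rw [he, hh, mul_one]
    generalize lossNoise P x.w (train ν i k).1 (sent ν) (shuffle2 ν i) k + r = t at ht
    generalize x.innerErr θ ν i k (train ν i k).1 = e
    have ht2 := sq_le_sq' (abs_le.1 ht).1 (abs_le.1 ht).2
    nlinarith [mul_nonneg (mul_nonneg hg.le (sub_nonneg.2 hθ.γ_le)) (sq_nonneg (e - t)),
      mul_nonneg hg.le (sq_nonneg e), mul_le_mul_of_nonneg_left ht2 hg.le]
  set e1 := x.innerErr θ ν i (k + 1) (train ν i k).1
  set e2 := x.ul (shuffle1 ν i k) (sent ν (shuffle1 ν i k).1 (shuffle1 ν i k).2).1 -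
        P.innerRisk x.w (sent ν (shuffle1 ν i k).1 (shuffle1 ν i k).2).1
  set D := 4 * c * θ.η * K
  have hD : 0 ≤ D := by positivity
  have h4 : ‖x.gradErr θ ν i k‖ ≤ a * |e1| + a * |e2| + 2 * (b * D) := by
    refine (norm_add_le _ _).trans ((add_le_add h1 h2).trans (le_of_eq ?_))
    ring
  have h5 := pow_le_pow_left₀ (norm_nonneg _) h4 2
  have h6 : (a * |e1| + a * |e2| + 2 * (b * D)) ^ 2 ≤
      3 * (a ^ 2 * e1 ^ 2) + 3 * (a ^ 2 * e2 ^ 2) + 12 * (b ^ 2 * D ^ 2) := by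
    rw [← sq_abs e1, ← sq_abs e2]
    nlinarith [sq_nonneg (a * |e1| - a * |e2|), sq_nonneg (a * |e1| - 2 * (b * D)),
      sq_nonneg (a * |e2| - 2 * (b * D))]
  nlinarith [mul_le_mul_of_nonneg_left h3 (sq_nonneg a)]

theorem gradSq_le : x.gradSq θ ≤ 3 * a ^ 2 * (x.roundSq θ + 4 * θ.γ * B ^ 2 + x.lag) +
      12 * b ^ 2 * (4 * c * θ.η * K) ^ 2 := by
  have : Nonempty (Fin N) := ⟨⟨0, hP.pos⟩⟩
  have : Nonempty (Fin K) := ⟨⟨0, hθ.K_pos⟩⟩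
  have := P.nonempty_roundSample (K := K) hP.pos
  have h := expect_mono fun i : Fin N => expect_mono fun k : Fin K => expect_mono
    fun ν : P.RoundSample K => sq_norm_gradErr_le hP hθ hx hf ν i k
  refine h.trans (le_of_eq ?_)
  simp only [Finset.expect_add_distrib, ← Finset.mul_expect, Fintype.expect_const]
  have e1 : ∀ (i : Fin N) (k : Fin K), 𝔼 ν : P.RoundSample K,
      x.innerErr θ ν i k (train ν i k).1 ^ 2 = x.meanSq θ i k := fun i k =>
    expect_train i k (fun ν z => x.innerErr θ ν i k z ^ 2)
      (fun ν s z => by rw [innerErr_updateEntry])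
  have e2 : ∀ (i : Fin N) (k : Fin K), 𝔼 ν : P.RoundSample K,
      (x.ul (shuffle1 ν i k) (sent ν (shuffle1 ν i k).1 (shuffle1 ν i k).2).1 -
        P.innerRisk x.w (sent ν (shuffle1 ν i k).1 (shuffle1 ν i k).2).1) ^ 2 = x.lag :=
    fun i k => by
    have : Nonempty (∀ i : Fin N, Fin K → P.S1 i × P.S2 i) := ⟨this.some.1⟩
    refine (P.expect_round1 (K := K) hP.pos i (fun τ y ξ =>
      (x.ul (ξ k) (y (ξ k).1 (ξ k).2).1 - P.innerRisk x.w (y (ξ k).1 (ξ k).2).1) ^ 2)).trans ?_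
    rw [Fintype.expect_const]
    refine (expect_record (X := fun i => P.S1 i × P.S2 i) k
      (fun p s => (x.ul p s.1 - P.innerRisk x.w s.1) ^ 2)).trans ?_
    refine Finset.expect_congr rfl fun p _ => ?_
    rw [expect_prod]
    simp only [Fintype.expect_const]
  simp only [e1, e2, Fintype.expect_const]
  rfl

end PreState

/-- Bernoulli's inequality for `(1 + β) ^ K` gives `(1 - β) ^ K * (1 + K * β) ≤ 1`, and `1 / (1 + x)
≤ 1 - x / 2` on the unit interval. -/
theorem one_sub_pow_le {β : ℝ} {K : ℕ} (hβ : 0 ≤ β) (hβ1 : β ≤ 1) (hK : β * K ≤ 1) :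
    (1 - β) ^ K ≤ 1 - β * K / 2 := by
  have h1 := one_add_mul_le_pow (a := β) (by linarith) K
  have h2 : (1 - β) ^ K * (1 + β) ^ K ≤ 1 := by
    rw [← mul_pow]
    exact pow_le_one₀ (by nlinarith) (by nlinarith)
  have h3 : 0 ≤ (1 - β) ^ K := pow_nonneg (by linarith) K
  have h0 : 0 ≤ β * K := by positivity
  have h4 : (1 - β) ^ K * (1 + K * β) ≤ 1 := (mul_le_mul_of_nonneg_left h1 h3).trans h2
  nlinarith

/-! ### The gradient estimator, the descent of the risk, and the potential. -/

namespace PreState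

variable {N d : ℕ} {Z : Type*} {P : Problem N d Z} {K : ℕ}

/-- The average over the clients of the gradient estimators before iteration `k`. -/
def avgG (x : PreState P K) (θ : Rates) (ν : P.RoundSample K) (k : ℕ) : Vec d :=
  𝔼 i, (x.loc θ ν i k).G

/-- The average of the gradient estimators over the clients and the iterations of a round. -/
def meanG (x : PreState P K) (θ : Rates) (ν : P.RoundSample K) : Vec d :=
  𝔼 k : Fin K, x.avgG θ ν (k + 1)

/-- The error of the gradient estimator. -/
def gap (x : PreState P K) : Vec d := x.G - gradient P.risk x.w

/-- The contribution of the sampling noise to the averaged gradient estimator. -/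
def noiseAvg (x : PreState P K) (θ : Rates) (ν : P.RoundSample K) (k : ℕ) : Vec d :=
  𝔼 i, (movingAverage θ.β (P.noise1 x.w ν i) k + movingAverage θ.β (P.noise2 x.w ν i) k)

/-- The contribution of `gradErr` to the averaged gradient estimator. -/
def errAvg (x : PreState P K) (θ : Rates) (ν : P.RoundSample K) (k : ℕ) : Vec d :=
  𝔼 i, movingAverage θ.β (extendZero (x.gradErr θ ν i)) k

variable (x : PreState P K) (θ : Rates) (ν : P.RoundSample K)

/-- The recursion is linear, so the inputs can be split into constant mean, sampling noise and
remaining error, each of which is estimated in its own way. -/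
theorem loc_G_eq (i : Fin N) : ∀ k ≤ K, (x.loc θ ν i k).G = (1 - θ.β) ^ k • x.G +
    movingAverage θ.β (fun j => (P.mean1 x.w i + P.mean2 x.w i) +
      ((P.noise1 x.w ν i j + P.noise2 x.w ν i j) + extendZero (x.gradErr θ ν i) j)) k := by
  intro k
  induction k with
  | zero => intro _; simp [loc_zero, movingAverage]
  | succ k ih =>
    intro hk
    have h := x.loc_succ_G θ ν i ⟨k, hk⟩
    simp only at h
    have e : P.mean1 x.w i + P.mean2 x.w i + ((P.noise1 x.w ν i k + P.noise2 x.w ν i k) +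
        extendZero (x.gradErr θ ν i) k) = x.est1 θ ν i ⟨k, hk⟩ + x.est2 θ ν i ⟨k, hk⟩ := by
      have hk' : k < K := hk
      simp only [Problem.noise1, Problem.noise2, extendZero, hk', dif_pos, gradErr]
      abel
    rw [h, ih (by omega), movingAverage, e, pow_succ]
    module

theorem loc_w_eq (i : Fin N) : ∀ k ≤ K, (x.loc θ ν i k).w =
    x.w - θ.η • ∑ j ∈ Finset.range k, (x.loc θ ν i (j + 1)).G := by
  intro k
  induction k with
  | zero => intro _; simp [loc_zero]
  | succ k ih =>
    intro hk
    have h := x.loc_succ_w θ ν i ⟨k, hk⟩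
    simp only at h
    rw [h, ih (by omega), Finset.sum_range_succ]
    module

variable {x θ} {B c q l L a b : ℝ} (hP : P.Bounds B c q l L a b)
include hP

theorem avgG_sub_eq {k : ℕ} (hk : k ≤ K) : x.avgG θ ν k - gradient P.risk x.w =
    (1 - θ.β) ^ k • x.gap + x.noiseAvg θ ν k + x.errAvg θ ν k := by
  have : Nonempty (Fin N) := ⟨⟨0, hP.pos⟩⟩
  have e : x.avgG θ ν k = 𝔼 i, ((1 - θ.β) ^ k • x.G +
      ((1 - (1 - θ.β) ^ k) • (P.mean1 x.w i + P.mean2 x.w i) +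
        ((movingAverage θ.β (P.noise1 x.w ν i) k + movingAverage θ.β (P.noise2 x.w ν i) k) +
          movingAverage θ.β (extendZero (x.gradErr θ ν i)) k))) := by
    refine Finset.expect_congr rfl fun i _ => ?_
    rw [loc_G_eq x θ ν i k hk, movingAverage_add, movingAverage_const, movingAverage_add,
      movingAverage_add]
  rw [e, Finset.expect_add_distrib, Finset.expect_add_distrib, Finset.expect_add_distrib,
    Fintype.expect_const, ← smul_expect_real, ← hP.grad_eq_mean x.w, gap, noiseAvg, errAvg]
  module

theorem next_w_sub_eq (hK : 0 < K) : (x.next θ ν).w - x.w = -((θ.η * K) • x.meanG θ ν) := by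
  have : Nonempty (Fin N) := ⟨⟨0, hP.pos⟩⟩
  have hK' : (K : ℝ) ≠ 0 := by positivity
  have e1 : (x.next θ ν).w = 𝔼 i, (x.w - θ.η • ∑ j ∈ Finset.range K, (x.loc θ ν i (j + 1)).G) :=
    Finset.expect_congr rfl fun i _ => loc_w_eq x θ ν i K le_rfl
  have e2 : x.meanG θ ν = (K : ℝ)⁻¹ • 𝔼 i, ∑ j ∈ Finset.range K, (x.loc θ ν i (j + 1)).G := by
    rw [Finset.expect_sum_comm, meanG, expect_eq_smul_sum, Finset.card_fin, Finset.sum_range]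
    rfl
  rw [e1, e2, Finset.expect_sub_distrib, Fintype.expect_const, ← smul_expect_real, smul_smul,
    mul_assoc, mul_inv_cancel₀ hK', mul_one]
  abel

variable {M : ℕ} (hθ : θ.Admissible K M L)
include hθ

theorem expect_sq_noiseAvg_le (x : PreState P K) {k : ℕ} (hk : k ≤ K) :
    𝔼 ν : P.RoundSample K, ‖x.noiseAvg θ ν k‖ ^ 2 ≤ 16 * K * (θ.β * c) ^ 2 := by
  refine (hP.expect_sq_noise_le x.w hθ.β_pos.le hθ.β_le k).trans ?_
  gcongr

omit hP in
theorem expect_sq_errAvg_le (x : PreState P K) {k : ℕ} (hk : k ≤ K) :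
    𝔼 ν : P.RoundSample K, ‖x.errAvg θ ν k‖ ^ 2 ≤ (θ.β * K) ^ 2 * x.gradSq θ := by
  have h : ∀ ν : P.RoundSample K, ‖x.errAvg θ ν k‖ ^ 2 ≤
      𝔼 i, (θ.β * K) ^ 2 * 𝔼 k : Fin K, ‖x.gradErr θ ν i k‖ ^ 2 := fun ν =>
    (norm_sq_expect_le _ _).trans (expect_mono fun i =>
      sq_norm_movingAverage_le hθ.β_pos.le hθ.β_le (x.gradErr θ ν i) hk)
  refine (expect_mono h).trans (le_of_eq ?_)
  rw [Finset.expect_comm, gradSq]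
  simp only [← Finset.mul_expect]
  congr 1
  exact Finset.expect_congr rfl fun i _ => Finset.expect_comm _ _ _

omit hθ in
theorem moveSq_eq (x : PreState P K) (hK : 0 < K) :
    x.moveSq θ = (θ.η * K) ^ 2 * 𝔼 ν : P.RoundSample K, ‖x.meanG θ ν‖ ^ 2 := by
  rw [moveSq, Finset.mul_expect]
  refine Finset.expect_congr rfl fun ν _ => ?_
  rw [next_w_sub_eq ν hP hK, norm_neg, norm_smul, mul_pow, Real.norm_eq_abs, sq_abs]

theorem expect_sq_meanG_sub_le (x : PreState P K) :
    𝔼 ν : P.RoundSample K, ‖x.meanG θ ν - gradient P.risk x.w‖ ^ 2 ≤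
      3 * ‖x.gap‖ ^ 2 + 48 * θ.β * c ^ 2 + 3 * x.gradSq θ := by
  have : Nonempty (Fin N) := ⟨⟨0, hP.pos⟩⟩
  have : Nonempty (Fin K) := ⟨⟨0, hθ.K_pos⟩⟩
  have := P.nonempty_roundSample (K := K) hP.pos
  have hb := hθ.β_pos
  have hb1 := hθ.β_le
  have hbK := hθ.βK_le
  have hK : (0 : ℝ) < K := by exact_mod_cast hθ.K_pos
  have hG : 0 ≤ x.gradSq θ := Finset.expect_nonneg fun _ _ => Finset.expect_nonneg fun _ _ =>
    Finset.expect_nonneg fun _ _ => sq_nonneg _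
  have h : ∀ ν : P.RoundSample K, ‖x.meanG θ ν - gradient P.risk x.w‖ ^ 2 ≤
      𝔼 k : Fin K, (3 * ‖x.gap‖ ^ 2 + 3 * ‖x.noiseAvg θ ν (k + 1)‖ ^ 2 +
        3 * ‖x.errAvg θ ν (k + 1)‖ ^ 2) := by
    intro ν
    have e : x.meanG θ ν - gradient P.risk x.w =
        𝔼 k : Fin K, (x.avgG θ ν (k + 1) - gradient P.risk x.w) := by
      rw [Finset.expect_sub_distrib, Fintype.expect_const, meanG]
    rw [e]
    refine (norm_sq_expect_le _ _).trans (expect_mono fun k => ?_)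
    rw [avgG_sub_eq ν hP k.2]
    refine (sq_norm_add_three_le _ _ _).trans ?_
    have h1 : ‖(1 - θ.β) ^ ((k : ℕ) + 1) • x.gap‖ ≤ ‖x.gap‖ := by
      rw [norm_smul, Real.norm_eq_abs, abs_of_nonneg (pow_nonneg (by linarith) _)]
      exact mul_le_of_le_one_left (norm_nonneg _) (pow_le_one₀ (by linarith) (by linarith))
    gcongr
  refine (expect_mono h).trans ?_
  rw [Finset.expect_comm]
  refine Finset.expect_le Finset.univ_nonempty fun k _ => ?_
  simp only [Finset.expect_add_distrib, ← Finset.mul_expect, Fintype.expect_const]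
  have h1 := expect_sq_noiseAvg_le hP hθ x (k := k + 1) k.2
  have h2 := expect_sq_errAvg_le hθ x (k := k + 1) k.2
  have h3 : 16 * K * (θ.β * c) ^ 2 ≤ 16 * θ.β * c ^ 2 := by
    have := mul_le_mul_of_nonneg_right hbK (show 0 ≤ θ.β * c ^ 2 by positivity)
    nlinarith
  have h4 : (θ.β * K) ^ 2 * x.gradSq θ ≤ x.gradSq θ :=
    mul_le_of_le_one_left hG (pow_le_one₀ (by positivity) hbK)
  linarith

/-- Noise is kept with the decayed gap, with which it is uncorrelated, so it costs only its
variance. The bias and the change of the gradient have no such structure and pay the Young factor `3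
/ (β * K)`. -/
theorem expect_sq_gap_next_le (x : PreState P K) :
    𝔼 ν : P.RoundSample K, ‖(x.next θ ν).gap‖ ^ 2 ≤ (1 - θ.β * K / 2) * ‖x.gap‖ ^ 2 +
      24 * K * (θ.β * c) ^ 2 +
        6 / (θ.β * K) * ((θ.β * K) ^ 2 * x.gradSq θ + L ^ 2 * x.moveSq θ) := by
  have : Nonempty (Fin N) := ⟨⟨0, hP.pos⟩⟩
  have := P.nonempty_roundSample (K := K) hP.pos
  have hb := hθ.β_pos
  have hb1 := hθ.β_le
  have hbK := hθ.βK_le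
  have hK : (0 : ℝ) < K := by exact_mod_cast hθ.K_pos
  set s : ℝ := θ.β * K with hs
  have hs0 : 0 < s := by positivity
  set ρ : ℝ := (1 - θ.β) ^ K with hρ
  have hρ0 : 0 ≤ ρ := pow_nonneg (by linarith) K
  have hρ1 : ρ ≤ 1 - s / 2 := one_sub_pow_le hb.le hb1 hbK
  have h : ∀ ν : P.RoundSample K, ‖(x.next θ ν).gap‖ ^ 2 ≤
      (1 + s / 2) * (ρ ^ 2 * ‖x.gap‖ ^ 2 + 2 * ρ * inner ℝ x.gap (x.noiseAvg θ ν K) +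
        ‖x.noiseAvg θ ν K‖ ^ 2) +
      (1 + 1 / (s / 2)) * (2 * ‖x.errAvg θ ν K‖ ^ 2 +
        2 * (L ^ 2 * ‖(x.next θ ν).w - x.w‖ ^ 2)) := by
    intro ν
    have e : (x.next θ ν).gap = (ρ • x.gap + x.noiseAvg θ ν K) + (x.errAvg θ ν K +
        (gradient P.risk x.w - gradient P.risk (x.next θ ν).w)) := by
      have := avgG_sub_eq ν hP (x := x) (θ := θ) (le_refl K)
      have e' : (x.next θ ν).gap = (x.avgG θ ν K - gradient P.risk x.w) +
          (gradient P.risk x.w - gradient P.risk (x.next θ ν).w) := by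
        rw [gap, avgG, sub_add_sub_cancel]
        rfl
      rw [e', this]
      abel
    rw [e]
    refine (sq_norm_add_le_young _ _ (by positivity : 0 < s / 2)).trans ?_
    have h1 : ‖ρ • x.gap + x.noiseAvg θ ν K‖ ^ 2 = ρ ^ 2 * ‖x.gap‖ ^ 2 +
        2 * ρ * inner ℝ x.gap (x.noiseAvg θ ν K) + ‖x.noiseAvg θ ν K‖ ^ 2 := by
      rw [norm_add_sq_real, norm_smul, mul_pow, Real.norm_eq_abs, sq_abs, real_inner_smul_left]
      ring
    have h2 : ‖x.errAvg θ ν K + (gradient P.risk x.w - gradient P.risk (x.next θ ν).w)‖ ^ 2 ≤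
        2 * ‖x.errAvg θ ν K‖ ^ 2 + 2 * (L ^ 2 * ‖(x.next θ ν).w - x.w‖ ^ 2) := by
      have h3 := sq_norm_add_le_young (x.errAvg θ ν K)
        (gradient P.risk x.w - gradient P.risk (x.next θ ν).w) (one_pos : (0 : ℝ) < 1)
      have h4 := pow_le_pow_left₀ (norm_nonneg _) (hP.grad_sub x.w (x.next θ ν).w) 2
      rw [norm_sub_rev, mul_pow] at h4
      linarith
    rw [h1]
    gcongr
  refine (expect_mono h).trans ?_
  simp only [Finset.expect_add_distrib, ← Finset.mul_expect, Fintype.expect_const, ← inner_expect]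
  have hz : 𝔼 ν : P.RoundSample K, x.noiseAvg θ ν K = 0 := hP.expect_noise x.w θ.β K
  rw [hz, inner_zero_right, mul_zero, add_zero]
  have h1 := expect_sq_noiseAvg_le hP hθ x (le_refl K)
  have h2 := expect_sq_errAvg_le hθ x (le_refl K)
  change _ + _ * (_ + 2 * (L ^ 2 * x.moveSq θ)) ≤ _
  have hS : 0 ≤ x.moveSq θ := Finset.expect_nonneg fun _ _ => sq_nonneg _
  have hG : 0 ≤ x.gradSq θ := Finset.expect_nonneg fun _ _ => Finset.expect_nonneg fun _ _ =>
    Finset.expect_nonneg fun _ _ => sq_nonneg _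
  have h3 : (1 + s / 2) * ρ ^ 2 ≤ 1 - s / 2 := by
    have : ρ ^ 2 ≤ (1 - s / 2) ^ 2 := pow_le_pow_left₀ hρ0 hρ1 2
    nlinarith
  have h4 : 1 + 1 / (s / 2) ≤ 3 / s := by
    rw [one_div_div, ← sub_nonneg]
    have : 3 / s - (1 + 2 / s) = (1 - s) / s := by
      field_simp
      ring
    rw [this]
    exact div_nonneg (by linarith) hs0.le
  calc _ = (1 + s / 2) * ρ ^ 2 * ‖x.gap‖ ^ 2 +
        (1 + s / 2) * 𝔼 ν : P.RoundSample K, ‖x.noiseAvg θ ν K‖ ^ 2 +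
        (1 + 1 / (s / 2)) * (2 * 𝔼 ν : P.RoundSample K, ‖x.errAvg θ ν K‖ ^ 2 +
          2 * (L ^ 2 * x.moveSq θ)) := by ring
    _ ≤ (1 - s / 2) * ‖x.gap‖ ^ 2 + (3 / 2) * (16 * K * (θ.β * c) ^ 2) +
        3 / s * (2 * (s ^ 2 * x.gradSq θ) + 2 * (L ^ 2 * x.moveSq θ)) := by
          gcongr
          linarith
    _ = _ := by ring

/-- The displacement is `-(η * K)` times the mean direction, and polarization turns its inner
product with the gradient into squares. The second-order term uses up half of the negative square of
the direction; the other half is kept to pay for displacements in the other recursions. -/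
theorem expect_risk_next_le (x : PreState P K) :
    𝔼 ν : P.RoundSample K, P.risk (x.next θ ν).w ≤ P.risk x.w -
      θ.η * K / 2 * ‖gradient P.risk x.w‖ ^ 2 -
      θ.η * K / 4 * 𝔼 ν : P.RoundSample K, ‖x.meanG θ ν‖ ^ 2 +
      θ.η * K / 2 * (3 * ‖x.gap‖ ^ 2 + 48 * θ.β * c ^ 2 + 3 * x.gradSq θ) := by
  have : Nonempty (Fin N) := ⟨⟨0, hP.pos⟩⟩
  have := P.nonempty_roundSample (K := K) hP.pos
  have hη := hθ.η_pos
  have hK : (0 : ℝ) < K := by exact_mod_cast hθ.K_pos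
  have hL := hP.nonneg.2.2.2.2.1
  have hs0 : 0 < θ.η * K := by positivity
  have hsL := hθ.ηK_le
  have h : ∀ ν : P.RoundSample K, P.risk (x.next θ ν).w ≤ P.risk x.w -
      θ.η * K / 2 * ‖gradient P.risk x.w‖ ^ 2 - θ.η * K / 4 * ‖x.meanG θ ν‖ ^ 2 +
      θ.η * K / 2 * ‖x.meanG θ ν - gradient P.risk x.w‖ ^ 2 := by
    intro ν
    have h1 := le_add_inner_gradient hP.differentiable (fun y z => hP.grad_sub z y) hL x.w
      (x.next θ ν).w
    rw [next_w_sub_eq ν hP hθ.K_pos, norm_neg, inner_neg_right, real_inner_smul_right, norm_smul,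
      mul_pow, Real.norm_eq_abs, sq_abs] at h1
    have h2 := norm_sub_sq_real (x.meanG θ ν) (gradient P.risk x.w)
    rw [real_inner_comm] at h2
    have h3 := mul_le_mul_of_nonneg_right hsL
      (show 0 ≤ θ.η * K * ‖x.meanG θ ν‖ ^ 2 by positivity)
    rw [h2]
    linarith
  refine (expect_mono h).trans ?_
  simp only [Finset.expect_add_distrib, Finset.expect_sub_distrib, ← Finset.mul_expect,
    Fintype.expect_const]
  have := expect_sq_meanG_sub_le hP hθ x
  gcongr

omit hP hθ in
/-- The Lyapunov function of the algorithm. -/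
def potential (x : PreState P K) (θ : Rates) (a : ℝ) : ℝ :=
  P.risk x.w + 3 * θ.η / θ.β * ‖x.gap‖ ^ 2 +
    θ.η * K * (360 * a ^ 2 * x.innerPotential θ + 60 * a ^ 2 * x.lag)

omit hP hθ in
/-- The error of one round, per unit of step size. -/
def roundError (θ : Rates) (K : ℕ) (B c l a b : ℝ) : ℝ :=
  96 * θ.β * c ^ 2 + 240 * a ^ 2 * θ.γ * B ^ 2 +
    (240 * b ^ 2 + 120 * a ^ 2 * l ^ 2) * (4 * c * θ.η * K) ^ 2 +
    660 * a ^ 2 * trackingError θ K B c l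

/-- One round decreases the expected potential. -/
theorem expect_potential_next_le (hx : x.Bounded B c) (hf : x.Fresh B (4 * c * θ.η * K))
    (hM : ∀ i, (P.S1 i).card ≤ M) (h1 : 288 * L ^ 2 * (θ.η / θ.β) ^ 2 ≤ 1)
    (h2 : 17280 * a ^ 2 * l ^ 2 * (M * θ.η / θ.γ) ^ 2 ≤ 1) :
    𝔼 ν : P.RoundSample K, (x.next θ ν).potential θ a ≤ x.potential θ a -
      θ.η * K / 2 * ‖gradient P.risk x.w‖ ^ 2 + θ.η * K * roundError θ K B c l a b := by
  have hη := hθ.η_pos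
  have hb := hθ.β_pos
  have hg := hθ.γ_pos
  have hbK := hθ.βK_le
  have hK : (0 : ℝ) < K := by exact_mod_cast hθ.K_pos
  have hs0 : 0 < θ.η * K := by positivity
  have k1 := expect_risk_next_le hP hθ x
  have k2 := expect_sq_gap_next_le hP hθ x
  have k3 := roundSq_le hP hθ hx hf hM
  have k4 := expect_lag_next_le hP hθ hx hf
  have k5 := gradSq_le hP hθ hx hf
  rw [moveSq_eq hP x hθ.K_pos] at k2 k3
  simp only [potential, Finset.expect_add_distrib, ← Finset.mul_expect]
  have hs : 0 ≤ 𝔼 ν : P.RoundSample K, ‖x.meanG θ ν‖ ^ 2 :=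
    Finset.expect_nonneg fun _ _ => sq_nonneg _
  have hG : 0 ≤ x.gradSq θ := Finset.expect_nonneg fun _ _ => Finset.expect_nonneg fun _ _ =>
    Finset.expect_nonneg fun _ _ => sq_nonneg _
  rw [roundError]
  generalize 𝔼 ν : P.RoundSample K, ‖x.meanG θ ν‖ ^ 2 = s at *
  generalize 𝔼 ν : P.RoundSample K, P.risk (x.next θ ν).w = F' at *
  generalize 𝔼 ν : P.RoundSample K, ‖(x.next θ ν).gap‖ ^ 2 = Δ' at *
  generalize 𝔼 ν : P.RoundSample K, (x.next θ ν).innerPotential θ = Φ' at *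
  generalize 𝔼 ν : P.RoundSample K, (x.next θ ν).lag = Λ' at *
  generalize x.gradSq θ = E at *
  generalize x.roundSq θ = Λ at *
  generalize x.innerPotential θ = Φ at *
  generalize x.lag = Λ₀ at *
  generalize trackingError θ K B c l = T at *
  generalize ‖gradient P.risk x.w‖ ^ 2 = g at *
  generalize ‖x.gap‖ ^ 2 = Δ at *
  generalize P.risk x.w = F at *
  generalize 4 * c * θ.η * (K : ℝ) = D at *
  -- Per unit of `η * K`, the weight `3 * η / β` cancels the gap `3 / 2 * Δ`. The total coefficient
  -- of `E` is `18 + 3 / 2 ≤ 20`, which puts `60 * a ^ 2` on `Λ₀` and, through `Λ'`, `60 + 120 = 360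
  -- / 2` times `a ^ 2` on `Λ`. Each displacement term is at most `s / 16`, against the available `s
  -- / 4`.
  have m2 := mul_le_mul_of_nonneg_left k2 (show 0 ≤ 3 * θ.η / θ.β by positivity)
  have e2 : 3 * θ.η / θ.β * ((1 - θ.β * K / 2) * Δ + 24 * K * (θ.β * c) ^ 2 +
      6 / (θ.β * K) * ((θ.β * K) ^ 2 * E + L ^ 2 * ((θ.η * K) ^ 2 * s))) =
      3 * θ.η / θ.β * Δ + θ.η * K * (-(3 / 2) * Δ + 72 * θ.β * c ^ 2 + 18 * E +
        18 * L ^ 2 * (θ.η / θ.β) ^ 2 * s) := by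
    field_simp
    ring
  rw [e2] at m2
  have m3 := mul_le_mul_of_nonneg_left k3 (show 0 ≤ θ.η * K * (360 * a ^ 2) by positivity)
  have e3 : θ.η * K * (360 * a ^ 2) * (Φ - Φ' + 3 / 2 * T +
      3 * (M / (θ.γ * K)) ^ 2 * l ^ 2 * ((θ.η * K) ^ 2 * s)) =
      θ.η * K * (360 * a ^ 2 * Φ - 360 * a ^ 2 * Φ' + 540 * a ^ 2 * T +
        1080 * a ^ 2 * l ^ 2 * (M * θ.η / θ.γ) ^ 2 * s) := by
    field_simp
    ring
  rw [e3] at m3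
  have m4 := mul_le_mul_of_nonneg_left k4 (show 0 ≤ θ.η * K * (60 * a ^ 2) by positivity)
  have m5 := mul_le_mul_of_nonneg_left k5 (show 0 ≤ θ.η * K * 20 by positivity)
  have m6 := mul_le_mul_of_nonneg_right h1 (show 0 ≤ θ.η * K * s by positivity)
  have m7 := mul_le_mul_of_nonneg_right h2 (show 0 ≤ θ.η * K * s by positivity)
  have m8 : 0 ≤ θ.η * K * E := by positivity
  have m9 : 0 ≤ θ.η * K * s := by positivity
  linarith

end PreState

/-! ### Chaining the rounds. -/

section Run

variable {N d : ℕ} {Z : Type*} {P : Problem N d Z} {K : ℕ}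

/-- The randomness that leads from the state at the end of round `r`, before the communicated
samples are drawn, to that of round `r + 1`. -/
def freshSample (s : ℕ → P.RoundSample K) (r : ℕ) : P.RoundSample K :=
  ((s (r + 1)).1, (s r).2.1, (s (r + 1)).2.2)

/-- The state at the end of round `r`, before the communicated samples are drawn. -/
def preRun (P : Problem N d Z) (θ : Rates) (w₀ : Fin N → Vec d) (s : ℕ → P.RoundSample K) :
    ℕ → PreState P K
  | 0 => { w := 𝔼 i : Fin N, w₀ i, G := 0, u := 0, wl := fun p => w₀ p.1, ul := 0 }
  | r + 1 => (preRun P θ w₀ s r).next θ (freshSample s r)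

theorem localRun_freshSample (θ : Rates) (s : ℕ → P.RoundSample K) (r : ℕ) (g : Global P K)
    (i : Fin N) (k : ℕ) :
    localRun P θ (s (r + 1)) g i k = localRun P θ (freshSample s r) g i k := by
  induction k with
  | zero => rfl
  | succ k ih =>
    rw [localRun, localRun, ih]
    rfl

theorem run_eq_global (θ : Rates) (w₀ : Fin N → Vec d) (s : ℕ → P.RoundSample K) (r : ℕ) :
    run P θ w₀ s r = (preRun P θ w₀ s r).global (sent (s r)) := by
  induction r with
  | zero => rfl
  | succ r ih =>
    rw [run, ih, nextRound]
    simp only [localRun_freshSample]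
    rfl

/-- The strict inequality in the hypothesis on communicated samples is the point: those of round `r`
itself are still free. -/
theorem preRun_congr (θ : Rates) (w₀ : Fin N → Vec d) {s s' : ℕ → P.RoundSample K} (r : ℕ)
    (h1 : ∀ j < r, (s j).2.1 = (s' j).2.1)
    (h2 : ∀ j ≤ r, (s j).1 = (s' j).1 ∧ (s j).2.2 = (s' j).2.2) :
    preRun P θ w₀ s r = preRun P θ w₀ s' r := by
  induction r with
  | zero => rfl
  | succ r ih =>
    rw [preRun, preRun, ih (fun j hj => h1 j (by omega)) fun j hj => h2 j (by omega), freshSample,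
      freshSample, h1 r (by omega), (h2 (r + 1) le_rfl).1, (h2 (r + 1) le_rfl).2]

/-- The draws of a run as an infinite sequence. -/
def drawSeq {R : ℕ} (ω : P.RunSample R K) (r : ℕ) : P.RoundSample K := ω (Fin.ofNat (R + 1) r)

theorem ofNat_injOn {R r r' : ℕ} (hr : r ≤ R) (hr' : r' ≤ R)
    (h : Fin.ofNat (R + 1) r = Fin.ofNat (R + 1) r') : r = r' := by
  have := congrArg Fin.val h
  simpa [Fin.ofNat, Nat.mod_eq_of_lt (Nat.lt_succ_of_le hr),
    Nat.mod_eq_of_lt (Nat.lt_succ_of_le hr')] using this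

/-- Averaging the state after round `r + 1` over the randomness that is new in it. -/
theorem expect_preRun_succ (hN : 0 < N) (θ : Rates) (w₀ : Fin N → Vec d) {R r : ℕ} (hr : r < R)
    (Φ : PreState P K → ℝ) :
    𝔼 ω : P.RunSample R K, Φ (preRun P θ w₀ (drawSeq ω) (r + 1)) =
      𝔼 ω : P.RunSample R K, 𝔼 ν, Φ ((preRun P θ w₀ (drawSeq ω) r).next θ ν) := by
  have := P.nonempty_roundSample (K := K) hN
  set i := Fin.ofNat (R + 1) r with hi
  set j := Fin.ofNat (R + 1) (r + 1) with hj
  have hij : i ≠ j := fun h => by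
    have := ofNat_injOn hr.le hr h
    omega
  -- The new randomness straddles two rounds: the communicated samples of round `r`, and everything
  -- but these in round `r + 1`.
  let set' : P.RunSample R K → P.RoundSample K → P.RunSample R K := fun ω ν =>
    Function.update (Function.update ω i ((ω i).1, ν.2.1, (ω i).2.2)) j
      (ν.1, (ω j).2.1, ν.2.2)
  have set_i : ∀ ω ν, set' ω ν i = ((ω i).1, ν.2.1, (ω i).2.2) := fun ω ν => by
    simp [set', hij]
  have set_j : ∀ ω ν, set' ω ν j = (ν.1, (ω j).2.1, ν.2.2) := fun ω ν => by
    simp [set']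
  have set_k : ∀ ω ν k, k ≠ i → k ≠ j → set' ω ν k = ω k := fun ω ν k hki hkj => by
    simp [set', hki, hkj]
  have get_set : ∀ ω ν, freshSample (drawSeq (set' ω ν)) r = ν := fun ω ν => by
    simp only [freshSample, drawSeq, ← hi, ← hj, set_i, set_j]
  have set_set : ∀ ω ν, set' (set' ω ν) (freshSample (drawSeq ω) r) = ω := fun ω ν => by
    funext k
    by_cases hki : k = i
    · rw [hki, set_i, set_i]
      rfl
    · by_cases hkj : k = j
      · rw [hkj, set_j, set_j]
        rfl
      · rw [set_k _ _ _ hki hkj, set_k _ _ _ hki hkj]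
  rw [expect_resample (fun ω => freshSample (drawSeq ω) r) set' get_set set_set]
  refine Finset.expect_congr rfl fun ω _ => Finset.expect_congr rfl fun ν _ => ?_
  rw [preRun, get_set]
  congr 2
  refine preRun_congr θ w₀ r (fun k hk => ?_) fun k hk => ?_
  · have hki : Fin.ofNat (R + 1) k ≠ i := fun h => by
      have := ofNat_injOn (by omega) hr.le h
      omega
    have hkj : Fin.ofNat (R + 1) k ≠ j := fun h => by
      have := ofNat_injOn (by omega) hr h
      omega
    rw [drawSeq, drawSeq, set_k _ _ _ hki hkj]
  · have hkj : Fin.ofNat (R + 1) k ≠ j := fun h => by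
      have := ofNat_injOn (by omega) hr h
      omega
    by_cases hki : Fin.ofNat (R + 1) k = i
    · rw [drawSeq, drawSeq, hki, set_i]
      exact ⟨rfl, rfl⟩
    · rw [drawSeq, drawSeq, set_k _ _ _ hki hkj]
      exact ⟨rfl, rfl⟩

/-- The expected squared norm of the gradient at the end of round `r`. -/
def gradNormSq (P : Problem N d Z) (θ : Rates) (R K : ℕ) (w₀ : Fin N → Vec d) (r : ℕ) : ℝ :=
  𝔼 ω : P.RunSample R K, ‖gradient P.risk (preRun P θ w₀ (drawSeq ω) r).w‖ ^ 2

theorem expectedSqGrad_eq (θ : Rates) (R : ℕ) (w₀ : Fin N → Vec d) :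
    expectedSqGrad P θ R K w₀ =
      (1 / (R : ℝ)) * ∑ r ∈ Finset.Icc 1 R, gradNormSq P θ R K w₀ r := by
  simp only [expectedSqGrad, gradNormSq, ← Finset.mul_expect, Finset.expect_sum_comm]
  congr 1
  refine Finset.sum_congr rfl fun r _ => Finset.expect_congr rfl fun ω _ => ?_
  rw [run_eq_global]
  rfl

variable {θ : Rates} {B c q l L a b : ℝ} (hP : P.Bounds B c q l L a b) (w₀ : Fin N → Vec d)
include hP

theorem gradNormSq_le (R r : ℕ) : gradNormSq P θ R K w₀ r ≤ 4 * c ^ 2 := by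
  have := P.nonempty_roundSample (K := K) hP.pos
  refine Finset.expect_le Finset.univ_nonempty fun ω _ => ?_
  have := pow_le_pow_left₀ (norm_nonneg _)
    (hP.grad_le (preRun P θ w₀ (drawSeq ω) r).w) 2
  linarith

theorem expectedSqGrad_le_const {R : ℕ} (hR : 1 ≤ R) :
    expectedSqGrad P θ R K w₀ ≤ 4 * c ^ 2 := by
  have hR' : (0 : ℝ) < R := by exact_mod_cast hR
  rw [expectedSqGrad_eq, one_div, inv_mul_le_iff₀ hR']
  refine (Finset.sum_le_sum fun r _ => gradNormSq_le hP w₀ R r).trans ?_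
  simp

variable {M : ℕ} (hθ : θ.Admissible K M L)
include hθ

theorem preRun_bounded (s : ℕ → P.RoundSample K) (r : ℕ) : (preRun P θ w₀ s r).Bounded B c := by
  obtain ⟨hB, hc, -⟩ := hP.nonneg
  induction r with
  | zero =>
    refine ⟨?_, fun i z => ?_⟩
    · simp only [preRun, norm_zero]
      positivity
    · simpa [preRun] using hB
  | succ r ih =>
    exact PreState.Bounded.next _ hP ih hθ.β_pos.le hθ.β_le hθ.γ_pos.le hθ.γ_le

theorem preRun_fresh (s : ℕ → P.RoundSample K) (r : ℕ) :
    (preRun P θ w₀ s (r + 1)).Fresh B (4 * c * θ.η * K) :=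
  PreState.Bounded.fresh_next _ hP (preRun_bounded hP w₀ hθ s r) hθ.β_pos.le hθ.β_le
    hθ.γ_pos.le hθ.γ_le hθ.η_pos.le

-- Boundedness of the loss and of the estimators alone controls the potential, so the distance
-- between the initial models plays no role.
omit w₀ in
theorem potential_le {x : PreState P K} (hx : x.Bounded B c) (hf : x.Fresh B (4 * c * θ.η * K))
    (hM : ∀ i, (P.S1 i).card ≤ M) : x.potential θ a ≤ P.f 0 + q + 48 * c ^ 2 * (θ.η / θ.β) +
      1440 * a ^ 2 * B ^ 2 * (M * θ.η / θ.γ) + θ.η * K * (240 * a ^ 2 * B ^ 2) := by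
  have : Nonempty (Fin N) := ⟨⟨0, hP.pos⟩⟩
  have : Nonempty (Fin K) := ⟨⟨0, hθ.K_pos⟩⟩
  have hη := hθ.η_pos
  have hb := hθ.β_pos
  have hg := hθ.γ_pos
  have hK : (0 : ℝ) < K := by exact_mod_cast hθ.K_pos
  have h1 : P.risk x.w ≤ P.f 0 + q := by linarith [(abs_le.1 (hP.risk_le x.w)).2]
  have h2 : ‖x.gap‖ ^ 2 ≤ 16 * c ^ 2 := by
    have h := (norm_sub_le x.G (gradient P.risk x.w)).trans (add_le_add hx.1 (hP.grad_le x.w))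
    have := pow_le_pow_left₀ (norm_nonneg _) h 2
    calc ‖x.gap‖ ^ 2 ≤ (2 * c + 2 * c) ^ 2 := this
      _ = _ := by ring
  have hsq : ∀ (u : ℝ) (z : Z), |u| ≤ B → (u - P.innerRisk x.w z) ^ 2 ≤ 4 * B ^ 2 := by
    intro u z hu
    have h := (abs_sub u (P.innerRisk x.w z)).trans (add_le_add hu (hP.inner_le x.w z))
    have := sq_le_sq' (abs_le.1 h).1 (abs_le.1 h).2
    linarith
  have h3 : x.innerPotential θ ≤ M / (θ.γ * K) * (4 * B ^ 2) := by
    refine Finset.expect_le Finset.univ_nonempty fun i _ => ?_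
    have hmM : ((P.S1 i).card : ℝ) ≤ M := by exact_mod_cast hM i
    have h4 : 𝔼 z, (x.u i z - P.innerRisk x.w z) ^ 2 ≤ 4 * B ^ 2 :=
      Finset.expect_le Finset.univ_nonempty fun z _ => hsq _ _ (hx.2 i z)
    gcongr
  have h4 : x.lag ≤ 4 * B ^ 2 :=
    Finset.expect_le Finset.univ_nonempty fun p _ =>
      Finset.expect_le Finset.univ_nonempty fun z _ => hsq _ _ (hf.2 p z)
  rw [PreState.potential]
  calc _ ≤ P.f 0 + q + 3 * θ.η / θ.β * (16 * c ^ 2) +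
        θ.η * K * (360 * a ^ 2 * (M / (θ.γ * K) * (4 * B ^ 2)) + 60 * a ^ 2 * (4 * B ^ 2)) := by
        gcongr
    _ = _ := by
        field_simp
        ring

omit w₀ in
theorem le_potential (x : PreState P K) : P.f 0 - q ≤ x.potential θ a := by
  have hη := hθ.η_pos
  have hb := hθ.β_pos
  have hg := hθ.γ_pos
  have h1 : P.f 0 - q ≤ P.risk x.w := by linarith [(abs_le.1 (hP.risk_le x.w)).1]
  have h3 : 0 ≤ x.innerPotential θ := Finset.expect_nonneg fun i _ =>
    mul_nonneg (by positivity) (Finset.expect_nonneg fun _ _ => sq_nonneg _)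
  have h4 : 0 ≤ x.lag := Finset.expect_nonneg fun i _ => Finset.expect_nonneg fun _ _ => sq_nonneg _
  rw [PreState.potential]
  have : 0 ≤ 3 * θ.η / θ.β * ‖x.gap‖ ^ 2 +
    θ.η * K * (360 * a ^ 2 * x.innerPotential θ + 60 * a ^ 2 * x.lag) := by positivity
  linarith

/-- Telescoping starts after round `1`, because the records of round `0` may be far from the
averaged model. It stops at `n < R`, because the transition out of round `R` would need draws that
the run does not contain. -/
theorem sum_gradNormSq_le (hM : ∀ i, (P.S1 i).card ≤ M) (h1 : 288 * L ^ 2 * (θ.η / θ.β) ^ 2 ≤ 1)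
    (h2 : 17280 * a ^ 2 * l ^ 2 * (M * θ.η / θ.γ) ^ 2 ≤ 1) {R : ℕ} :
    ∀ n < R, θ.η * K / 2 * ∑ r ∈ Finset.range n, gradNormSq P θ R K w₀ (r + 1) ≤
      (2 * q + 48 * c ^ 2 * (θ.η / θ.β) + 1440 * a ^ 2 * B ^ 2 * (M * θ.η / θ.γ) +
        θ.η * K * (240 * a ^ 2 * B ^ 2)) + n * (θ.η * K * PreState.roundError θ K B c l a b) := by
  have := P.nonempty_roundSample (K := K) hP.pos
  have step : ∀ n, n < R → θ.η * K / 2 * ∑ r ∈ Finset.range n, gradNormSq P θ R K w₀ (r + 1) ≤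
      (P.f 0 + q + 48 * c ^ 2 * (θ.η / θ.β) + 1440 * a ^ 2 * B ^ 2 * (M * θ.η / θ.γ) +
        θ.η * K * (240 * a ^ 2 * B ^ 2)) + n * (θ.η * K * PreState.roundError θ K B c l a b) -
      𝔼 ω : P.RunSample R K, (preRun P θ w₀ (drawSeq ω) (n + 1)).potential θ a := by
    intro n
    induction n with
    | zero =>
      intro _
      have h : 𝔼 ω : P.RunSample R K, (preRun P θ w₀ (drawSeq ω) (0 + 1)).potential θ a ≤ _ :=
        Finset.expect_le Finset.univ_nonempty fun ω _ =>
          potential_le hP hθ (preRun_bounded hP w₀ hθ (drawSeq ω) 1)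
            (preRun_fresh hP w₀ hθ (drawSeq ω) 0) hM
      simp only [Finset.range_zero, Finset.sum_empty, Nat.cast_zero]
      linarith
    | succ n ih =>
      intro hn
      have h := ih (by omega)
      have e := expect_preRun_succ (P := P) (K := K) hP.pos θ w₀ hn (fun x => x.potential θ a)
      have h3 : 𝔼 ω : P.RunSample R K, 𝔼 ν, ((preRun P θ w₀ (drawSeq ω) (n + 1)).next θ ν).potential
          θ a ≤ 𝔼 ω : P.RunSample R K, ((preRun P θ w₀ (drawSeq ω) (n + 1)).potential θ a -
          θ.η * K / 2 * ‖gradient P.risk (preRun P θ w₀ (drawSeq ω) (n + 1)).w‖ ^ 2 +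
            θ.η * K * PreState.roundError θ K B c l a b) := expect_mono fun ω =>
        PreState.expect_potential_next_le hP hθ (preRun_bounded hP w₀ hθ _ _)
          (preRun_fresh hP w₀ hθ _ _) hM h1 h2
      simp only [Finset.expect_add_distrib, Finset.expect_sub_distrib, ← Finset.mul_expect,
        Fintype.expect_const] at h3
      rw [Finset.sum_range_succ, mul_add, e]
      change _ + θ.η * K / 2 * (𝔼 ω : P.RunSample R K,
        ‖gradient P.risk (preRun P θ w₀ (drawSeq ω) (n + 1)).w‖ ^ 2) ≤ _
      push_cast
      linarith
  intro n hn
  have h := step n hn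
  have h3 : P.f 0 - q ≤ 𝔼 ω : P.RunSample R K,
      (preRun P θ w₀ (drawSeq ω) (n + 1)).potential θ a :=
    Finset.le_expect Finset.univ_nonempty fun ω _ => le_potential hP hθ _
  linarith

theorem expectedSqGrad_le (hM : ∀ i, (P.S1 i).card ≤ M) (h1 : 288 * L ^ 2 * (θ.η / θ.β) ^ 2 ≤ 1)
    (h2 : 17280 * a ^ 2 * l ^ 2 * (M * θ.η / θ.γ) ^ 2 ≤ 1)
    (hE : 0 ≤ PreState.roundError θ K B c l a b)
    {R : ℕ} (hR : 1 ≤ R) :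
    expectedSqGrad P θ R K w₀ ≤ (4 * c ^ 2 + 480 * a ^ 2 * B ^ 2) / R +
      (4 * q + 96 * c ^ 2 * (θ.η / θ.β) + 2880 * a ^ 2 * B ^ 2 * (M * θ.η / θ.γ)) /
        (R * (θ.η * K)) +
      2 * PreState.roundError θ K B c l a b := by
  have hR' : (0 : ℝ) < R := by exact_mod_cast hR
  have hη := hθ.η_pos
  have hK : (0 : ℝ) < K := by exact_mod_cast hθ.K_pos
  have hs : 0 < θ.η * K := by positivity
  obtain ⟨n, rfl⟩ : ∃ n, R = n + 1 := ⟨R - 1, by omega⟩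
  have h3 := sum_gradNormSq_le hP w₀ hθ hM h1 h2 (R := n + 1) n (Nat.lt_succ_self n)
  -- The last round escapes the telescoping sum and is bounded trivially, which accounts for the `4
  -- * c ^ 2 / R`.
  have h4 := gradNormSq_le (θ := θ) (K := K) hP w₀ (n + 1) (n + 1)
  have e : ∑ r ∈ Finset.Icc 1 (n + 1), gradNormSq P θ (n + 1) K w₀ r =
      ∑ r ∈ Finset.range n, gradNormSq P θ (n + 1) K w₀ (r + 1) +
        gradNormSq P θ (n + 1) K w₀ (n + 1) := by
    rw [← Finset.sum_range_succ, Finset.range_eq_Ico, Finset.sum_Ico_add' _ 0 (n + 1) 1]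
    rfl
  rw [expectedSqGrad_eq, e]
  set S := ∑ r ∈ Finset.range n, gradNormSq P θ (n + 1) K w₀ (r + 1)
  set E := PreState.roundError θ K B c l a b
  set A := 2 * q + 48 * c ^ 2 * (θ.η / θ.β) + 1440 * a ^ 2 * B ^ 2 * (M * θ.η / θ.γ) with hA
  have h5 : S ≤ 2 * A / (θ.η * K) + 480 * a ^ 2 * B ^ 2 + 2 * n * E := by
    rw [div_add' _ _ _ hs.ne', div_add' _ _ _ hs.ne', le_div_iff₀ hs]
    linarith
  have h6 : 2 * n * E ≤ 2 * ((n + 1 : ℕ) : ℝ) * E := by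
    gcongr
    norm_num
  rw [one_div, inv_mul_le_iff₀ hR']
  have h7 : ((n + 1 : ℕ) : ℝ) * ((4 * c ^ 2 + 480 * a ^ 2 * B ^ 2) / ((n + 1 : ℕ) : ℝ) +
      (4 * q + 96 * c ^ 2 * (θ.η / θ.β) + 2880 * a ^ 2 * B ^ 2 * (M * θ.η / θ.γ)) /
        (((n + 1 : ℕ) : ℝ) * (θ.η * K)) + 2 * E) =
      4 * c ^ 2 + 480 * a ^ 2 * B ^ 2 + 2 * A / (θ.η * K) + 2 * ((n + 1 : ℕ) : ℝ) * E := by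
    rw [hA]
    field_simp
    ring
  rw [h7]
  linarith

end Run


/-! ### Insertion of the step sizes. -/

section Rate

theorem roundError_le {θ : Rates} {K : ℕ} {B c l a b cγ cβ k₁ k₂ ρ : ℝ} (hB : 0 ≤ B) (hc : 0 ≤ c)
    (hl : 0 ≤ l) (hγ : θ.γ ≤ cγ * ρ) (hβ : θ.β ≤ cβ * ρ)
    (h1 : (θ.η * K) ^ 2 ≤ k₁ * ρ) (h2 : θ.γ * K * (θ.η * K) ≤ k₂ * ρ) :
    PreState.roundError θ K B c l a b ≤ (96 * c ^ 2 * cβ + 240 * a ^ 2 * B ^ 2 * cγ +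
      (240 * b ^ 2 + 120 * a ^ 2 * l ^ 2) * (16 * c ^ 2) * k₁ +
      660 * a ^ 2 * (16 * l ^ 2 * c ^ 2 * k₁ + 4 * B ^ 2 * cγ + 16 * l * c * B * k₂)) * ρ := by
  have e : PreState.roundError θ K B c l a b = 96 * c ^ 2 * θ.β + 240 * a ^ 2 * B ^ 2 * θ.γ +
      (240 * b ^ 2 + 120 * a ^ 2 * l ^ 2) * (16 * c ^ 2) * (θ.η * K) ^ 2 +
      660 * a ^ 2 * (16 * l ^ 2 * c ^ 2 * (θ.η * K) ^ 2 + 4 * B ^ 2 * θ.γ +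
        16 * l * c * B * (θ.γ * K * (θ.η * K))) := by
    rw [PreState.roundError, PreState.trackingError]
    ring
  rw [e]
  calc _ ≤ 96 * c ^ 2 * (cβ * ρ) + 240 * a ^ 2 * B ^ 2 * (cγ * ρ) +
      (240 * b ^ 2 + 120 * a ^ 2 * l ^ 2) * (16 * c ^ 2) * (k₁ * ρ) +
      660 * a ^ 2 * (16 * l ^ 2 * c ^ 2 * (k₁ * ρ) + 4 * B ^ 2 * (cγ * ρ) +
        16 * l * c * B * (k₂ * ρ)) := by gcongr
    _ = _ := by ring

theorem roundError_nonneg {θ : Rates} {K : ℕ} {B c l a b : ℝ} (hB : 0 ≤ B) (hc : 0 ≤ c)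
    (hl : 0 ≤ l) (hγ : 0 ≤ θ.γ) (hβ : 0 ≤ θ.β) (hη : 0 ≤ θ.η) :
    0 ≤ PreState.roundError θ K B c l a b := by
  rw [PreState.roundError, PreState.trackingError]
  positivity

/-- Bounds on the total step sizes of one round, for data size `s ^ 6` and `T ^ 3` rounds. -/
theorem round_steps_le {θ : Rates} {K : ℕ} {s T cγ cβ cK cη : ℝ} (hγ : 0 < cγ) (hβ : 0 < cβ)
    (hη : 0 < cη) (hs : 0 < s) (hT : 0 < T) (eγ : θ.γ = cγ * s ^ 2 / T ^ 2)
    (eβ : θ.β = cβ / (s * T ^ 2)) (eη : θ.η = cη / (s ^ 4 * T ^ 2))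
    (hKl : cK * s ^ 2 * T ≤ K) (hKu : (K : ℝ) ≤ 2 * cK * s ^ 2 * T) :
    θ.η * K ≤ 2 * cη * cK / (s ^ 2 * T) ∧ cη * cK / (s ^ 2 * T) ≤ θ.η * K ∧
      θ.γ * K ≤ 2 * cγ * cK * s ^ 4 / T ∧ θ.β * K ≤ 2 * cK * cβ * s / T := by
  rw [eγ, eβ, eη]
  refine ⟨?_, ?_, ?_, ?_⟩
  · calc cη / (s ^ 4 * T ^ 2) * K ≤ cη / (s ^ 4 * T ^ 2) * (2 * cK * s ^ 2 * T) :=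
          mul_le_mul_of_nonneg_left hKu (by positivity)
      _ = _ := by field_simp
  · calc cη * cK / (s ^ 2 * T) = cη / (s ^ 4 * T ^ 2) * (cK * s ^ 2 * T) := by field_simp
      _ ≤ _ := mul_le_mul_of_nonneg_left hKl (by positivity)
  · calc cγ * s ^ 2 / T ^ 2 * K ≤ cγ * s ^ 2 / T ^ 2 * (2 * cK * s ^ 2 * T) :=
          mul_le_mul_of_nonneg_left hKu (by positivity)
      _ = _ := by field_simp
  · calc cβ / (s * T ^ 2) * K ≤ cβ / (s * T ^ 2) * (2 * cK * s ^ 2 * T) :=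
          mul_le_mul_of_nonneg_left hKu (by positivity)
      _ = _ := by field_simp

theorem admissible_of_le {θ : Rates} {K M : ℕ} {L s T X cγ cβ cK cη : ℝ} (hγ : 0 < cγ)
    (hβ : 0 < cβ) (hη : 0 < cη) (hL : 0 ≤ L) (hs : 1 ≤ s) (hT : 0 < T)
    (hM : (M : ℝ) = s ^ 6) (eγ : θ.γ = cγ * s ^ 2 / T ^ 2)
    (eβ : θ.β = cβ / (s * T ^ 2)) (eη : θ.η = cη / (s ^ 4 * T ^ 2)) (hK : (0 : ℝ) < K)
    (hηK : θ.η * K ≤ 2 * cη * cK / (s ^ 2 * T)) (hγK : θ.γ * K ≤ 2 * cγ * cK * s ^ 4 / T)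
    (hβK : θ.β * K ≤ 2 * cK * cβ * s / T) (hreg : X * s ≤ T) (hX1 : 1 ≤ X) (hXγ : cγ ≤ X)
    (hXβ : 2 * cK * cβ ≤ X) (hXK : 2 * cγ * cK ≤ X) (hXη : 8 * cη * cK * L ≤ X) :
    θ.Admissible K M L := by
  have hs0 : 0 < s := by linarith
  have hXs : ∀ y : ℝ, y ≤ X → y ≤ T := fun y hy =>
    (hy.trans (le_mul_of_one_le_right (by linarith) hs)).trans hreg
  have h2 : 1 ≤ s ^ 2 := one_le_pow₀ hs
  refine
    { K_pos := by exact_mod_cast hK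
      γ_pos := ?_
      γ_le := ?_
      β_pos := ?_
      βK_le := ?_
      η_pos := ?_
      γK_le := ?_
      ηK_le := ?_ }
  · rw [eγ]; positivity
  · rw [eγ, div_le_one (by positivity)]
    have h3 : (X * s) ^ 2 ≤ T ^ 2 := pow_le_pow_left₀ (by positivity) hreg 2
    have h4 : cγ ≤ X ^ 2 := by nlinarith
    calc cγ * s ^ 2 ≤ X ^ 2 * s ^ 2 := mul_le_mul_of_nonneg_right h4 (by positivity)
      _ = (X * s) ^ 2 := by ring
      _ ≤ _ := h3
  · rw [eβ]; positivity
  · refine hβK.trans ?_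
    rw [div_le_one hT]
    exact (mul_le_mul_of_nonneg_right hXβ hs0.le).trans hreg
  · rw [eη]; positivity
  · refine hγK.trans ?_
    rw [hM, div_le_iff₀ hT]
    calc 2 * cγ * cK * s ^ 4 ≤ T * s ^ 4 :=
          mul_le_mul_of_nonneg_right (hXs _ hXK) (by positivity)
      _ ≤ T * s ^ 4 * s ^ 2 := le_mul_of_one_le_right (by positivity) h2
      _ = _ := by ring
  · refine (mul_le_mul_of_nonneg_right hηK hL).trans ?_
    rw [div_mul_eq_mul_div, div_le_iff₀ (by positivity)]
    have h3 := hXs _ hXη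
    nlinarith

theorem mul_sq_le_one {m n x : ℝ} (hn : 0 ≤ n) (hx : 0 ≤ x) (h : n * x ≤ 1) (hm : m ≤ n ^ 2) :
    m * x ^ 2 ≤ 1 :=
  calc m * x ^ 2 ≤ n ^ 2 * x ^ 2 := mul_le_mul_of_nonneg_right hm (sq_nonneg x)
    _ = (n * x) ^ 2 := by ring
    _ ≤ 1 := pow_le_one₀ (mul_nonneg hn hx) h

/-- The rate in the regime where the rates are admissible. -/
theorem expectedSqGrad_le_rate {N d : ℕ} {Z : Type*} {P : Problem N d Z}
    {B c q l L a b cγ cβ cK cη s T : ℝ} {θ : Rates} {K M R : ℕ}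
    (h0 : 0 ≤ B ∧ 0 ≤ c ∧ 0 ≤ q ∧ 0 ≤ l ∧ 0 ≤ L ∧ 0 ≤ a ∧ 0 ≤ b)
    (hP : P.Bounds B c q l L a b) (w₀ : Fin N → Vec d)
    (hγ : 0 < cγ) (hβ : 0 < cβ) (hK : 0 < cK) (hη : 0 < cη)
    (h1 : 17 * L * cη ≤ cβ) (h2 : 132 * a * l * cη ≤ cγ)
    (hM : ∀ i, (P.S1 i).card ≤ M) (hs : 1 ≤ s) (hT : 1 ≤ T)
    (hMs : (M : ℝ) = s ^ 6) (hRT : (R : ℝ) = T ^ 3) (hR : 1 ≤ R)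
    (eγ : θ.γ = cγ * s ^ 2 / T ^ 2) (eβ : θ.β = cβ / (s * T ^ 2))
    (eη : θ.η = cη / (s ^ 4 * T ^ 2)) (hθ : θ.Admissible K M L)
    (hηK : θ.η * K ≤ 2 * cη * cK / (s ^ 2 * T)) (hηK' : cη * cK / (s ^ 2 * T) ≤ θ.η * K)
    (hγK : θ.γ * K ≤ 2 * cγ * cK * s ^ 4 / T) :
    expectedSqGrad P θ R K w₀ ≤ ((4 * c ^ 2 + 480 * a ^ 2 * B ^ 2) +
      (4 * q + 96 * c ^ 2 * (cη / cβ) + 2880 * a ^ 2 * B ^ 2 * (cη / cγ)) / (cη * cK) +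
      2 * (96 * c ^ 2 * cβ + 240 * a ^ 2 * B ^ 2 * cγ +
      (240 * b ^ 2 + 120 * a ^ 2 * l ^ 2) * (16 * c ^ 2) * (4 * cη ^ 2 * cK ^ 2) +
      660 * a ^ 2 * (16 * l ^ 2 * c ^ 2 * (4 * cη ^ 2 * cK ^ 2) + 4 * B ^ 2 * cγ +
        16 * l * c * B * (4 * cγ * cη * cK ^ 2)))) * (s ^ 2 / T ^ 2) := by
  obtain ⟨hB, hc, hq, hl, hL, ha, hb⟩ := h0
  obtain ⟨E, hE⟩ : ∃ E, E = 96 * c ^ 2 * cβ + 240 * a ^ 2 * B ^ 2 * cγ +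
      (240 * b ^ 2 + 120 * a ^ 2 * l ^ 2) * (16 * c ^ 2) * (4 * cη ^ 2 * cK ^ 2) +
      660 * a ^ 2 * (16 * l ^ 2 * c ^ 2 * (4 * cη ^ 2 * cK ^ 2) + 4 * B ^ 2 * cγ +
        16 * l * c * B * (4 * cγ * cη * cK ^ 2)) := ⟨_, rfl⟩
  obtain ⟨A, hA⟩ : ∃ A, A = 4 * q + 96 * c ^ 2 * (cη / cβ) + 2880 * a ^ 2 * B ^ 2 * (cη / cγ) :=
    ⟨_, rfl⟩
  have hA0 : 0 ≤ A := by rw [hA]; positivity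
  rw [← hE, ← hA]
  have hs0 : 0 < s := by linarith
  have hT0 : 0 < T := by linarith
  have hKp : (0 : ℝ) < K := by exact_mod_cast hθ.K_pos
  have hηβ : θ.η / θ.β = cη / cβ / s ^ 3 := by
    rw [eη, eβ]
    field_simp
  have hηβ' : θ.η / θ.β ≤ cη / cβ := by
    rw [hηβ]
    exact div_le_self (by positivity) (one_le_pow₀ hs)
  have hηγ : M * θ.η / θ.γ = cη / cγ := by
    rw [eη, eγ, hMs]
    field_simp
  have hηβ0 : 0 ≤ θ.η / θ.β := by rw [hηβ]; positivity
  -- The numbers in the smallness conditions come from `17 ^ 2 ≥ 288` and `132 ^ 2 ≥ 17280`.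
  have g1 : 288 * L ^ 2 * (θ.η / θ.β) ^ 2 ≤ 1 := by
    have h3 : 17 * (L * (θ.η / θ.β)) ≤ 1 := by
      calc 17 * (L * (θ.η / θ.β)) ≤ 17 * (L * (cη / cβ)) := by gcongr
        _ = 17 * L * cη / cβ := by ring
        _ ≤ 1 := (div_le_one hβ).2 h1
    calc 288 * L ^ 2 * (θ.η / θ.β) ^ 2 = 288 * (L * (θ.η / θ.β)) ^ 2 := by ring
      _ ≤ 1 := mul_sq_le_one (by norm_num) (by positivity) h3 (by norm_num)
  have g2 : 17280 * a ^ 2 * l ^ 2 * (M * θ.η / θ.γ) ^ 2 ≤ 1 := by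
    rw [hηγ]
    have h3 : 132 * (a * l * (cη / cγ)) ≤ 1 := by
      calc 132 * (a * l * (cη / cγ)) = 132 * a * l * cη / cγ := by ring
        _ ≤ 1 := (div_le_one hγ).2 h2
    calc 17280 * a ^ 2 * l ^ 2 * (cη / cγ) ^ 2 = 17280 * (a * l * (cη / cγ)) ^ 2 := by ring
      _ ≤ 1 := mul_sq_le_one (by norm_num) (by positivity) h3 (by norm_num)
  have hE' : PreState.roundError θ K B c l a b ≤ E * (s ^ 2 / T ^ 2) := by
    rw [hE]
    refine roundError_le hB hc hl ?_ ?_ ?_ ?_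
    · exact (eγ.trans (mul_div_assoc _ _ _)).le
    · rw [eβ, ← mul_div_assoc, div_le_div_iff₀ (by positivity) (by positivity)]
      have h3 : 1 ≤ s ^ 2 * s := one_le_mul_of_one_le_of_one_le (one_le_pow₀ hs) hs
      calc cβ * T ^ 2 = cβ * T ^ 2 * 1 := by ring
        _ ≤ cβ * T ^ 2 * (s ^ 2 * s) := by gcongr
        _ = _ := by ring
    · have h3 : 0 ≤ θ.η * K := mul_nonneg hθ.η_pos.le hKp.le
      refine (pow_le_pow_left₀ h3 hηK 2).trans ?_
      rw [div_pow, ← mul_div_assoc, div_le_div_iff₀ (by positivity) (by positivity)]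
      have h4 : 1 ≤ s ^ 6 := one_le_pow₀ hs
      calc (2 * cη * cK) ^ 2 * T ^ 2 = 4 * cη ^ 2 * cK ^ 2 * T ^ 2 * 1 := by ring
        _ ≤ 4 * cη ^ 2 * cK ^ 2 * T ^ 2 * s ^ 6 := by gcongr
        _ = _ := by ring
    · have h3 : 0 ≤ θ.η * K := mul_nonneg hθ.η_pos.le hKp.le
      calc θ.γ * K * (θ.η * K) ≤ 2 * cγ * cK * s ^ 4 / T * (2 * cη * cK / (s ^ 2 * T)) := by
            gcongr
        _ = _ := by field_simp; ring
  have hE0' : 0 ≤ PreState.roundError θ K B c l a b :=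
    roundError_nonneg hB hc hl hθ.γ_pos.le hθ.β_pos.le hθ.η_pos.le
  have main := expectedSqGrad_le hP w₀ hθ hM g1 g2 hE0' hR
  refine main.trans ?_
  have t1 : (4 * c ^ 2 + 480 * a ^ 2 * B ^ 2) / R ≤
      (4 * c ^ 2 + 480 * a ^ 2 * B ^ 2) * (s ^ 2 / T ^ 2) := by
    rw [div_eq_mul_inv, hRT]
    gcongr
    rw [inv_eq_one_div, div_le_div_iff₀ (by positivity) (by positivity), one_mul]
    have h3 : 1 ≤ s ^ 2 := one_le_pow₀ hs
    calc T ^ 2 = 1 * T ^ 2 * 1 := by ring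
      _ ≤ s ^ 2 * T ^ 2 * T := by gcongr
      _ = _ := by ring
  have t2 : (4 * q + 96 * c ^ 2 * (θ.η / θ.β) + 2880 * a ^ 2 * B ^ 2 * (M * θ.η / θ.γ)) /
      (R * (θ.η * K)) ≤ A / (cη * cK) * (s ^ 2 / T ^ 2) := by
    have h3 : 4 * q + 96 * c ^ 2 * (θ.η / θ.β) + 2880 * a ^ 2 * B ^ 2 * (M * θ.η / θ.γ) ≤ A := by
      rw [hηγ, hA]
      gcongr
    calc _ ≤ A / (R * (cη * cK / (s ^ 2 * T))) := by
          rw [hRT]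
          gcongr
      _ = _ := by
          rw [hRT]
          field_simp
  linarith

/-- The convergence rate, with the sizes `M = s ^ 6` and `R = T ^ 3`. -/
theorem exists_rate_constant {B c q l L a b cγ cβ cK cη : ℝ}
    (h0 : 0 ≤ B ∧ 0 ≤ c ∧ 0 ≤ q ∧ 0 ≤ l ∧ 0 ≤ L ∧ 0 ≤ a ∧ 0 ≤ b)
    (hγ : 0 < cγ) (hβ : 0 < cβ) (hK : 0 < cK) (hη : 0 < cη)
    (h1 : 17 * L * cη ≤ cβ) (h2 : 132 * a * l * cη ≤ cγ) :
    ∃ C : ℝ, 0 < C ∧ ∀ (N d : ℕ) (Z : Type*) (P : Problem N d Z), P.Bounds B c q l L a b →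
      ∀ (w₀ : Fin N → Vec d) (M R : ℕ) (s T : ℝ), (∀ i, (P.S1 i).card ≤ M) → 1 ≤ s → 1 ≤ T →
        (M : ℝ) = s ^ 6 → (R : ℝ) = T ^ 3 →
        expectedSqGrad P ⟨cγ * s ^ 2 / T ^ 2, cβ / (s * T ^ 2), cη / (s ^ 4 * T ^ 2)⟩ R
          ⌈cK * s ^ 2 * T⌉₊ w₀ ≤ C * (s ^ 2 / T ^ 2) := by
  have h0' := h0
  obtain ⟨hB, hc, hq, hl, hL, ha, hb⟩ := h0'
  have hinv : 0 < 1 / cK := by positivity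
  have hnn := mul_nonneg (mul_pos hη hK).le hL
  have hkb := mul_pos hK hβ
  have hgk := mul_pos hγ hK
  -- A single threshold for all admissibility conditions. The summand `1 / cK` makes `cK * s ^ 2 * T
  -- ≥ 1`, so that rounding up at most doubles the number of iterations.
  obtain ⟨X, hX⟩ : ∃ X, X = 1 + cγ + 2 * cK * cβ + 2 * cγ * cK + 8 * cη * cK * L + 1 / cK :=
    ⟨_, rfl⟩
  have hX1 : 1 ≤ X := by rw [hX]; linarith
  obtain ⟨D, hD⟩ : ∃ D, D = ((4 * c ^ 2 + 480 * a ^ 2 * B ^ 2) +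
      (4 * q + 96 * c ^ 2 * (cη / cβ) + 2880 * a ^ 2 * B ^ 2 * (cη / cγ)) / (cη * cK) +
      2 * (96 * c ^ 2 * cβ + 240 * a ^ 2 * B ^ 2 * cγ +
      (240 * b ^ 2 + 120 * a ^ 2 * l ^ 2) * (16 * c ^ 2) * (4 * cη ^ 2 * cK ^ 2) +
      660 * a ^ 2 * (16 * l ^ 2 * c ^ 2 * (4 * cη ^ 2 * cK ^ 2) + 4 * B ^ 2 * cγ +
        16 * l * c * B * (4 * cγ * cη * cK ^ 2)))) := ⟨_, rfl⟩
  have hD0 : 0 ≤ D := by rw [hD]; positivity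
  refine ⟨1 + 4 * c ^ 2 * X ^ 2 + D, by positivity,
    fun N d Z P hP w₀ M R s T hM hs hT hMs hRT => ?_⟩
  have hs0 : 0 < s := by linarith
  have hT0 : 0 < T := by linarith
  have hR : 1 ≤ R := by
    have : (1 : ℝ) ≤ R := hRT ▸ one_le_pow₀ hT
    exact_mod_cast this
  have hρ : 0 < s ^ 2 / T ^ 2 := by positivity
  -- In the opposite case `s ^ 2 / T ^ 2` exceeds `1 / X ^ 2`, and the bound `4 * c ^ 2` on the
  -- squared gradient suffices.
  by_cases hreg : X * s ≤ T
  · have hKl := Nat.le_ceil (cK * s ^ 2 * T)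
    have hx1 : 1 / cK ≤ T := by
      refine le_trans ?_ ((le_mul_of_one_le_right (by linarith) hs).trans hreg)
      rw [hX]
      linarith
    have hone : 1 ≤ cK * s ^ 2 * T := by
      rw [div_le_iff₀ hK] at hx1
      have : 1 ≤ s ^ 2 := one_le_pow₀ hs
      nlinarith [mul_pos hT0 hK]
    have hKu : (⌈cK * s ^ 2 * T⌉₊ : ℝ) ≤ 2 * cK * s ^ 2 * T := by
      have := Nat.ceil_lt_add_one (show 0 ≤ cK * s ^ 2 * T by positivity)
      linarith
    obtain ⟨s1, s2, s3, s4⟩ := round_steps_le (θ := ⟨cγ * s ^ 2 / T ^ 2, cβ / (s * T ^ 2),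
      cη / (s ^ 4 * T ^ 2)⟩) hγ hβ hη hs0 hT0 rfl rfl rfl hKl hKu
    have hθ := admissible_of_le hγ hβ hη hL hs hT0 hMs rfl rfl rfl (by linarith) s1 s3 s4 hreg hX1
      (by rw [hX]; linarith) (by rw [hX]; linarith) (by rw [hX]; linarith) (by rw [hX]; linarith)
    have h := expectedSqGrad_le_rate h0 hP w₀ hγ hβ hK hη h1 h2 hM hs hT hMs hRT hR rfl rfl rfl
      hθ s1 s2 s3
    rw [← hD] at h
    refine h.trans (mul_le_mul_of_nonneg_right ?_ hρ.le)
    linarith [show 0 ≤ 4 * c ^ 2 * X ^ 2 by positivity]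
  · refine (expectedSqGrad_le_const hP w₀ hR).trans ?_
    have h3 : 1 ≤ X ^ 2 * (s ^ 2 / T ^ 2) := by
      rw [← mul_div_assoc, one_le_div (by positivity), ← mul_pow]
      exact pow_le_pow_left₀ hT0.le (not_le.1 hreg).le 2
    have h4 := mul_le_mul_of_nonneg_left h3 (show 0 ≤ 4 * c ^ 2 by positivity)
    have h5 : 0 ≤ (1 + D) * (s ^ 2 / T ^ 2) := by positivity
    linarith

theorem rpow_div_pow {x : ℝ} (hx : 0 ≤ x) {m n : ℕ} (p : ℝ) (h : (n : ℝ) / m = p) :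
    x ^ p = (x ^ (1 / (m : ℝ))) ^ n := by
  rw [← Real.rpow_natCast (x ^ (1 / (m : ℝ))), ← Real.rpow_mul hx, ← h]
  congr 1
  ring

theorem one_le_maxData {N d : ℕ} {Z : Type*} (P : Problem N d Z) (hN : 0 < N) : 1 ≤ P.maxData :=
  ((P.nonempty1 (⟨0, hN⟩ : Fin N)).card_pos).trans_le
    (Finset.le_sup (f := fun i => (P.S1 i).card) (Finset.mem_univ (⟨0, hN⟩ : Fin N)))

/-- `T ^ 3` rounds with `T` of the order of `s / ε` reach the accuracy `ε ^ 2`. -/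
theorem rate_le_sq {C s T ε : ℝ} (hC : 0 < C) (hs : 0 < s) (hε : 0 < ε) (hT : 0 < T)
    (h : (1 + C) * s / ε ≤ T) : C * (s ^ 2 / T ^ 2) ≤ ε ^ 2 := by
  rw [div_le_iff₀ hε] at h
  have h1 := pow_le_pow_left₀ (by positivity) h 2
  rw [← mul_div_assoc, div_le_iff₀ (by positivity)]
  have h2 : C ≤ (1 + C) ^ 2 := by nlinarith
  calc C * s ^ 2 ≤ (1 + C) ^ 2 * s ^ 2 := by gcongr
    _ = ((1 + C) * s) ^ 2 := by ring
    _ ≤ (T * ε) ^ 2 := h1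
    _ = _ := by ring

/-- The sample count is of order `T ^ 3 * k`, thus `s ^ 2 * T ^ 4`, and `T` of order `s / ε` turns
it into `s ^ 6 / ε ^ 4`. The constant is `96 = 6 * 2 ^ 4`. -/
theorem samples_le {C s T ε cK k : ℝ} (hs : 0 < s) (hcK : 0 < cK)
    (hT : 1 ≤ T) (h : T ≤ 2 * ((1 + C) * s / ε)) (hk0 : 0 ≤ k) (hk : k ≤ (cK + 1) * s ^ 2 * T) :
    2 * k + 4 * T ^ 3 * k ≤ 96 * (cK + 1) * (1 + C) ^ 4 * s ^ 6 / ε ^ 4 := by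
  have hT3 : 1 ≤ T ^ 3 := one_le_pow₀ hT
  have hT0 : 0 < T := by linarith
  have h4 := pow_le_pow_left₀ hT0.le h 4
  calc 2 * k + 4 * T ^ 3 * k ≤ 6 * T ^ 3 * k := by nlinarith
    _ ≤ 6 * T ^ 3 * ((cK + 1) * s ^ 2 * T) := mul_le_mul_of_nonneg_left hk (by positivity)
    _ = 6 * (cK + 1) * s ^ 2 * T ^ 4 := by ring
    _ ≤ 6 * (cK + 1) * s ^ 2 * (2 * ((1 + C) * s / ε)) ^ 4 :=
        mul_le_mul_of_nonneg_left h4 (by positivity)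
    _ = _ := by ring

end Rate

end FedX
end

/-! ### The theorem. -/

/-- Convergence of FedX2. The constant `c₀` depends only on the regularity constants and on
`cγ, cβ, cK`, and `C₁, C₂, C₃` only on these and `cη`. -/
theorem theorem2 (C₀ Cℓ Lℓ Cf Lf Ch Lh : ℝ≥0) (cγ cβ cK : ℝ)
    (hγ : 0 < cγ) (hβ : 0 < cβ) (hK : 0 < cK) :
    ∃ c₀ : ℝ, 0 < c₀ ∧ ∀ cη : ℝ, 0 < cη → cη ≤ c₀ →
      ∃ C₁ C₂ C₃ : ℝ, 0 < C₁ ∧ 0 < C₂ ∧ 0 < C₃ ∧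
        ∀ (N d : ℕ) (Z : Type*) (P : FedX.Problem N d Z), 0 < N →
          P.Regular C₀ Cℓ Lℓ Cf Lf Ch Lh → ∀ w₀ : Fin N → FedX.Vec d,
          (∀ R : ℕ, 1 ≤ R →
            FedX.expectedSqGrad P (FedX.rates cγ cβ cη P.maxData R) R
                (FedX.iterations cK P.maxData R) w₀
              ≤ C₁ * (P.maxData : ℝ) ^ (1 / 3 : ℝ) / (R : ℝ) ^ (2 / 3 : ℝ)) ∧
          (∀ ε : ℝ, 0 < ε → ε ≤ 1 → ∀ R : ℕ, R = ⌈C₂ * √(P.maxData : ℝ) / ε ^ 3⌉₊ →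
            FedX.expectedSqGrad P (FedX.rates cγ cβ cη P.maxData R) R
                (FedX.iterations cK P.maxData R) w₀ ≤ ε ^ 2 ∧
            (FedX.samplesPerClient R (FedX.iterations cK P.maxData R) : ℝ)
              ≤ C₃ * (P.maxData : ℝ) / ε ^ 4) := by
  obtain ⟨B, c, q, l, L, a, b, h0, hbounds⟩ :=
    FedX.Problem.Regular.exists_bounds C₀ Cℓ Lℓ Cf Lf Ch Lh
  obtain ⟨hB, hc, hq, hl, hL, ha, hb⟩ := id h0
  -- The reciprocal of a sum enforces both smallness conditions at once; the summand `1` keeps it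
  -- defined when `L` or `a * l` vanishes.
  refine ⟨(1 + 17 * L / cβ + 132 * a * l / cγ)⁻¹, by positivity, fun cη hη hle => ?_⟩
  have hden : (1 + 17 * L / cβ + 132 * a * l / cγ) * cη ≤ 1 := by
    have h := mul_le_mul_of_nonneg_left hle
      (show 0 ≤ 1 + 17 * L / cβ + 132 * a * l / cγ by positivity)
    rwa [mul_inv_cancel₀ (by positivity)] at h
  have e1 : 0 ≤ 17 * L / cβ * cη := by positivity
  have e2 : 0 ≤ 132 * a * l / cγ * cη := by positivity
  have g1 : 17 * L * cη ≤ cβ := by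
    have : 17 * L / cβ * cη ≤ 1 := by linarith
    rwa [div_mul_eq_mul_div, div_le_one hβ] at this
  have g2 : 132 * a * l * cη ≤ cγ := by
    have : 132 * a * l / cγ * cη ≤ 1 := by linarith
    rwa [div_mul_eq_mul_div, div_le_one hγ] at this
  obtain ⟨C, hC, hrate⟩ := FedX.exists_rate_constant h0 hγ hβ hK hη g1 g2
  -- The second constant is a cube so that `R` is, up to rounding, the cube of `(1 + C) * s / ε`.
  -- Having `1 + C` in place of `C` gives both `(1 + C) ^ 2 ≥ C` and a base of at least `1`, so
  -- rounding `R` up at most doubles it.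
  refine ⟨C, (1 + C) ^ 3, 96 * (cK + 1) * (1 + C) ^ 4, hC, by positivity, by positivity,
    fun N d Z P hN hP w₀ => ?_⟩
  have hM1 : (1 : ℝ) ≤ P.maxData := by exact_mod_cast FedX.one_le_maxData P hN
  obtain ⟨s, hs⟩ : ∃ s : ℝ, s = (P.maxData : ℝ) ^ (1 / 6 : ℝ) := ⟨_, rfl⟩
  have hs1 : 1 ≤ s := hs ▸ Real.one_le_rpow hM1 (by norm_num)
  have hM0 : (0 : ℝ) ≤ P.maxData := by linarith
  have m2 : (P.maxData : ℝ) ^ (1 / 3 : ℝ) = s ^ 2 :=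
    hs ▸ FedX.rpow_div_pow hM0 (m := 6) (n := 2) _ (by norm_num)
  have m4 : (P.maxData : ℝ) ^ (2 / 3 : ℝ) = s ^ 4 :=
    hs ▸ FedX.rpow_div_pow hM0 (m := 6) (n := 4) _ (by norm_num)
  have m6 : (P.maxData : ℝ) = s ^ 6 := by
    rw [hs]
    refine (Real.rpow_one (P.maxData : ℝ)).symm.trans ?_
    exact FedX.rpow_div_pow hM0 (m := 6) (n := 6) _ (by norm_num)
  have m3 : √(P.maxData : ℝ) = s ^ 3 := by
    rw [m6, show s ^ 6 = (s ^ 3) ^ 2 by ring, Real.sqrt_sq (by positivity)]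
  have main : ∀ (R : ℕ), 1 ≤ R → ∃ T : ℝ, 1 ≤ T ∧ (R : ℝ) = T ^ 3 ∧
      (R : ℝ) ^ (2 / 3 : ℝ) = T ^ 2 ∧ (FedX.iterations cK P.maxData R) = ⌈cK * s ^ 2 * T⌉₊ ∧
      FedX.expectedSqGrad P (FedX.rates cγ cβ cη P.maxData R) R
        (FedX.iterations cK P.maxData R) w₀ ≤ C * (s ^ 2 / T ^ 2) := by
    intro R hR
    have hR1 : (1 : ℝ) ≤ R := by exact_mod_cast hR
    have hR0 : (0 : ℝ) ≤ R := by linarith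
    obtain ⟨T, hT⟩ : ∃ T : ℝ, T = (R : ℝ) ^ (1 / 3 : ℝ) := ⟨_, rfl⟩
    have hT1 : 1 ≤ T := hT ▸ Real.one_le_rpow hR1 (by norm_num)
    have r2 : (R : ℝ) ^ (2 / 3 : ℝ) = T ^ 2 :=
      hT ▸ FedX.rpow_div_pow hR0 (m := 3) (n := 2) _ (by norm_num)
    have r3 : (R : ℝ) = T ^ 3 := by
      rw [hT]
      refine (Real.rpow_one (R : ℝ)).symm.trans ?_
      exact FedX.rpow_div_pow hR0 (m := 3) (n := 3) _ (by norm_num)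
    refine ⟨T, hT1, r3, r2, ?_, ?_⟩
    · rw [FedX.iterations, m2, ← hT]
    · have h := hrate N d Z P (hbounds N d Z P hN hP) w₀ P.maxData R s T
        (fun i => Finset.le_sup (f := fun i => (P.S1 i).card) (Finset.mem_univ i)) hs1 hT1 m6 r3
      rw [FedX.rates, FedX.iterations, m2, m4, r2, ← hT, ← hs]
      exact h
  have hY : 1 ≤ 1 + C := by linarith
  refine ⟨fun R hR => ?_, fun ε hε hε1 R hRdef => ?_⟩
  · obtain ⟨T, -, -, r2, -, h⟩ := main R hR
    rw [r2, m2, mul_div_assoc]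
    exact h
  · have hRl : (1 + C) ^ 3 * s ^ 3 / ε ^ 3 ≤ R := by
      rw [hRdef, m3]
      exact Nat.le_ceil _
    have hbase : 1 ≤ (1 + C) * s / ε := by
      rw [one_le_div hε]
      nlinarith
    have hcube : (1 + C) ^ 3 * s ^ 3 / ε ^ 3 = ((1 + C) * s / ε) ^ 3 := by
      rw [div_pow, mul_pow]
    rw [hcube] at hRl
    have hR : 1 ≤ R := by
      have : (1 : ℝ) ≤ R := (one_le_pow₀ hbase).trans hRl
      exact_mod_cast this
    have hRu : (R : ℝ) ≤ (2 * ((1 + C) * s / ε)) ^ 3 := by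
      have h1 : (R : ℝ) ≤ ((1 + C) * s / ε) ^ 3 + 1 := by
        rw [hRdef, m3, ← hcube]
        exact (Nat.ceil_lt_add_one (by positivity)).le
      have h2 : 1 ≤ ((1 + C) * s / ε) ^ 3 := one_le_pow₀ hbase
      rw [mul_pow]
      linarith
    obtain ⟨T, hT1, r3, -, hKe, h⟩ := main R hR
    have hT0 : 0 < T := by linarith
    rw [r3] at hRl hRu
    have hTl : (1 + C) * s / ε ≤ T := le_of_pow_le_pow_left₀ three_ne_zero hT0.le hRl
    have hTu : T ≤ 2 * ((1 + C) * s / ε) :=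
      le_of_pow_le_pow_left₀ three_ne_zero (by positivity) hRu
    have hs0 : 0 < s := by linarith
    refine ⟨h.trans (FedX.rate_le_sq hC hs0 hε hT0 hTl), ?_⟩
    have hKu : ((FedX.iterations cK P.maxData R : ℕ) : ℝ) ≤ (cK + 1) * s ^ 2 * T := by
      rw [hKe]
      have h1 := Nat.ceil_lt_add_one (show 0 ≤ cK * s ^ 2 * T by positivity)
      have h2 : 1 ≤ s ^ 2 * T := one_le_mul_of_one_le_of_one_le (one_le_pow₀ hs1) hT1
      linarith
    have hfin := FedX.samples_le hs0 hK hT1 hTu (Nat.cast_nonneg _) hKu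
    rw [← r3, ← m6] at hfin
    rw [FedX.samplesPerClient]
    push_cast
    rwa [← mul_assoc]
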